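/- Let $\mathcal H$ be a separable complex Hilbert space with inner product $(\cdot,\cdot)$ linear in the first entry, let $M,N\ge 0$ be integers with $M+N\le\dim\mathcal H$, and let $m_1\ge\dots\ge m_M>0$ and $n_1\ge\dots\ge n_N>0$ be real numbers. Left side. Let $U_0(\mathcal H)$ be the group of unitary operators $U$ on $\mathcal H$ with $U-1$ compact, let $\mathfrak g$ be its Lie algebra, the real Banach space of skew-adjoint compact operators with the operator norm, and let $\mathfrak g^*$ be the dual Banach space, i.e. the space of self-adjoint trace-class operators $\rho$ with the trace norm, paired with $\mathfrak g$ by $\langle\rho,X\rangle=i\,\mathrm{Tr}(\rho X)$. The coadjoint action is $\rho\mapsto U\rho U^*$, and $X\in\mathfrak g$ acts infinitesimally by $X\cdot\rho=[X,\rho]$. Let $\mathcal O_{m,n}\subset\mathfrak g^*$ be the set of self-adjoint trace-class operators whose nonzero eigenvalues, counted with multiplicity, are $m_1,\dots,m_M,-n_N,\dots,-n_1$. Right side. Let $S=\mathcal H\otimes\mathbb C^{M+N}$, with elements $\psi=\sum_i\psi_i\otimes e_i$, the indefinite form $(\psi,\varphi)_S=\sum_{i\le M}(\psi_i,\varphi_i)-\sum_{i>M}(\psi_i,\varphi_i)$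 and the symplectic form $\omega(\psi,\varphi)=-2\,\mathrm{Im}\,(\psi,\varphi)_S$. The group $H=U(M,N)$ acts on $S$ from the right by $U\mapsto 1\otimes U^T$, and $U_0(\mathcal H)$ acts from the left by $U\mapsto U\otimes 1$. Put $\langle J_R(\psi),X\rangle=i\,((1\otimes X^T)\psi,\psi)_S$ for $X\in\mathfrak h=\mathfrak u(M,N)$ and $\langle J_L(\psi),Y\rangle=i\,((Y\otimes 1)\psi,\psi)_S$ for $Y\in\mathfrak g$. Let $(m,n)\in\mathfrak h^*$ be given by $\langle (m,n),X\rangle=i\,\mathrm{Tr}(DX)$ with $D=\mathrm{diag}(m_1,\dots,m_M,-n_N,\dots,-n_1)$, and let $H_{(m,n)}$ be its stability group under the coadjoint action of $H$. Theorem. The set $\mathcal O_{m,n}$ is a single coadjoint orbit of $U_0(\mathcal H)$, and $J_R$, $J_L$ are momentum maps for the infinitesimal right and left actions, in the sense that $d\langle J,X\rangle=\omega(X_S,\cdot)$ with $X_S$ the vector field generated by $X$. The level set $J_R^{-1}(m,n)$ is an embedded submanifold of $S$; the Marsden–Weinstein quotient $S^{(m,n)}=J_R^{-1}(m,n)/H_{(m,n)}$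 with the quotient topology is a smooth manifold such that the projection from the level set is a submersion, and it carries a (strong) symplectic form $\omega_{\rm red}$ whose pullback to $J_R^{-1}(m,n)$ is the restriction of $\omega$. The orbit $\mathcal O_{m,n}$ is an embedded submanifold of $\mathfrak g^*$ with tangent spaces $\{X\cdot\rho : X\in\mathfrak g\}$, and it carries the (strong) Kirillov–Kostant–Souriau symplectic form $\omega_\rho(X\cdot\rho,Y\cdot\rho)=\langle\rho,[X,Y]\rangle$. Finally, $J_L$ descends to a symplectomorphism $\tilde J_L:S^{(m,n)}\to\mathcal O_{m,n}$, i.e. a diffeomorphism that pulls back the Kirillov–Kostant–Souriau form to $\omega_{\rm red}$. -/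

import Mathlib

open scoped Manifold ContDiff Matrix InnerProductSpace

universe u

noncomputable section

/-! ## Symplectic forms on smooth Banach manifolds -/

/-- A (not necessarily smooth) `2`-form on a manifold `X` modelled on the Banach space `E`. -/
abbrev TwoForm (E X : Type*) [NormedAddCommGroup E] [NormedSpace ℝ E] [TopologicalSpace X]
    [ChartedSpace E X] : Type _ :=
  ∀ x : X, TangentSpace 𝓘(ℝ, E) x [⋀^Fin 2]→L[ℝ] ℝ

/-- The expression of a `2`-form in a chart `φ`, i.e. its pullback along `φ⁻¹`
(meaningful on the open set `φ.target`). -/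
def TwoForm.inChart {E X : Type*} [NormedAddCommGroup E] [NormedSpace ℝ E] [TopologicalSpace X]
    [ChartedSpace E X] (Ω : TwoForm E X) (φ : OpenPartialHomeomorph X E) :
    E → E [⋀^Fin 2]→L[ℝ] ℝ :=
  fun y => (Ω (φ.symm y)).compContinuousLinearMap (mfderiv 𝓘(ℝ, E) 𝓘(ℝ, E) φ.symm y)

/-- A (strong) symplectic form: smooth, closed, and such that `v ↦ ω(v, ·)` is a bijection from
each tangent space onto its topological dual. -/
structure TwoForm.IsSymplectic {E X : Type*} [NormedAddCommGroup E] [NormedSpace ℝ E]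
    [TopologicalSpace X] [ChartedSpace E X] (Ω : TwoForm E X) : Prop where
  smooth : ∀ φ ∈ atlas E X, ContDiffOn ℝ ∞ (Ω.inChart φ) φ.target
  closed : ∀ φ ∈ atlas E X, ∀ y ∈ φ.target, extDeriv (Ω.inChart φ) y = 0
  injective : ∀ (x : X) (v : TangentSpace 𝓘(ℝ, E) x), (∀ w, Ω x ![v, w] = 0) → v = 0
  surjective : ∀ (x : X) (l : TangentSpace 𝓘(ℝ, E) x →L[ℝ] ℝ), ∃ v, ∀ w, Ω x ![v, w] = l w

/-! ## The group of unitaries that are compact perturbations of the identity -/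

section LeftGroup

variable (H : Type u) [NormedAddCommGroup H] [InnerProductSpace ℂ H] [CompleteSpace H]

/-- `U₀(H)`: the unitary operators `U` on `H` such that `U - 1` is compact. -/
def UnitaryCompact : Subgroup (unitary (H →L[ℂ] H)) where
  carrier := {U | IsCompactOperator (((U : H →L[ℂ] H) - 1 : H →L[ℂ] H) : H → H)}
  one_mem' := by
    have : ((1 : unitary (H →L[ℂ] H)) : H →L[ℂ] H) - 1 = 0 := by simp
    simp only [Set.mem_ofPred_eq, this]
    exact isCompactOperator_zero
  mul_mem' := by
    intro U V hU hV
    have h : ((U * V : unitary (H →L[ℂ] H)) : H →L[ℂ] H) - 1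
        = ((U : H →L[ℂ] H) - 1) * (V : H →L[ℂ] H) + ((V : H →L[ℂ] H) - 1) := by
      simp [sub_mul]
    simp only [Set.mem_ofPred_eq, h]
    exact (hU.comp_clm (V : H →L[ℂ] H)).add hV
  inv_mem' := by
    intro U hU
    have h : ((U⁻¹ : unitary (H →L[ℂ] H)) : H →L[ℂ] H) - 1
        = -(((U⁻¹ : unitary (H →L[ℂ] H)) : H →L[ℂ] H) * ((U : H →L[ℂ] H) - 1)) := by
      have h1 : ((U⁻¹ : unitary (H →L[ℂ] H)) : H →L[ℂ] H) * (U : H →L[ℂ] H) = 1 := by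
        rw [← Submonoid.coe_mul, inv_mul_cancel, Submonoid.coe_one]
      rw [mul_sub, h1, mul_one, neg_sub]
    simp only [Set.mem_ofPred_eq, h]
    exact (hU.clm_comp ((U⁻¹ : unitary (H →L[ℂ] H)) : H →L[ℂ] H)).neg

/-- The Lie algebra `𝔲₀(H)` of `U₀(H)`: the skew-adjoint compact operators, a real Banach space
with the operator norm. -/
def SkewCompact : Submodule ℝ (H →L[ℂ] H) where
  carrier := {A | IsCompactOperator A ∧ star A = -A}
  zero_mem' := ⟨isCompactOperator_zero, by simp⟩
  add_mem' := by
    rintro A B ⟨hA, hA'⟩ ⟨hB, hB'⟩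
    exact ⟨hA.add hB, by rw [star_add, hA', hB', neg_add]⟩
  smul_mem' := by
    rintro c A ⟨hA, hA'⟩
    exact ⟨hA.smul c, by rw [star_smul, hA', star_trivial, smul_neg]⟩

/-- The dual `𝔲₀(H)*` of the Banach space `𝔲₀(H)`. -/
abbrev SkewCompactDual : Type u := StrongDual ℝ (SkewCompact H)

variable {H}

lemma SkewCompact.star_eq (X : SkewCompact H) : star (X : H →L[ℂ] H) = -(X : H →L[ℂ] H) := X.2.2

/-- The adjoint action `X ↦ U X U⁻¹` of `U₀(H)` on its Lie algebra. -/
def adjointAction (U : UnitaryCompact H) : SkewCompact H →L[ℝ] SkewCompact H where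
  toFun X := ⟨(U : H →L[ℂ] H) * X * star (U : H →L[ℂ] H),
    (X.2.1.clm_comp (U : H →L[ℂ] H)).comp_clm (star (U : H →L[ℂ] H)), by
      simp [SkewCompact.star_eq, mul_assoc]⟩
  map_add' X Y := by ext1; simp [mul_add, add_mul]
  map_smul' c X := by ext1; simp
  cont := by
    refine Continuous.subtype_mk ?_ _
    fun_prop

/-- The Lie bracket `[X, Y] = XY - YX` of `𝔲₀(H)`, as a continuous linear map in `Y`. -/
def bracket (X : SkewCompact H) : SkewCompact H →L[ℝ] SkewCompact H where
  toFun Y := ⟨(X : H →L[ℂ] H) * Y - Y * X,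
    (X.2.1.comp_clm (Y : H →L[ℂ] H)).sub (Y.2.1.comp_clm (X : H →L[ℂ] H)), by
      simp [SkewCompact.star_eq]⟩
  map_add' Y Z := by ext1; simp only [Submodule.coe_add, mul_add, add_mul]; abel
  map_smul' c Y := by ext1; simp [smul_sub]
  cont := by
    refine Continuous.subtype_mk ?_ _
    fun_prop

/-- The coadjoint action of `U₀(H)`: `⟨U • f, X⟩ = ⟨f, U⁻¹ X U⟩`. -/
def coadjointAction (U : UnitaryCompact H) (f : SkewCompactDual H) : SkewCompactDual H :=
  f.comp (adjointAction U⁻¹)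

/-- The infinitesimal coadjoint action (the derivative at `t = 0` of the coadjoint action of
`exp(tX)` on `f`): `⟨X • f, Z⟩ = -⟨f, [X, Z]⟩`. -/
def coadjointField (X : SkewCompact H) (f : SkewCompactDual H) : SkewCompactDual H :=
  -(f.comp (bracket X))

/-- The orbit of `f` under the coadjoint action of `U₀(H)`. -/
def coadjointOrbit (f : SkewCompactDual H) : Set (SkewCompactDual H) :=
  Set.range fun U : UnitaryCompact H => coadjointAction U f

/-- `ρ` is trace class: `Tr |ρ| < ∞`, computed in orthonormal bases of `H`. -/
def IsTraceClass (ρ : H →L[ℂ] H) : Prop :=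
  ∀ (κ : Type u) (e : HilbertBasis κ ℂ H), Summable fun i => (⟪e i, CFC.abs ρ (e i)⟫_ℂ).re

/-- The functional `f` is `X ↦ i Tr (ρ X)`. -/
def IsTracePairing (ρ : H →L[ℂ] H) (f : SkewCompactDual H) : Prop :=
  ∀ (X : SkewCompact H) (κ : Type u) (e : HilbertBasis κ ℂ H),
    HasSum (fun i => Complex.I * ⟪e i, ρ ((X : H →L[ℂ] H) (e i))⟫_ℂ) ((f X : ℝ) : ℂ)

/-- The nonzero eigenvalues of `ρ`, counted with multiplicity, are
`m₁, …, m_M` and `-n_N, …, -n₁`. -/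
def HasNonzeroEigenvalues {M N : ℕ} (m : Fin M → ℝ) (n : Fin N → ℝ) (ρ : H →L[ℂ] H) : Prop :=
  ∀ c : ℂ, c ≠ 0 →
    Module.rank ℂ (Module.End.eigenspace (ρ : H →ₗ[ℂ] H) c) =
      ((Nat.card {i // (m i : ℂ) = c} + Nat.card {j // (-(n j) : ℂ) = c} : ℕ) : Cardinal)

variable (H) in
/-- The set `𝒪_{m,n}` of the elements of `𝔲₀(H)*` given, through the pairing `i Tr (ρ X)`, by the
self-adjoint trace-class operators `ρ` with eigenvalues `m₁, …, m_M, 0, …, -n_N, …, -n₁`. -/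
def orbitSet {M N : ℕ} (m : Fin M → ℝ) (n : Fin N → ℝ) : Set (SkewCompactDual H) :=
  {f | ∃ ρ : H →L[ℂ] H, IsSelfAdjoint ρ ∧ IsTraceClass ρ ∧ HasNonzeroEigenvalues m n ρ ∧
    IsTracePairing ρ f}

/-- The submanifold structure and the Kirillov–Kostant–Souriau symplectic form of a coadjoint orbit
`O`: the inclusion in the Banach space `𝔲₀(H)*` is a smooth embedding, the tangent vectors are the
vectors `X • f`, and `Ω_f(X • f, Y • f) = ⟨f, [X, Y]⟩`. -/
structure IsOrbitSymplecticManifold (O : Set (SkewCompactDual H)) (E : Type u)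
    [NormedAddCommGroup E] [NormedSpace ℝ E] [ChartedSpace E O] (Ω : TwoForm E O) : Prop where
  isManifold : IsManifold 𝓘(ℝ, E) ∞ O
  isSmoothEmbedding :
    Manifold.IsSmoothEmbedding 𝓘(ℝ, E) 𝓘(ℝ, SkewCompactDual H) ∞ (Subtype.val : O → _)
  tangent : ∀ f : O,
    Set.range (mfderiv 𝓘(ℝ, E) 𝓘(ℝ, SkewCompactDual H) (Subtype.val : O → _) f) =
      Set.range fun X : SkewCompact H => coadjointField X (f : SkewCompactDual H)
  isSymplectic : Ω.IsSymplectic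
  kks : ∀ (f : O) (X Y : SkewCompact H) (v w : TangentSpace 𝓘(ℝ, E) f),
    mfderiv 𝓘(ℝ, E) 𝓘(ℝ, SkewCompactDual H) (Subtype.val : O → _) f v
      = coadjointField X (f : SkewCompactDual H) →
    mfderiv 𝓘(ℝ, E) 𝓘(ℝ, SkewCompactDual H) (Subtype.val : O → _) f w
      = coadjointField Y (f : SkewCompactDual H) →
    Ω f ![v, w] = (f : SkewCompactDual H) (bracket X Y)

end LeftGroup

/-! ## The pseudo-unitary group -/

section RightGroup

variable (M N : ℕ)

/-- The signs `+1` (`M` times) and `-1` (`N` times). -/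
def sgn : Fin M ⊕ Fin N → ℂ := Sum.elim (fun _ => 1) (fun _ => -1)

/-- The diagonal matrix of signature `(M, N)`. -/
def sigMatrix : Matrix (Fin M ⊕ Fin N) (Fin M ⊕ Fin N) ℂ := Matrix.diagonal (sgn M N)

lemma sigMatrix_mul_self : sigMatrix M N * sigMatrix M N = 1 := by
  rw [sigMatrix, Matrix.diagonal_mul_diagonal, ← Matrix.diagonal_one]
  congr 1
  ext i
  rcases i with i | i <;> simp [sgn]

lemma conjTranspose_sigMatrix : (sigMatrix M N)ᴴ = sigMatrix M N := by
  rw [sigMatrix, Matrix.diagonal_conjTranspose]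
  congr 1
  ext i
  rcases i with i | i <;> simp [sgn]

/-- `U(M, N)`: the invertible complex matrices that preserve the hermitian form of signature
`(M, N)`. -/
def PseudoUnitary : Subgroup (Matrix (Fin M ⊕ Fin N) (Fin M ⊕ Fin N) ℂ)ˣ where
  carrier := {U | U.val * sigMatrix M N * U.valᴴ = sigMatrix M N}
  one_mem' := by simp
  mul_mem' := by
    intro U V hU hV
    simp only [Set.mem_ofPred_eq] at hU hV ⊢
    calc (U * V).val * sigMatrix M N * (U * V).valᴴ
        = U.val * (V.val * sigMatrix M N * V.valᴴ) * U.valᴴ := by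
          simp [Matrix.conjTranspose_mul, mul_assoc]
      _ = sigMatrix M N := by rw [hV, hU]
  inv_mem' := by
    intro U hU
    simp only [Set.mem_ofPred_eq] at hU ⊢
    have h1 : U⁻¹.val * U.val = 1 := U.inv_mul
    have h2 : U.valᴴ * U⁻¹.valᴴ = 1 := by rw [← Matrix.conjTranspose_mul, h1]; simp
    calc U⁻¹.val * sigMatrix M N * U⁻¹.valᴴ
        = U⁻¹.val * (U.val * sigMatrix M N * U.valᴴ) * U⁻¹.valᴴ := by rw [hU]
      _ = (U⁻¹.val * U.val) * sigMatrix M N * (U.valᴴ * U⁻¹.valᴴ) := by simp only [mul_assoc]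
      _ = sigMatrix M N := by rw [h1, h2]; simp

/-- The Lie algebra `𝔲(M, N)` of `U(M, N)`. -/
def PseudoSkew : Submodule ℝ (Matrix (Fin M ⊕ Fin N) (Fin M ⊕ Fin N) ℂ) where
  carrier := {X | X * sigMatrix M N + sigMatrix M N * Xᴴ = 0}
  zero_mem' := by simp
  add_mem' := by
    intro X Y hX hY
    simp only [Set.mem_ofPred_eq] at hX hY ⊢
    calc (X + Y) * sigMatrix M N + sigMatrix M N * (X + Y)ᴴ
        = (X * sigMatrix M N + sigMatrix M N * Xᴴ) + (Y * sigMatrix M N + sigMatrix M N * Yᴴ) := by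
          rw [Matrix.conjTranspose_add, mul_add, add_mul]; abel
      _ = 0 := by rw [hX, hY, add_zero]
  smul_mem' := by
    intro c X hX
    simp only [Set.mem_ofPred_eq] at hX ⊢
    rw [Matrix.conjTranspose_smul, star_trivial, Matrix.smul_mul, Matrix.mul_smul, ← smul_add, hX,
      smul_zero]

variable {M N}

/-- The adjoint action `X ↦ U X U⁻¹` of `U(M, N)` on its Lie algebra. -/
def pseudoAdjoint (U : PseudoUnitary M N) (X : PseudoSkew M N) : PseudoSkew M N :=
  ⟨U.1.val * (X : Matrix _ _ ℂ) * U.1⁻¹.val, by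
    have hU : U.1.val * sigMatrix M N * U.1.valᴴ = sigMatrix M N := U.2
    have hX : (X : Matrix _ _ ℂ) * sigMatrix M N + sigMatrix M N * (X : Matrix _ _ ℂ)ᴴ = 0 := X.2
    have h1 : U.1⁻¹.val * U.1.val = 1 := U.1.inv_mul
    have h2 : U.1⁻¹.val * sigMatrix M N = sigMatrix M N * U.1.valᴴ := by
      calc U.1⁻¹.val * sigMatrix M N
          = U.1⁻¹.val * (U.1.val * sigMatrix M N * U.1.valᴴ) := by rw [hU]
        _ = (U.1⁻¹.val * U.1.val) * sigMatrix M N * U.1.valᴴ := by simp only [mul_assoc]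
        _ = _ := by rw [h1, one_mul]
    have h3 : sigMatrix M N * U.1⁻¹.valᴴ = U.1.val * sigMatrix M N := by
      have := congrArg Matrix.conjTranspose h2
      simpa [Matrix.conjTranspose_mul, conjTranspose_sigMatrix] using this
    change U.1.val * (X : Matrix _ _ ℂ) * U.1⁻¹.val * sigMatrix M N
      + sigMatrix M N * (U.1.val * (X : Matrix _ _ ℂ) * U.1⁻¹.val)ᴴ = 0
    calc U.1.val * (X : Matrix _ _ ℂ) * U.1⁻¹.val * sigMatrix M N
          + sigMatrix M N * (U.1.val * (X : Matrix _ _ ℂ) * U.1⁻¹.val)ᴴ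
        = U.1.val * (X : Matrix _ _ ℂ) * (U.1⁻¹.val * sigMatrix M N)
          + (sigMatrix M N * U.1⁻¹.valᴴ) * (X : Matrix _ _ ℂ)ᴴ * U.1.valᴴ := by
          simp only [Matrix.conjTranspose_mul, mul_assoc]
      _ = U.1.val * ((X : Matrix _ _ ℂ) * sigMatrix M N
          + sigMatrix M N * (X : Matrix _ _ ℂ)ᴴ) * U.1.valᴴ := by
          rw [h2, h3]; simp only [mul_assoc, mul_add, add_mul]
      _ = 0 := by rw [hX]; simp⟩

lemma pseudoAdjoint_mul (U V : PseudoUnitary M N) (X : PseudoSkew M N) :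
    pseudoAdjoint (U * V) X = pseudoAdjoint U (pseudoAdjoint V X) := by
  ext1
  simp [pseudoAdjoint, mul_assoc]

lemma pseudoAdjoint_one (X : PseudoSkew M N) :
    pseudoAdjoint (1 : PseudoUnitary M N) X = X := by
  ext1
  simp [pseudoAdjoint]

/-- The stability group of `μ ∈ 𝔲(M, N)*` under the coadjoint action
`⟨U • μ, X⟩ = ⟨μ, U⁻¹ X U⟩` of `U(M, N)`. -/
def pseudoStabilizer (μ : Module.Dual ℝ (PseudoSkew M N)) : Subgroup (PseudoUnitary M N) where
  carrier := {U | ∀ X, μ (pseudoAdjoint U⁻¹ X) = μ X}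
  one_mem' := by
    intro X
    rw [inv_one, pseudoAdjoint_one]
  mul_mem' := by
    intro U V hU hV X
    rw [mul_inv_rev, pseudoAdjoint_mul, hV, hU]
  inv_mem' := by
    intro U hU X
    have := hU (pseudoAdjoint U X)
    rw [← pseudoAdjoint_mul, inv_mul_cancel, pseudoAdjoint_one] at this
    rw [inv_inv, this]

/-- The diagonal matrix with entries `m₁, …, m_M, -n_N, …, -n₁`. -/
def weightMatrix (m : Fin M → ℝ) (n : Fin N → ℝ) : Matrix (Fin M ⊕ Fin N) (Fin M ⊕ Fin N) ℂ :=
  Matrix.diagonal (Sum.elim (fun i => (m i : ℂ)) (fun j => -(n j.rev : ℂ)))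

/-- The element `(m, n)` of `𝔲(M, N)*`: `⟨(m, n), X⟩ = i Tr (D X)`, which is real, with
`D = weightMatrix m n`. -/
def weight (m : Fin M → ℝ) (n : Fin N → ℝ) : Module.Dual ℝ (PseudoSkew M N) where
  toFun X := (Complex.I * (weightMatrix m n * (X : Matrix _ _ ℂ)).trace).re
  map_add' X Y := by simp [mul_add]
  map_smul' c X := by simp

end RightGroup

/-! ## The symplectic space `H ⊗ ℂ^{M+N}` and its two momentum maps -/

section Space

variable (H : Type u) [NormedAddCommGroup H] [InnerProductSpace ℂ H]

/-- The Hilbert space `S = H ⊗ ℂ^{M+N}`: the element `∑ᵢ ψᵢ ⊗ eᵢ` is the family `(ψᵢ)`. -/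
abbrev TensorSpace (M N : ℕ) : Type u := PiLp 2 (fun _ : Fin M ⊕ Fin N => H)

variable {H} {M N : ℕ}

/-- The indefinite hermitian form `(ψ, φ)_S = ∑_{i ≤ M} (ψᵢ, φᵢ) - ∑_{i > M} (ψᵢ, φᵢ)`, linear in
`ψ` and antilinear in `φ`. -/
def indefForm (ψ φ : TensorSpace H M N) : ℂ := ∑ i, sgn M N i * ⟪φ i, ψ i⟫_ℂ

/-- The symplectic form `ω(ψ, φ) = -2 Im (ψ, φ)_S`. -/
def symplecticForm (ψ φ : TensorSpace H M N) : ℝ := -2 * (indefForm ψ φ).im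

/-- The right action `ψ ↦ (1 ⊗ Aᵀ) ψ` of a matrix `A`. -/
def rightMul (ψ : TensorSpace H M N) (A : Matrix (Fin M ⊕ Fin N) (Fin M ⊕ Fin N) ℂ) :
    TensorSpace H M N :=
  WithLp.toLp 2 fun k => ∑ i, A i k • ψ i

/-- The left action `ψ ↦ (Y ⊗ 1) ψ` of an operator `Y`. -/
def leftMul (Y : H →L[ℂ] H) (ψ : TensorSpace H M N) : TensorSpace H M N :=
  WithLp.toLp 2 fun k => Y (ψ k)

/-- The momentum map `J_R` of the right action of `U(M, N)`: `⟨J_R(ψ), X⟩ = i (ψ X, ψ)_S`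
(a real number). -/
def momentumRight (ψ : TensorSpace H M N) : Module.Dual ℝ (PseudoSkew M N) where
  toFun X := (Complex.I * indefForm (rightMul ψ (X : Matrix _ _ ℂ)) ψ).re
  map_add' X Y := by
    rw [← Complex.add_re, ← mul_add]
    congr 2
    simp [indefForm, rightMul, add_smul, Finset.sum_add_distrib, mul_add]
  map_smul' c X := by
    have h : indefForm (rightMul ψ ((c • X : PseudoSkew M N) : Matrix _ _ ℂ)) ψ
        = (c : ℂ) * indefForm (rightMul ψ (X : Matrix _ _ ℂ)) ψ := by
      simp only [indefForm, rightMul, Finset.mul_sum, Submodule.coe_smul, Matrix.smul_apply,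
        inner_sum, inner_smul_right, Complex.real_smul]
      exact Finset.sum_congr rfl fun k _ => Finset.sum_congr rfl fun i _ => by ring
    rw [h, RingHom.id_apply, smul_eq_mul, ← mul_assoc, mul_comm Complex.I, mul_assoc,
      Complex.re_ofReal_mul]

/-- The momentum map `J_L` of the left action of `U₀(H)`: `⟨J_L(ψ), Y⟩ = i (Y ψ, ψ)_S`
(a real number). -/
def momentumLeft [CompleteSpace H] (ψ : TensorSpace H M N) : SkewCompactDual H where
  toFun Y := (Complex.I * indefForm (leftMul (Y : H →L[ℂ] H) ψ) ψ).re
  map_add' X Y := by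
    rw [← Complex.add_re, ← mul_add]
    congr 2
    simp [indefForm, leftMul, Finset.sum_add_distrib, mul_add]
  map_smul' c X := by
    have h : indefForm (leftMul ((c • X : SkewCompact H) : H →L[ℂ] H) ψ) ψ
        = (c : ℂ) * indefForm (leftMul (X : H →L[ℂ] H) ψ) ψ := by
      simp only [indefForm, leftMul, Finset.mul_sum, Submodule.coe_smul,
        _root_.smul_apply]
      refine Finset.sum_congr rfl fun k _ => ?_
      rw [← Complex.coe_smul, inner_smul_right]
      ring
    rw [h, RingHom.id_apply, smul_eq_mul, ← mul_assoc, mul_comm Complex.I, mul_assoc,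
      Complex.re_ofReal_mul]
  cont := by
    simp only [indefForm, leftMul]
    fun_prop

/-- `J` is a momentum map with respect to `ω = symplecticForm` for the infinitesimal action
`X ↦ (ψ ↦ a X ψ)`: each component `⟨J, X⟩` is differentiable, with
`d⟨J, X⟩_ψ(ξ) = ω(a X ψ, ξ)`. -/
def IsMomentumMap {𝔤 : Type*} (a : 𝔤 → TensorSpace H M N → TensorSpace H M N)
    (J : TensorSpace H M N → 𝔤 → ℝ) : Prop :=
  ∀ (X : 𝔤) (ψ : TensorSpace H M N), DifferentiableAt ℝ (fun φ => J φ X) ψ ∧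
    ∀ ξ, fderiv ℝ (fun φ => J φ X) ψ ξ = symplecticForm (a X ψ) ξ

lemma rightMul_mul (ψ : TensorSpace H M N)
    (A B : Matrix (Fin M ⊕ Fin N) (Fin M ⊕ Fin N) ℂ) :
    rightMul ψ (A * B) = rightMul (rightMul ψ A) B := by
  ext k
  simp only [rightMul, Matrix.mul_apply, Finset.sum_smul, Finset.smul_sum, smul_smul]
  rw [Finset.sum_comm]
  exact Finset.sum_congr rfl fun i _ => Finset.sum_congr rfl fun j _ => by rw [mul_comm]

lemma rightMul_one (ψ : TensorSpace H M N) : rightMul ψ 1 = ψ := by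
  ext k
  simp [rightMul, Matrix.one_apply]

lemma indefForm_rightMul (U : PseudoUnitary M N) (ψ φ : TensorSpace H M N) :
    indefForm (rightMul ψ U.1.val) (rightMul φ U.1.val) = indefForm ψ φ := by
  have hU : U.1.val * sigMatrix M N * U.1.valᴴ = sigMatrix M N := U.2
  have h : ∀ i j, ∑ k, sgn M N k * (U.1.val i k * star (U.1.val j k)) = sigMatrix M N i j := by
    intro i j
    rw [← congrFun (congrFun hU i) j, sigMatrix, Matrix.mul_apply]
    refine Finset.sum_congr rfl fun k _ => ?_
    rw [Matrix.mul_diagonal, Matrix.conjTranspose_apply]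
    ring
  calc indefForm (rightMul ψ U.1.val) (rightMul φ U.1.val)
      = ∑ k, ∑ j, ∑ i, sgn M N k * (U.1.val i k * star (U.1.val j k)) * ⟪φ j, ψ i⟫_ℂ := by
        simp only [indefForm, rightMul, sum_inner, inner_sum, inner_smul_left, inner_smul_right,
          Finset.mul_sum]
        refine Finset.sum_congr rfl fun k _ => ?_
        rw [Finset.sum_comm]
        refine Finset.sum_congr rfl fun j _ => Finset.sum_congr rfl fun i _ => ?_
        rw [starRingEnd_apply]
        ring
    _ = ∑ j, ∑ i, sigMatrix M N i j * ⟪φ j, ψ i⟫_ℂ := by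
        rw [Finset.sum_comm]
        refine Finset.sum_congr rfl fun j _ => ?_
        rw [Finset.sum_comm]
        refine Finset.sum_congr rfl fun i _ => ?_
        rw [← Finset.sum_mul, h]
    _ = indefForm ψ φ := by
        simp [indefForm, sigMatrix, Matrix.diagonal_apply]

lemma momentumRight_rightMul (U : PseudoUnitary M N) (ψ : TensorSpace H M N)
    (X : PseudoSkew M N) :
    momentumRight (rightMul ψ U.1.val) X = momentumRight ψ (pseudoAdjoint U X) := by
  have h : U.1.val * (X : Matrix _ _ ℂ)
      = (pseudoAdjoint U X : Matrix _ _ ℂ) * U.1.val := by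
    simp [pseudoAdjoint, mul_assoc]
  change (Complex.I * indefForm (rightMul (rightMul ψ U.1.val) (X : Matrix _ _ ℂ))
    (rightMul ψ U.1.val)).re = (Complex.I * indefForm (rightMul ψ _) ψ).re
  rw [← rightMul_mul, h, rightMul_mul, indefForm_rightMul]

variable (H) in
/-- The level set `J_R⁻¹(μ)`, with the topology induced by `S`. -/
abbrev LevelSet (μ : Module.Dual ℝ (PseudoSkew M N)) : Type u :=
  {ψ : TensorSpace H M N // momentumRight ψ = μ}

/-- The stability group of `μ` acts from the right on `J_R⁻¹(μ)`. -/
instance levelSetAction (μ : Module.Dual ℝ (PseudoSkew M N)) :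
    MulAction (pseudoStabilizer μ)ᵐᵒᵖ (LevelSet H μ) where
  smul U ψ := ⟨rightMul ψ.1 U.unop.1.1.val, by
    ext X
    have hU : ∀ X, μ (pseudoAdjoint U.unop.1⁻¹⁻¹ X) = μ X :=
      (pseudoStabilizer μ).inv_mem U.unop.2
    rw [momentumRight_rightMul, ψ.2]
    simpa using hU X⟩
  one_smul ψ := Subtype.ext (by
    change rightMul ψ.1 1 = ψ.1
    exact rightMul_one _)
  mul_smul U V ψ := Subtype.ext (by
    change rightMul ψ.1 (V.unop.1.1.val * U.unop.1.1.val)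
      = rightMul (rightMul ψ.1 V.unop.1.1.val) U.unop.1.1.val
    exact rightMul_mul _ _ _)

variable (H) in
/-- The quotient `J_R⁻¹(μ) / H_μ` by the stability group of `μ`, with the quotient topology. -/
abbrev ReducedSpace (μ : Module.Dual ℝ (PseudoSkew M N)) : Type u :=
  MulAction.orbitRel.Quotient (pseudoStabilizer μ)ᵐᵒᵖ (LevelSet H μ)

/-- The canonical projection `J_R⁻¹(μ) → J_R⁻¹(μ) / H_μ`. -/
def toReduced (μ : Module.Dual ℝ (PseudoSkew M N)) (ψ : LevelSet H μ) : ReducedSpace H μ :=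
  Quotient.mk _ ψ

/-- The manifold structures and the symplectic form of the Marsden–Weinstein quotient: the level
set is an embedded submanifold of `S`, the projection `π` to the quotient is a smooth submersion,
and `Ω` is the symplectic form on the quotient whose pullback along `π` is the restriction to the
level set of the symplectic form of `S`. -/
structure IsMarsdenWeinsteinQuotient (μ : Module.Dual ℝ (PseudoSkew M N)) (E F : Type u)
    [NormedAddCommGroup E] [NormedSpace ℝ E] [NormedAddCommGroup F] [NormedSpace ℝ F]
    [ChartedSpace E (LevelSet H μ)] [ChartedSpace F (ReducedSpace H μ)]
    (Ω : TwoForm F (ReducedSpace H μ)) : Prop where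
  isManifold_levelSet : IsManifold 𝓘(ℝ, E) ∞ (LevelSet H μ)
  isSmoothEmbedding : Manifold.IsSmoothEmbedding 𝓘(ℝ, E) 𝓘(ℝ, TensorSpace H M N) ∞
    (Subtype.val : LevelSet H μ → TensorSpace H M N)
  isManifold : IsManifold 𝓘(ℝ, F) ∞ (ReducedSpace H μ)
  isSubmersion : Manifold.IsSubmersion 𝓘(ℝ, E) 𝓘(ℝ, F) ∞ (toReduced (H := H) μ)
  isSymplectic : Ω.IsSymplectic
  pullback : ∀ (ψ : LevelSet H μ) (v w : TangentSpace 𝓘(ℝ, E) ψ),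
    Ω (toReduced μ ψ) ![mfderiv 𝓘(ℝ, E) 𝓘(ℝ, F) (toReduced μ) ψ v,
        mfderiv 𝓘(ℝ, E) 𝓘(ℝ, F) (toReduced μ) ψ w] =
      symplecticForm
        (mfderiv 𝓘(ℝ, E) 𝓘(ℝ, TensorSpace H M N)
          (Subtype.val : LevelSet H μ → TensorSpace H M N) ψ v)
        (mfderiv 𝓘(ℝ, E) 𝓘(ℝ, TensorSpace H M N)
          (Subtype.val : LevelSet H μ → TensorSpace H M N) ψ w)

end Space

end

/-! The level set of `momentumRight` consists of the orthogonal families (frames) in H with squared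
norms m_i and n_j (`momentumRight_eq_weight_iff`). `momentumLeft ψ` is the functional of the
finite-rank operator ∑ ±|ψ_k⟩⟨ψ_k| (`frameOp`), for which the vectors of such a frame are
eigenvectors with the prescribed eigenvalues. The theorem comes from comparing a frame with its
operator.

Orbit and fibres. An isometry between finite-dimensional subspaces extends to a unitary differing
from 1 by a finite-rank operator, so U₀(H) is transitive on the level set
(`exists_leftMul_unitary_eq`). A self-adjoint trace-class operator is compact, and the spectral
theorem recovers a frame from it; hence `momentumLeft` maps the level set onto `orbitSet`
(`mem_orbitSet_iff`), which is one orbit by equivariance. Two frames with the same operator differ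
by a matrix mixing only equal eigenvalues; it is unitary and commutes with the signature and the
weights, so it lies in the stability group (`exists_rightMul_eq_of_frameOp_eq`).

Charts of the orbit. At f = `momentumLeft ψ`, let T project the Lie algebra onto the blocks mixing
different eigenspaces of `frameOp ψ`, with range 𝔪. The commutator with i `frameOp ψ` multiplies the
block (a, b) by i(λ_a - λ_b), so it is invertible on 𝔪, and the Kirillov–Kostant–Souriau form is
strongly nondegenerate there (`exists_transversal`). Hence (X, g) ↦ Ad*(Cayley X)(f + g), for X in 𝔪
and g annihilating 𝔪, is a local diffeomorphism. By the spectral gap, f + g with g small lies in the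
orbit only if g = 0 (`exists_pos_forall_annihilator_eq_zero`). This straightens the orbit near f,
and the group translates the chart to all other points.

Charts of the level set and of the quotient. The level set is cut out by equations on the Gram
matrix. Together with the orbit coordinate of `momentumLeft` these equations form a submersion,
which gives charts where `momentumLeft` is a linear projection (`exists_sliceChart_levelSet`). The
curves y ↦ U Cayley(y) ψ lift the orbit charts to the level set; these local sections show that the
quotient topology is the one induced from the dual Banach space
(`OrbitSlice.isEmbedding_reducedMomentum`), so the quotient receives the charts of the orbit.

Forms. Equivariance gives ⟨J_L(ψ), [X, Y]⟩ = ω(Xψ, Yψ) (`indefForm_bracket`), and every tangent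
vector of the level set is some Xψ. In a chart the orbit form is therefore the pullback of the
constant form ω along the lift, hence smooth and closed, and the reduced form pulls back to ω on the
level set. -/

noncomputable section

open Set Topology

set_option maxSynthPendingDepth 3

/-! ### Local diffeomorphisms and slice charts -/

section Slice

variable {V E W : Type*} [NormedAddCommGroup V] [NormedSpace ℝ V] [NormedAddCommGroup E]
  [NormedSpace ℝ E] [NormedAddCommGroup W] [NormedSpace ℝ W]

/-- The inverse function theorem, with smoothness of the inverse on an open set. -/
theorem exists_openPartialHomeomorph_contDiffOn [CompleteSpace E] {f : E → V} {U : Set E}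
    (hU : IsOpen U) (hf : ContDiffOn ℝ ∞ f U) {a : E} (ha : a ∈ U) (e : E ≃L[ℝ] V)
    (he : HasFDerivAt f (e : E →L[ℝ] V) a) :
    ∃ Φ : OpenPartialHomeomorph E V, a ∈ Φ.source ∧ Φ.source ⊆ U ∧ (∀ x, Φ x = f x) ∧
      ContDiffOn ℝ ∞ Φ Φ.source ∧ ContDiffOn ℝ ∞ Φ.symm Φ.target := by
  have hfa : ContDiffAt ℝ ∞ f a := hf.contDiffAt (hU.mem_nhds ha)
  let Φ₀ := hfa.toOpenPartialHomeomorph f he (by simp)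
  -- The inverse is smooth at the image of a point where the derivative is invertible. Such points
  -- form an open set, to which the local inverse is restricted.
  have hopen : IsOpen (U ∩ fderiv ℝ f ⁻¹' range ((↑) : (E ≃L[ℝ] V) → E →L[ℝ] V)) :=
    (hf.continuousOn_fderiv_of_isOpen hU (by simp)).isOpen_inter_preimage hU
      (ContinuousLinearEquiv.isOpen (𝕜 := ℝ) (E := E) (F := V))
  let Φ := Φ₀.restrOpen _ hopen
  have hsub : ∀ x ∈ Φ.source, x ∈ U ∧ fderiv ℝ f x ∈ range ((↑) : (E ≃L[ℝ] V) → E →L[ℝ] V) :=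
    fun x hx => by
      rw [OpenPartialHomeomorph.restrOpen_source] at hx
      exact hx.2
  refine ⟨Φ, ?_, fun x hx => (hsub x hx).1, fun _ => rfl, ?_, ?_⟩
  · rw [OpenPartialHomeomorph.restrOpen_source]
    exact ⟨hfa.mem_toOpenPartialHomeomorph_source he (by simp), ha, e, he.fderiv.symm⟩
  · exact hf.mono fun x hx => (hsub x hx).1
  · intro y hy
    have hy' := Φ.map_target hy
    obtain ⟨hyU, e', he'⟩ := hsub _ hy'
    have hfy : ContDiffAt ℝ ∞ f (Φ.symm y) := hf.contDiffAt (hU.mem_nhds hyU)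
    refine (Φ.contDiffAt_symm (f₀' := e') hy ?_ hfy).contDiffWithinAt
    rw [he']
    exact (hfy.differentiableAt (by simp)).hasFDerivAt

/-- A smooth local straightening of the subset `A` of `V`: in the coordinates `E × W`, the
set `A` is the slice `W = 0`. -/
structure SliceChart (A : Set V) (E W : Type*) [NormedAddCommGroup E] [NormedSpace ℝ E]
    [NormedAddCommGroup W] [NormedSpace ℝ W] where
  -- Unrelated to the chart: it only identifies the model space V of the ambient manifold with the
  -- splitting E × W required of an immersion.
  equiv : (E × W) ≃L[ℝ] V
  toOpenPartialHomeomorph : OpenPartialHomeomorph V (E × W)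
  contDiffOn : ContDiffOn ℝ ∞ toOpenPartialHomeomorph toOpenPartialHomeomorph.source
  contDiffOn_symm : ContDiffOn ℝ ∞ toOpenPartialHomeomorph.symm toOpenPartialHomeomorph.target
  mem_iff : ∀ x ∈ toOpenPartialHomeomorph.source, x ∈ A ↔ (toOpenPartialHomeomorph x).2 = 0

namespace SliceChart

variable {A : Set V} (c : SliceChart A E W)

/-- The inverse of a slice chart on the slice. -/
def param (y : E) : V := c.toOpenPartialHomeomorph.symm (y, 0)

/-- The open set of parameters of the slice. -/
def dom : Set E := {y | (y, (0 : W)) ∈ c.toOpenPartialHomeomorph.target}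

lemma isOpen_dom : IsOpen c.dom :=
  c.toOpenPartialHomeomorph.open_target.preimage (by fun_prop)

lemma contDiffOn_param : ContDiffOn ℝ ∞ c.param c.dom :=
  c.contDiffOn_symm.comp (by fun_prop) fun _ hy => hy

lemma param_mem_source {y : E} (hy : y ∈ c.dom) : c.param y ∈ c.toOpenPartialHomeomorph.source :=
  c.toOpenPartialHomeomorph.map_target hy

lemma apply_param {y : E} (hy : y ∈ c.dom) : c.toOpenPartialHomeomorph (c.param y) = (y, 0) :=
  c.toOpenPartialHomeomorph.right_inv hy

lemma param_mem {y : E} (hy : y ∈ c.dom) : c.param y ∈ A := by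
  rw [c.mem_iff _ (c.param_mem_source hy), c.apply_param hy]

lemma apply_eq {x : V} (hx : x ∈ c.toOpenPartialHomeomorph.source) (hA : x ∈ A) :
    c.toOpenPartialHomeomorph x = ((c.toOpenPartialHomeomorph x).1, 0) :=
  Prod.ext rfl ((c.mem_iff x hx).1 hA)

lemma fst_mem_dom {x : V} (hx : x ∈ c.toOpenPartialHomeomorph.source) (hA : x ∈ A) :
    (c.toOpenPartialHomeomorph x).1 ∈ c.dom := by
  change (_, (0 : W)) ∈ c.toOpenPartialHomeomorph.target
  rw [← c.apply_eq hx hA]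
  exact c.toOpenPartialHomeomorph.map_source hx

lemma param_fst {x : V} (hx : x ∈ c.toOpenPartialHomeomorph.source) (hA : x ∈ A) :
    c.param (c.toOpenPartialHomeomorph x).1 = x := by
  rw [param, ← c.apply_eq hx hA, c.toOpenPartialHomeomorph.left_inv hx]

/-- The image of a slice chart under a linear isomorphism preserving the subset. -/
def translate (L : V ≃L[ℝ] V) (hL : ∀ x, L.symm x ∈ A ↔ x ∈ A) : SliceChart A E W where
  equiv := c.equiv
  toOpenPartialHomeomorph :=
    L.symm.toHomeomorph.toOpenPartialHomeomorph.trans c.toOpenPartialHomeomorph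
  contDiffOn := by
    refine c.contDiffOn.comp (L.symm.contDiff.contDiffOn) fun x hx => ?_
    simpa using hx
  contDiffOn_symm := by
    refine L.contDiff.comp_contDiffOn (c.contDiffOn_symm.mono fun x hx => ?_)
    simpa using hx
  mem_iff x hx := by
    rw [← hL]
    exact c.mem_iff _ (by simpa using hx)

@[simp] lemma translate_apply (L : V ≃L[ℝ] V) (hL : ∀ x, L.symm x ∈ A ↔ x ∈ A) (x : V) :
    (c.translate L hL).toOpenPartialHomeomorph x = c.toOpenPartialHomeomorph (L.symm x) := rfl

@[simp] lemma translate_source (L : V ≃L[ℝ] V) (hL : ∀ x, L.symm x ∈ A ↔ x ∈ A) :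
    (c.translate L hL).toOpenPartialHomeomorph.source =
      L.symm ⁻¹' c.toOpenPartialHomeomorph.source := by
  simp [translate]

lemma apply_invFun_param {X : Type*} {j : X → V} (hA : range j = A) [Nonempty X] {y : E}
    (hy : y ∈ c.dom) : j (Function.invFun j (c.param y)) = c.param y :=
  Function.invFun_eq (by simpa [← hA] using c.param_mem hy)

variable {X : Type*} [TopologicalSpace X] {j : X → V} (hj : IsEmbedding j) (hA : range j = A)

/-- The chart induced by a slice chart on a space embedded onto `A`. -/
def chart [Nonempty X] : OpenPartialHomeomorph X E where
  toFun x := (c.toOpenPartialHomeomorph (j x)).1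
  invFun y := Function.invFun j (c.param y)
  source := j ⁻¹' c.toOpenPartialHomeomorph.source
  target := c.dom
  map_source' x hx := c.fst_mem_dom hx (hA ▸ mem_range_self x)
  map_target' y hy := by
    rw [mem_preimage, c.apply_invFun_param hA hy]
    exact c.param_mem_source hy
  left_inv' x hx := by
    rw [c.param_fst hx (hA ▸ mem_range_self x)]
    exact Function.leftInverse_invFun hj.injective x
  right_inv' y hy := by
    rw [c.apply_invFun_param hA hy, c.apply_param hy]
  open_source := c.toOpenPartialHomeomorph.open_source.preimage hj.continuous
  open_target := c.isOpen_dom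
  continuousOn_toFun := by
    refine continuous_fst.comp_continuousOn ?_
    exact c.toOpenPartialHomeomorph.continuousOn.comp hj.continuous.continuousOn fun _ hx => hx
  continuousOn_invFun := by
    rw [hj.continuousOn_iff]
    exact c.contDiffOn_param.continuousOn.congr fun y hy => c.apply_invFun_param hA hy

lemma chart_target [Nonempty X] : (c.chart hj hA).target = c.dom := rfl

lemma apply_chart_symm [Nonempty X] {y : E} (hy : y ∈ c.dom) :
    j ((c.chart hj hA).symm y) = c.param y := c.apply_invFun_param hA hy

/-- A transition map is the first component of an ambient chart composed with a smooth
parametrization, so its smoothness is inherited from V. -/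
lemma contDiffOn_chart_symm_trans [Nonempty X] (c' : SliceChart A E W) :
    ContDiffOn ℝ ∞ ((c.chart hj hA).symm.trans (c'.chart hj hA))
      ((c.chart hj hA).symm.trans (c'.chart hj hA)).source := by
  have key : ∀ y ∈ ((c.chart hj hA).symm.trans (c'.chart hj hA)).source,
      y ∈ c.dom ∧ c.param y ∈ c'.toOpenPartialHomeomorph.source := by
    intro y hy
    rw [OpenPartialHomeomorph.trans_source] at hy
    have h1 : y ∈ c.dom := hy.1
    have h2 : j ((c.chart hj hA).symm y) ∈ c'.toOpenPartialHomeomorph.source := hy.2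
    rw [c.apply_chart_symm hj hA h1] at h2
    exact ⟨h1, h2⟩
  have : ContDiffOn ℝ ∞ (fun y => (c'.toOpenPartialHomeomorph (c.param y)).1)
      ((c.chart hj hA).symm.trans (c'.chart hj hA)).source :=
    contDiff_fst.comp_contDiffOn
      (c'.contDiffOn.comp (c.contDiffOn_param.mono fun y hy => (key y hy).1)
        fun y hy => (key y hy).2)
  refine this.congr fun y hy => ?_
  change (c'.toOpenPartialHomeomorph (j ((c.chart hj hA).symm y))).1 = _
  rw [c.apply_chart_symm hj hA (key y hy).1]

section Charted

variable [Nonempty X] {ι : Type*} (d : ι → SliceChart A E W) (i : X → ι)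
  (hi : ∀ x, j x ∈ (d (i x)).toOpenPartialHomeomorph.source)

/-- The charted space structure given by a family of slice charts. -/
@[reducible] def chartedSpace : ChartedSpace E X where
  atlas := range fun k => (d k).chart hj hA
  chartAt x := (d (i x)).chart hj hA
  mem_chart_source := hi
  chart_mem_atlas _ := mem_range_self _

lemma isManifold : letI := chartedSpace hj hA d i hi; IsManifold 𝓘(ℝ, E) ∞ X := by
  let := chartedSpace hj hA d i hi
  apply isManifold_of_contDiffOn
  rintro _ _ ⟨k, rfl⟩ ⟨l, rfl⟩
  simpa using (d k).contDiffOn_chart_symm_trans hj hA (d l)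

lemma chart_mem_maximalAtlas (k : ι) : letI := chartedSpace hj hA d i hi;
    (d k).chart hj hA ∈ IsManifold.maximalAtlas 𝓘(ℝ, E) ∞ X := by
  let := chartedSpace hj hA d i hi
  have := isManifold hj hA d i hi
  exact IsManifold.subset_maximalAtlas (mem_range_self k)

/-- In the induced chart and the slice chart, the map `j` reads y ↦ (y, 0). -/
lemma isSmoothEmbedding : letI := chartedSpace hj hA d i hi;
    Manifold.IsSmoothEmbedding 𝓘(ℝ, E) 𝓘(ℝ, V) ∞ j := by
  let := chartedSpace hj hA d i hi
  refine ⟨?_, hj⟩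
  have key : Manifold.IsImmersionOfComplement W 𝓘(ℝ, E) 𝓘(ℝ, V) ∞ j := by
    intro x
    set c := d (i x)
    refine Manifold.IsImmersionAtOfComplement.mk_of_continuousAt hj.continuous.continuousAt c.equiv
      (c.chart hj hA)
      (c.toOpenPartialHomeomorph.trans c.equiv.toHomeomorph.toOpenPartialHomeomorph) (hi x)
      (by simpa using hi x) (chart_mem_maximalAtlas hj hA d i hi (i x)) ?_ fun y hy => ?_
    · apply StructureGroupoid.mem_maximalAtlas_of_mem_groupoid
      rw [contDiffGroupoid, mem_groupoid_of_pregroupoid]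
      refine ⟨?_, ?_⟩
      · simpa [contDiffPregroupoid] using c.equiv.contDiff.comp_contDiffOn c.contDiffOn
      · have h2 : ContDiffOn ℝ ∞ (c.toOpenPartialHomeomorph.symm ∘ c.equiv.symm)
            (c.equiv.symm ⁻¹' c.toOpenPartialHomeomorph.target) :=
          c.contDiffOn_symm.comp c.equiv.symm.contDiff.contDiffOn fun _ h => h
        simpa [contDiffPregroupoid] using h2
    · have hy' : y ∈ c.dom := by simpa [chart_target] using hy
      have h1 := c.apply_chart_symm hj hA hy'
      simp [h1, c.apply_param hy']
  exact key.isImmersion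

/-- The tangent space at x is E seen through the preferred chart at x, so the manifold derivative is
the ordinary derivative of the parametrization of that chart. -/
lemma mfderiv_eq (x : X) : letI := chartedSpace hj hA d i hi;
    mfderiv 𝓘(ℝ, E) 𝓘(ℝ, V) j x = fderiv ℝ (d (i x)).param
      ((d (i x)).toOpenPartialHomeomorph (j x)).1 := by
  let := chartedSpace hj hA d i hi
  have h := (isSmoothEmbedding hj hA d i hi).contMDiff.mdifferentiable (by simp) x
  have hx : ((d (i x)).toOpenPartialHomeomorph (j x)).1 ∈ (d (i x)).dom :=
    (d (i x)).fst_mem_dom (hi x) (hA ▸ mem_range_self x)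
  simp only [mfderiv, h, mfld_simps, fderivWithin_univ]
  apply Filter.EventuallyEq.fderiv_eq
  filter_upwards [(d (i x)).isOpen_dom.mem_nhds hx] with y hy
  exact (d (i x)).apply_chart_symm hj hA hy

end Charted

end SliceChart

/-! ### Pullbacks of constant forms -/

/-- The `2`-form `(v, w) ↦ B(v, w) - B(w, v)`. -/
def skewForm (V : Type*) [NormedAddCommGroup V] [NormedSpace ℝ V] :
    (V →L[ℝ] V →L[ℝ] ℝ) →L[ℝ] V [⋀^Fin 2]→L[ℝ] ℝ :=
  (ContinuousAlternatingMap.alternatizeUncurryFinCLM ℝ V ℝ).comp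
    (ContinuousLinearMap.compL ℝ V (V →L[ℝ] ℝ) (V [⋀^Fin 1]→L[ℝ] ℝ)
      ((ContinuousAlternatingMap.ofSubsingletonLIE (0 : Fin 1) :
        (V →L[ℝ] ℝ) ≃ₗᵢ[ℝ] V [⋀^Fin 1]→L[ℝ] ℝ).toContinuousLinearEquiv :
        (V →L[ℝ] ℝ) →L[ℝ] V [⋀^Fin 1]→L[ℝ] ℝ))

lemma skewForm_apply (B : V →L[ℝ] V →L[ℝ] ℝ) (v : Fin 2 → V) :
    skewForm V B v = B (v 0) (v 1) - B (v 1) (v 0) := by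
  simp [skewForm, ContinuousAlternatingMap.alternatizeUncurryFin_apply, Fin.sum_univ_two,
    Fin.removeNth, sub_eq_add_neg]

/-- The pullback along `σ` of the constant form `Ω`. -/
def pullbackForm (Ω : V [⋀^Fin 2]→L[ℝ] ℝ) (σ : E → V) (y : E) : E [⋀^Fin 2]→L[ℝ] ℝ :=
  Ω.compContinuousLinearMap (fderiv ℝ σ y)

/-- The exterior derivative commutes with pullback, and a constant form is closed. -/
lemma extDeriv_pullbackForm (Ω : V [⋀^Fin 2]→L[ℝ] ℝ) {σ : E → V} {y : E}
    (hσ : ContDiffAt ℝ ∞ σ y) : extDeriv (pullbackForm Ω σ) y = 0 := by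
  have hΩ : DifferentiableAt ℝ (fun _ : V => Ω) (σ y) := differentiableAt_const _
  have h := extDeriv_pullback hΩ hσ (by
    simp only [minSmoothness_of_isRCLikeNormedField]
    exact ENat.LEInfty.out)
  rw [show pullbackForm Ω σ =
    fun x => ((fun _ : V => Ω) (σ x)).compContinuousLinearMap (fderiv ℝ σ x) from rfl, h]
  have : extDeriv (fun _ : V => Ω) (σ y) = 0 := by
    ext v
    rw [extDeriv_apply (differentiableAt_const _)]
    simp
  rw [this]
  ext v
  simp

lemma skewForm_compContinuousLinearMap (B : V →L[ℝ] V →L[ℝ] ℝ) (f : E →L[ℝ] V) :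
    (skewForm V B).compContinuousLinearMap f =
      skewForm E (((ContinuousLinearMap.compL ℝ E V ℝ).flip f).comp (B.comp f)) := by
  ext v
  simp [skewForm_apply]

/-- Since `skewForm` is continuous linear in the bilinear map, the pullback is built from the
derivative of σ by continuous linear and bilinear operations only. -/
lemma contDiffOn_pullbackForm (B : V →L[ℝ] V →L[ℝ] ℝ) {σ : E → V} {s : Set E} (hs : IsOpen s)
    (hσ : ContDiffOn ℝ ∞ σ s) : ContDiffOn ℝ ∞ (pullbackForm (skewForm V B) σ) s := by
  have h1 : ContDiffOn ℝ ∞ (fderiv ℝ σ) s := hσ.fderiv_of_isOpen hs (by simp)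
  have h2 : ContDiffOn ℝ ∞
      (fun y => (ContinuousLinearMap.compL ℝ E V ℝ).flip (fderiv ℝ σ y)) s :=
    ContDiff.comp_contDiffOn (ContinuousLinearMap.contDiff _) h1
  have h3 : ContDiffOn ℝ ∞ (fun y => B.comp (fderiv ℝ σ y)) s := contDiffOn_const.clm_comp h1
  have h4 := (skewForm E).contDiff.comp_contDiffOn (h2.clm_comp h3)
  exact h4.congr fun y _ => skewForm_compContinuousLinearMap B _

end Slice

/-! ### Operators -/

section Operators

variable {H : Type u} [NormedAddCommGroup H] [InnerProductSpace ℂ H]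

lemma isCompactOperator_rankOne (x y : H) :
    IsCompactOperator (InnerProductSpace.rankOne ℂ x y : H →L[ℂ] H) := by
  rw [InnerProductSpace.rankOne_def']
  have h : IsCompactOperator (innerSL ℂ y : H →L[ℂ] ℂ) :=
    isCompactOperator_of_locallyCompactSpace_dom (innerSL ℂ y)
  exact h.clm_comp (ContinuousLinearMap.toSpanSingleton ℂ x)

/-- The Cayley transform `(1 + X / 2) (1 - X / 2)⁻¹` of an operator. -/
def cayleyOp (X : H →L[ℂ] H) : H →L[ℂ] H :=
  (1 + (2⁻¹ : ℝ) • X) * Ring.inverse (1 - (2⁻¹ : ℝ) • X)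

@[simp] lemma cayleyOp_zero : cayleyOp (0 : H →L[ℂ] H) = 1 := by simp [cayleyOp]

variable [CompleteSpace H]

lemma star_rankOne (x y : H) :
    star (InnerProductSpace.rankOne ℂ x y : H →L[ℂ] H) = InnerProductSpace.rankOne ℂ y x := by
  rw [ContinuousLinearMap.star_eq_adjoint]
  simp

lemma isClosed_skewCompact : IsClosed (SkewCompact H : Set (H →L[ℂ] H)) := by
  have h1 : IsClosed {A : H →L[ℂ] H | IsCompactOperator A} := isClosed_setOfPred_isCompactOperator
  have h2 : IsClosed {A : H →L[ℂ] H | star A = -A} :=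
    isClosed_eq continuous_star continuous_neg
  exact h1.inter h2

instance : CompleteSpace (SkewCompact H) := isClosed_skewCompact.completeSpace_coe

lemma inner_skew_left (X : SkewCompact H) (x y : H) :
    ⟪(X : H →L[ℂ] H) x, y⟫_ℂ = -⟪x, (X : H →L[ℂ] H) y⟫_ℂ := by
  rw [← ContinuousLinearMap.adjoint_inner_right, ← ContinuousLinearMap.star_eq_adjoint,
    SkewCompact.star_eq X]
  simp

/-- The skew-adjoint operator `|x⟩⟨y| - |y⟩⟨x|`. -/
def ketBra (x y : H) : SkewCompact H :=
  ⟨InnerProductSpace.rankOne ℂ x y - InnerProductSpace.rankOne ℂ y x,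
    (isCompactOperator_rankOne x y).sub (isCompactOperator_rankOne y x), by
      rw [star_sub, star_rankOne, star_rankOne, neg_sub]⟩

@[simp] lemma ketBra_apply (x y z : H) :
    (ketBra x y : H →L[ℂ] H) z = ⟪y, z⟫_ℂ • x - ⟪x, z⟫_ℂ • y := rfl

lemma norm_ketBra_le (x y : H) : ‖ketBra x y‖ ≤ 2 * ‖x‖ * ‖y‖ := by
  have h : ‖ketBra x y‖ ≤ ‖(InnerProductSpace.rankOne ℂ x y : H →L[ℂ] H)‖ +
      ‖(InnerProductSpace.rankOne ℂ y x : H →L[ℂ] H)‖ := by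
    rw [Submodule.coe_norm]
    exact norm_sub_le _ _
  rw [InnerProductSpace.norm_rankOne, InnerProductSpace.norm_rankOne] at h
  linarith

/-! ### The Cayley transform -/

/-- iY is self-adjoint, so i is not in its spectrum, and i - iY = i(1 - Y). -/
lemma isUnit_one_sub_skew {Y : H →L[ℂ] H} (hY : star Y = -Y) : IsUnit (1 - Y) := by
  have hA : IsSelfAdjoint (Complex.I • Y) := by
    rw [IsSelfAdjoint, star_smul, hY]
    simp
  have h : (Complex.I : ℂ) ∉ spectrum ℂ (Complex.I • Y) := fun h => by
    have := hA.im_eq_zero_of_mem_spectrum h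
    simp at this
  rw [spectrum.notMem_iff] at h
  have h2 : (algebraMap ℂ (H →L[ℂ] H)) Complex.I - Complex.I • Y = Complex.I • (1 - Y) := by
    rw [smul_sub, Algebra.algebraMap_eq_smul_one]
  rw [h2] at h
  have h3 := h.smul (Units.mk0 (-Complex.I) (by simp))
  simpa [Units.smul_def, smul_smul] using h3

lemma isUnit_cayley_den (X : SkewCompact H) : IsUnit (1 - (2⁻¹ : ℝ) • (X : H →L[ℂ] H)) :=
  isUnit_one_sub_skew (by rw [star_smul, SkewCompact.star_eq X, smul_neg, star_trivial])

lemma isUnit_cayley_num (X : SkewCompact H) : IsUnit (1 + (2⁻¹ : ℝ) • (X : H →L[ℂ] H)) := by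
  simpa using isUnit_cayley_den (-X)

/-- This factorization gives both the compactness of U - 1 and the derivative of the Cayley
transform at 0. The factor 1/2 makes that derivative the inclusion. -/
lemma cayleyOp_sub_one (X : SkewCompact H) :
    cayleyOp (X : H →L[ℂ] H) - 1 = X * Ring.inverse (1 - (2⁻¹ : ℝ) • (X : H →L[ℂ] H)) := by
  have h := Ring.mul_inverse_cancel _ (isUnit_cayley_den X)
  have h2 : (1 + (2⁻¹ : ℝ) • (X : H →L[ℂ] H)) - (1 - (2⁻¹ : ℝ) • (X : H →L[ℂ] H)) = X := by
    rw [add_sub_sub_cancel, ← add_smul]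
    norm_num
  calc cayleyOp (X : H →L[ℂ] H) - 1
      = (1 + (2⁻¹ : ℝ) • (X : H →L[ℂ] H)) * Ring.inverse (1 - (2⁻¹ : ℝ) • (X : H →L[ℂ] H)) -
        (1 - (2⁻¹ : ℝ) • (X : H →L[ℂ] H)) * Ring.inverse (1 - (2⁻¹ : ℝ) • (X : H →L[ℂ] H)) := by
        rw [h, cayleyOp]
    _ = _ := by rw [← sub_mul, h2]

lemma star_cayleyOp (X : SkewCompact H) :
    star (cayleyOp (X : H →L[ℂ] H)) = cayleyOp (-X : H →L[ℂ] H) := by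
  have hc : Commute (1 - (2⁻¹ : ℝ) • (X : H →L[ℂ] H)) (1 + (2⁻¹ : ℝ) • (X : H →L[ℂ] H)) := by
    apply Commute.sub_left (Commute.one_left _)
    exact (Commute.one_right _).add_right (Commute.refl _)
  rw [cayleyOp, cayleyOp, star_mul, ← Ring.inverse_star]
  simp only [star_add, star_sub, star_one, star_smul, star_trivial, SkewCompact.star_eq X, smul_neg,
    sub_neg_eq_add, ← sub_eq_add_neg]
  obtain ⟨a, ha⟩ := isUnit_cayley_num X
  rw [← ha] at hc ⊢
  rw [Ring.inverse_unit]
  exact hc.symm.units_inv_left.eq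

lemma cayleyOp_neg_mul (X : SkewCompact H) :
    cayleyOp (-X : H →L[ℂ] H) * cayleyOp (X : H →L[ℂ] H) = 1 := by
  have hc : Commute (1 - (2⁻¹ : ℝ) • (X : H →L[ℂ] H)) (1 + (2⁻¹ : ℝ) • (X : H →L[ℂ] H)) := by
    apply Commute.sub_left (Commute.one_left _)
    exact (Commute.one_right _).add_right (Commute.refl _)
  have h1 := Ring.mul_inverse_cancel _ (isUnit_cayley_den X)
  have h2 := Ring.inverse_mul_cancel _ (isUnit_cayley_num X)
  simp only [cayleyOp, smul_neg, sub_neg_eq_add, ← sub_eq_add_neg]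
  calc _ = (1 - (2⁻¹ : ℝ) • (X : H →L[ℂ] H)) *
        (Ring.inverse (1 + (2⁻¹ : ℝ) • (X : H →L[ℂ] H)) * (1 + (2⁻¹ : ℝ) • (X : H →L[ℂ] H))) *
        Ring.inverse (1 - (2⁻¹ : ℝ) • (X : H →L[ℂ] H)) := by simp only [mul_assoc]
    _ = 1 := by rw [h2, mul_one, h1]

/-- The Cayley transform from the Lie algebra of `U₀(H)` to `U₀(H)`. -/
def cayley (X : SkewCompact H) : UnitaryCompact H :=
  ⟨⟨cayleyOp X, by
    rw [Unitary.mem_iff, star_cayleyOp]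
    refine ⟨cayleyOp_neg_mul X, ?_⟩
    simpa using cayleyOp_neg_mul (-X)⟩, by
    change IsCompactOperator ((cayleyOp (X : H →L[ℂ] H) - 1 : H →L[ℂ] H) : H → H)
    rw [cayleyOp_sub_one]
    exact X.2.1.comp_clm _⟩

lemma coe_cayley (X : SkewCompact H) :
    ((cayley X : unitary (H →L[ℂ] H)) : H →L[ℂ] H) = cayleyOp X := rfl

lemma contDiff_cayleyOp : ContDiff ℝ ∞ fun X : SkewCompact H => cayleyOp (X : H →L[ℂ] H) := by
  have hX : ContDiff ℝ ∞ fun X : SkewCompact H => (X : H →L[ℂ] H) :=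
    (SkewCompact H).subtypeL.contDiff
  refine (contDiff_const.add (hX.const_smul _)).mul ?_
  rw [contDiff_iff_contDiffAt]
  intro X
  obtain ⟨a, ha⟩ := isUnit_cayley_den X
  have h1 : ContDiffAt ℝ ∞ Ring.inverse (1 - (2⁻¹ : ℝ) • (X : H →L[ℂ] H)) := by
    rw [← ha]
    exact contDiffAt_ringInverse ℝ a
  exact h1.comp X (contDiffAt_const.sub (hX.contDiffAt.const_smul _))

/-- The remainder is X((1 - X/2)⁻¹ - 1), a product of O(‖X‖) and o(1). -/
lemma hasFDerivAt_cayleyOp_zero :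
    HasFDerivAt (fun X : SkewCompact H => cayleyOp (X : H →L[ℂ] H)) (SkewCompact H).subtypeL 0 := by
  apply HasFDerivAt.of_isLittleO
  have hg : Filter.Tendsto
      (fun X : SkewCompact H => Ring.inverse (1 - (2⁻¹ : ℝ) • (X : H →L[ℂ] H)) - 1)
      (𝓝 0) (𝓝 0) := by
    have hc : ContinuousAt (Ring.inverse : (H →L[ℂ] H) → H →L[ℂ] H)
        (1 - (2⁻¹ : ℝ) • ((0 : SkewCompact H) : H →L[ℂ] H)) := by
      simpa using NormedRing.inverse_continuousAt (1 : (H →L[ℂ] H)ˣ)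
    have hd : ContinuousAt (fun X : SkewCompact H => 1 - (2⁻¹ : ℝ) • (X : H →L[ℂ] H)) 0 := by
      fun_prop
    have h := (hc.comp (f := fun X : SkewCompact H => 1 - (2⁻¹ : ℝ) • (X : H →L[ℂ] H)) hd).tendsto
    simpa using h.sub_const 1
  have h1 : (fun X : SkewCompact H => (X : H →L[ℂ] H)) =O[𝓝 0] fun X => ‖X‖ :=
    Asymptotics.IsBigO.of_bound 1 (Filter.Eventually.of_forall fun X => by simp)
  have h2 := h1.mul_isLittleO ((Asymptotics.isLittleO_one_iff ℝ).2 hg)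
  rw [← Asymptotics.isLittleO_norm_right]
  refine Asymptotics.IsLittleO.congr' h2 (Filter.Eventually.of_forall fun X => ?_)
    (Filter.Eventually.of_forall fun X => by simp)
  have h3 := cayleyOp_sub_one X
  simp only [ZeroMemClass.coe_zero, cayleyOp_zero, h3, sub_zero, mul_sub, mul_one,
    Submodule.subtypeL_apply]

end Operators

/-! ### The coadjoint action -/

lemma hasFDerivAt_comp_snd {D E G : Type*} [NormedAddCommGroup D] [NormedSpace ℝ D]
    [NormedAddCommGroup E] [NormedSpace ℝ E] [NormedAddCommGroup G] [NormedSpace ℝ G]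
    {C : D → E →L[ℝ] E} {C' : D →L[ℝ] E →L[ℝ] E} {x : D} (hC : HasFDerivAt C C' x)
    (hx : C x = 1) (f : E →L[ℝ] G) {L : D × (E →L[ℝ] G) →L[ℝ] E →L[ℝ] G}
    (hL : ∀ p Z, L p Z = f (C' p.1 Z) + p.2 Z) :
    HasFDerivAt (fun p : D × (E →L[ℝ] G) => p.2.comp (C p.1)) L (x, f) := by
  have h1 : HasFDerivAt (fun p : D × (E →L[ℝ] G) => C p.1)
      (C'.comp (ContinuousLinearMap.fst ℝ D (E →L[ℝ] G))) (x, f) :=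
    HasFDerivAt.comp (g := C) (f := Prod.fst) (x, f) hC hasFDerivAt_fst
  have h2 := (hasFDerivAt_snd (𝕜 := ℝ) (p := (x, f))).clm_comp h1
  refine h2.congr_fderiv (ContinuousLinearMap.ext fun p => ContinuousLinearMap.ext fun Z => ?_)
  rw [hL]
  simp [hx]

lemma hasFDerivAt_bilinear_diag {D E G : Type*} [NormedAddCommGroup D] [NormedSpace ℝ D]
    [NormedAddCommGroup E] [NormedSpace ℝ E] [NormedAddCommGroup G] [NormedSpace ℝ G]
    (B : E →L[ℝ] E →L[ℝ] G) {c : D → E} {c' : D →L[ℝ] E} {x : D} (hc : HasFDerivAt c c' x)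
    {e : E} (he : c x = e) {L : D →L[ℝ] G} (hL : ∀ v, L v = B e (c' v) + B (c' v) e) :
    HasFDerivAt (fun y => B (c y) (c y)) L x := by
  refine (B.hasFDerivAt_of_bilinear hc hc).congr_fderiv ?_
  ext1 v
  simp [hL, he]

section Coadjoint

variable {H : Type u} [NormedAddCommGroup H] [InnerProductSpace ℂ H] [CompleteSpace H]

/-- The map `Y ↦ (A* Y B + B* Y A) / 2`. -/
def conjMap (A B : H →L[ℂ] H) : SkewCompact H →L[ℝ] SkewCompact H where
  toFun Y := ⟨(2⁻¹ : ℝ) • (star A * Y * B + star B * Y * A),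
    (((Y.2.1.clm_comp (star A)).comp_clm B).add
      ((Y.2.1.clm_comp (star B)).comp_clm A)).smul (2⁻¹ : ℝ), by
    simp only [star_smul, star_add, star_mul, star_star, SkewCompact.star_eq, star_trivial]
    rw [← smul_neg]
    congr 1
    noncomm_ring⟩
  map_add' Y Z := by
    ext1
    simp only [Submodule.coe_add, ← smul_add, mul_add, add_mul]
    congr 1
    abel
  map_smul' c Y := by
    ext1
    simp [smul_comm c]
  cont := by
    refine Continuous.subtype_mk ?_ _
    fun_prop

lemma coe_conjMap (A B : H →L[ℂ] H) (Y : SkewCompact H) :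
    (conjMap A B Y : H →L[ℂ] H) = (2⁻¹ : ℝ) • (star A * Y * B + star B * Y * A) := rfl

lemma norm_conjMap_le (A B : H →L[ℂ] H) : ‖conjMap A B‖ ≤ ‖A‖ * ‖B‖ := by
  refine ContinuousLinearMap.opNorm_le_bound _ (by positivity) fun Y => ?_
  rw [Submodule.coe_norm, coe_conjMap]
  refine (norm_smul_le _ _).trans ?_
  have h1 : ‖star A * (Y : H →L[ℂ] H) * B‖ ≤ ‖A‖ * ‖Y‖ * ‖B‖ := by
    refine (norm_mul_le _ _).trans ?_
    gcongr
    exact (norm_mul_le _ _).trans_eq (by rw [norm_star, Submodule.coe_norm])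
  have h2 : ‖star B * (Y : H →L[ℂ] H) * A‖ ≤ ‖B‖ * ‖Y‖ * ‖A‖ := by
    refine (norm_mul_le _ _).trans ?_
    gcongr
    exact (norm_mul_le _ _).trans_eq (by rw [norm_star, Submodule.coe_norm])
  have h3 := norm_add_le (star A * (Y : H →L[ℂ] H) * B) (star B * (Y : H →L[ℂ] H) * A)
  rw [norm_inv, Real.norm_ofNat]
  linarith

variable (H) in
/-- The map `(A, B) ↦ conjMap A B` as a continuous bilinear map. -/
def conjBilin : (H →L[ℂ] H) →L[ℝ] (H →L[ℂ] H) →L[ℝ] (SkewCompact H →L[ℝ] SkewCompact H) :=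
  LinearMap.mkContinuous₂ (LinearMap.mk₂ ℝ (conjMap (H := H))
    (fun A A' B => by
      ext1 Y; ext1
      simp only [add_apply, Submodule.coe_add, coe_conjMap, ← smul_add, star_add, mul_add, add_mul]
      congr 1
      abel)
    (fun c A B => by
      ext1 Y; ext1
      simp [coe_conjMap, smul_comm c])
    (fun A B B' => by
      ext1 Y; ext1
      simp only [add_apply, Submodule.coe_add, coe_conjMap, ← smul_add, star_add, mul_add, add_mul]
      congr 1
      abel)
    (fun c A B => by
      ext1 Y; ext1
      simp [coe_conjMap, smul_comm c])) 1
    (fun A B => by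
      rw [one_mul]
      exact norm_conjMap_le A B)

lemma conjBilin_apply (A B : H →L[ℂ] H) : conjBilin H A B = conjMap A B := rfl

/-- The coadjoint action is quadratic in U, because U⁻¹ = U*. Symmetrizing A* Y B in A and B keeps
the values skew-adjoint, so the action is the diagonal of a bounded bilinear map and its calculus is
elementary. -/
lemma conjMap_self (U : UnitaryCompact H) :
    conjMap (U : H →L[ℂ] H) (U : H →L[ℂ] H) = adjointAction U⁻¹ := by
  ext1 Y; ext1
  rw [coe_conjMap, ← two_smul ℝ, smul_smul]
  simp [adjointAction, ← Unitary.star_eq_inv]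

lemma conjMap_one_add (X : SkewCompact H) :
    conjMap 1 (X : H →L[ℂ] H) + conjMap (X : H →L[ℂ] H) 1 = -bracket X := by
  ext1 Y; ext1
  simp only [add_apply, neg_apply, Submodule.coe_add, Submodule.coe_neg, coe_conjMap, star_one,
    one_mul, mul_one, SkewCompact.star_eq X]
  rw [add_comm (-(X : H →L[ℂ] H) * Y), ← smul_add, ← two_smul ℝ, smul_smul]
  simp [bracket, ← sub_eq_add_neg]

lemma coe_adjointAction (U : UnitaryCompact H) (X : SkewCompact H) :
    (adjointAction U X : H →L[ℂ] H) = (U : H →L[ℂ] H) * X * star (U : H →L[ℂ] H) := rfl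

lemma coe_bracket (X Y : SkewCompact H) :
    (bracket X Y : H →L[ℂ] H) = (X : H →L[ℂ] H) * Y - Y * X := rfl

lemma adjointAction_mul (U V : UnitaryCompact H) (X : SkewCompact H) :
    adjointAction (U * V) X = adjointAction U (adjointAction V X) := by
  ext1
  simp [coe_adjointAction, mul_assoc]

lemma adjointAction_one (X : SkewCompact H) : adjointAction 1 X = X := by
  ext1
  simp [coe_adjointAction]

lemma adjointAction_bracket (U : UnitaryCompact H) (X Y : SkewCompact H) :
    adjointAction U (bracket X Y) = bracket (adjointAction U X) (adjointAction U Y) := by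
  have h : star (U : H →L[ℂ] H) * (U : H →L[ℂ] H) = 1 := Unitary.star_mul_self_of_mem U.1.2
  have h2 (A B : H →L[ℂ] H) : (U : H →L[ℂ] H) * A * star (U : H →L[ℂ] H) *
      ((U : H →L[ℂ] H) * B * star (U : H →L[ℂ] H)) =
      (U : H →L[ℂ] H) * (A * B) * star (U : H →L[ℂ] H) := by
    calc _ = (U : H →L[ℂ] H) * A * (star (U : H →L[ℂ] H) *
        (U : H →L[ℂ] H)) * B * star (U : H →L[ℂ] H) := by simp only [mul_assoc]
      _ = _ := by rw [h, mul_one]; simp only [mul_assoc]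
  ext1
  simp only [coe_adjointAction, coe_bracket, h2, mul_sub, sub_mul]

lemma coadjointAction_mul (U V : UnitaryCompact H) (f : SkewCompactDual H) :
    coadjointAction (U * V) f = coadjointAction U (coadjointAction V f) := by
  ext X
  simp [coadjointAction, adjointAction_mul]

lemma coadjointAction_one (f : SkewCompactDual H) : coadjointAction 1 f = f := by
  ext X
  simp [coadjointAction, adjointAction_one]

lemma coadjointAction_inv_self (U : UnitaryCompact H) (f : SkewCompactDual H) :
    coadjointAction U⁻¹ (coadjointAction U f) = f := by
  rw [← coadjointAction_mul, inv_mul_cancel, coadjointAction_one]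

lemma coadjointAction_self_inv (U : UnitaryCompact H) (f : SkewCompactDual H) :
    coadjointAction U (coadjointAction U⁻¹ f) = f := by
  rw [← coadjointAction_mul, mul_inv_cancel, coadjointAction_one]

lemma coadjointField_apply (X Z : SkewCompact H) (f : SkewCompactDual H) :
    coadjointField X f Z = -f (bracket X Z) := rfl

lemma coadjointAction_coadjointField (U : UnitaryCompact H) (X : SkewCompact H)
    (f : SkewCompactDual H) :
    coadjointAction U (coadjointField X f) =
      coadjointField (adjointAction U X) (coadjointAction U f) := by
  ext Z
  simp only [coadjointAction, coadjointField_apply, ContinuousLinearMap.comp_apply,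
    adjointAction_bracket]
  rw [← adjointAction_mul, inv_mul_cancel, adjointAction_one]

/-- The coadjoint action of a unitary as a linear isomorphism. -/
def coadjointEquiv (U : UnitaryCompact H) : SkewCompactDual H ≃L[ℝ] SkewCompactDual H :=
  ContinuousLinearEquiv.equivOfInverse
    ((ContinuousLinearMap.compL ℝ (SkewCompact H) (SkewCompact H) ℝ).flip (adjointAction U⁻¹))
    ((ContinuousLinearMap.compL ℝ (SkewCompact H) (SkewCompact H) ℝ).flip (adjointAction U⁻¹⁻¹))
    (coadjointAction_inv_self U) (coadjointAction_self_inv U)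

@[simp] lemma coadjointEquiv_apply (U : UnitaryCompact H) (f : SkewCompactDual H) :
    coadjointEquiv U f = coadjointAction U f := rfl

@[simp] lemma coadjointEquiv_symm_apply (U : UnitaryCompact H) (f : SkewCompactDual H) :
    (coadjointEquiv U).symm f = coadjointAction U⁻¹ f := rfl

lemma coadjointAction_cayley (X : SkewCompact H) (f : SkewCompactDual H) :
    coadjointAction (cayley X) f =
      f.comp (conjBilin H (cayleyOp (X : H →L[ℂ] H)) (cayleyOp X)) := by
  rw [conjBilin_apply, ← coe_cayley, conjMap_self]
  rfl

lemma contDiff_coadjointAction_cayley : ContDiff ℝ ∞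
    fun p : SkewCompact H × SkewCompactDual H => coadjointAction (cayley p.1) p.2 := by
  simp only [coadjointAction_cayley]
  have h : ContDiff ℝ ∞ fun p : SkewCompact H × SkewCompactDual H =>
    cayleyOp (p.1 : H →L[ℂ] H) := contDiff_cayleyOp.comp contDiff_fst
  exact contDiff_snd.clm_comp (((conjBilin H).contDiff.comp h).clm_apply h)

/-- The derivative of `A ↦ conjMap A A` at `1`. -/
def conjDeriv : (H →L[ℂ] H) →L[ℝ] (SkewCompact H →L[ℝ] SkewCompact H) :=
  conjBilin H (1 : H →L[ℂ] H) + (conjBilin H).flip (1 : H →L[ℂ] H)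

/-- The derivative of `X ↦ conjMap (cayleyOp X) (cayleyOp X)` at `0`. -/
def conjCayleyDeriv : SkewCompact H →L[ℝ] (SkewCompact H →L[ℝ] SkewCompact H) :=
  (conjDeriv (H := H)).comp (SkewCompact H).subtypeL

lemma conjCayleyDeriv_apply (X : SkewCompact H) : conjCayleyDeriv X = -bracket X :=
  conjMap_one_add X

lemma hasFDerivAt_conj_cayley_zero :
    HasFDerivAt (fun X : SkewCompact H => conjBilin H (cayleyOp (X : H →L[ℂ] H)) (cayleyOp X))
      (conjCayleyDeriv (H := H)) 0 := by
  apply hasFDerivAt_bilinear_diag (conjBilin H) (e := 1)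
  · exact (hasFDerivAt_cayleyOp_zero (H := H))
  · exact cayleyOp_zero
  · intro v
    rfl

lemma hasFDerivAt_coadjointAction_cayley (f : SkewCompactDual H)
    {L : SkewCompact H × SkewCompactDual H →L[ℝ] SkewCompactDual H}
    (hL : ∀ p, L p = coadjointField p.1 f + p.2) :
    HasFDerivAt (fun p : SkewCompact H × SkewCompactDual H => coadjointAction (cayley p.1) p.2)
      L (0, f) := by
  simp only [coadjointAction_cayley]
  refine hasFDerivAt_comp_snd (hasFDerivAt_conj_cayley_zero (H := H)) ?_ f fun p Z => ?_
  · ext1 Z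
    ext1
    rw [conjBilin_apply, coe_conjMap, ← two_smul ℝ, smul_smul]
    simp
  · rw [hL, add_apply, coadjointField_apply, conjCayleyDeriv_apply, neg_apply, map_neg]

end Coadjoint

/-! ### The momentum maps -/

section Momentum

variable {H : Type u} [NormedAddCommGroup H] [InnerProductSpace ℂ H] {M N : ℕ}

lemma indefForm_add_left (ψ ψ' φ : TensorSpace H M N) :
    indefForm (ψ + ψ') φ = indefForm ψ φ + indefForm ψ' φ := by
  simp [indefForm, mul_add, Finset.sum_add_distrib]

lemma indefForm_add_right (ψ φ φ' : TensorSpace H M N) :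
    indefForm ψ (φ + φ') = indefForm ψ φ + indefForm ψ φ' := by
  simp [indefForm, mul_add, Finset.sum_add_distrib]

lemma indefForm_smul_left (c : ℝ) (ψ φ : TensorSpace H M N) :
    indefForm (c • ψ) φ = c * indefForm ψ φ := by
  simp only [indefForm, PiLp.smul_apply, Finset.mul_sum]
  refine Finset.sum_congr rfl fun k _ => ?_
  rw [← Complex.coe_smul, inner_smul_right]
  ring

lemma indefForm_neg_left (ψ φ : TensorSpace H M N) : indefForm (-ψ) φ = -indefForm ψ φ := by
  simp [indefForm]

lemma indefForm_smul_right (c : ℝ) (ψ φ : TensorSpace H M N) :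
    indefForm ψ (c • φ) = c * indefForm ψ φ := by
  simp only [indefForm, PiLp.smul_apply, Finset.mul_sum]
  refine Finset.sum_congr rfl fun k _ => ?_
  rw [← Complex.coe_smul, inner_smul_left, Complex.conj_ofReal]
  ring

lemma star_sgn (k : Fin M ⊕ Fin N) : (starRingEnd ℂ) (sgn M N k) = sgn M N k := by
  rcases k with k | k <;> simp [sgn]

lemma norm_sgn (k : Fin M ⊕ Fin N) : ‖sgn M N k‖ = 1 := by
  rcases k with k | k <;> simp [sgn]

lemma conj_indefForm (ψ φ : TensorSpace H M N) :
    (starRingEnd ℂ) (indefForm ψ φ) = indefForm φ ψ := by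
  simp [indefForm, star_sgn]

lemma norm_indefForm_le (ψ φ : TensorSpace H M N) :
    ‖indefForm ψ φ‖ ≤ (M + N) * ‖ψ‖ * ‖φ‖ := by
  have h (k : Fin M ⊕ Fin N) : ‖sgn M N k * ⟪φ k, ψ k⟫_ℂ‖ ≤ ‖ψ‖ * ‖φ‖ := by
    rw [norm_mul, norm_sgn, one_mul, mul_comm]
    refine (norm_inner_le_norm _ _).trans ?_
    gcongr
    · exact PiLp.norm_apply_le φ k
    · exact PiLp.norm_apply_le ψ k
  refine (norm_sum_le_of_le _ fun k _ => h k).trans ?_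
  simp [mul_assoc]

lemma norm_leftMul_le (A : H →L[ℂ] H) (ψ : TensorSpace H M N) :
    ‖leftMul A ψ‖ ≤ ‖A‖ * ‖ψ‖ := by
  rw [PiLp.norm_eq_of_L2, PiLp.norm_eq_of_L2]
  refine Real.sqrt_le_iff.2 ⟨by positivity, ?_⟩
  rw [mul_pow, Real.sq_sqrt (by positivity), Finset.mul_sum]
  refine Finset.sum_le_sum fun k _ => ?_
  rw [← mul_pow]
  gcongr
  exact A.le_opNorm _

variable (H M N) in
/-- The bilinear form `-Im (ψ, φ)_S`, which is half the symplectic form. -/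
def halfSymplectic : TensorSpace H M N →L[ℝ] TensorSpace H M N →L[ℝ] ℝ :=
  LinearMap.mkContinuous₂ (LinearMap.mk₂ ℝ (fun ψ φ => -(indefForm ψ φ).im)
    (fun ψ ψ' φ => by simp [indefForm_add_left, add_comm])
    (fun c ψ φ => by simp [indefForm_smul_left])
    (fun ψ φ φ' => by simp [indefForm_add_right, add_comm])
    (fun c ψ φ => by simp [indefForm_smul_right])) (M + N)
    (fun ψ φ => by
      rw [LinearMap.mk₂_apply, norm_neg]
      exact (Complex.abs_im_le_norm _).trans (norm_indefForm_le ψ φ))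

lemma halfSymplectic_apply (ψ φ : TensorSpace H M N) :
    halfSymplectic H M N ψ φ = -(indefForm ψ φ).im := rfl

lemma halfSymplectic_swap (ψ φ : TensorSpace H M N) :
    halfSymplectic H M N φ ψ = -halfSymplectic H M N ψ φ := by
  rw [halfSymplectic_apply, ← conj_indefForm]
  simp [halfSymplectic_apply]

lemma symplecticForm_eq (ψ φ : TensorSpace H M N) :
    symplecticForm ψ φ = 2 * halfSymplectic H M N ψ φ := by
  rw [symplecticForm, halfSymplectic_apply]
  ring

lemma skewForm_halfSymplectic (v : Fin 2 → TensorSpace H M N) :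
    skewForm _ (halfSymplectic H M N) v = symplecticForm (v 0) (v 1) := by
  rw [skewForm_apply, halfSymplectic_swap (v 0), symplecticForm_eq]
  ring

/-- Both momentum maps have components ψ ↦ h(Aψ, ψ), with h half of ω and A skew for the indefinite
form. The two terms of the product rule then coincide, which turns h into ω. -/
lemma isMomentumMap_aux (A : TensorSpace H M N →L[ℝ] TensorSpace H M N)
    (hA : ∀ ψ φ, indefForm (A ψ) φ = -indefForm ψ (A φ)) (ψ : TensorSpace H M N) :
    DifferentiableAt ℝ (fun φ => (Complex.I * indefForm (A φ) φ).re) ψ ∧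
      ∀ ξ, fderiv ℝ (fun φ => (Complex.I * indefForm (A φ) φ).re) ψ ξ =
        symplecticForm (A ψ) ξ := by
  have h : (fun φ => (Complex.I * indefForm (A φ) φ).re) =
      fun φ => halfSymplectic H M N (A φ) φ := by
    ext φ
    simp [halfSymplectic_apply]
  have h1 := (halfSymplectic H M N).hasFDerivAt_of_bilinear A.hasFDerivAt (hasFDerivAt_id ψ)
  rw [h]
  refine ⟨h1.differentiableAt, fun ξ => ?_⟩
  refine (DFunLike.congr_fun h1.fderiv ξ).trans ?_
  have h2 : halfSymplectic H M N (A ξ) ψ = halfSymplectic H M N (A ψ) ξ := by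
    rw [halfSymplectic_apply, hA, ← conj_indefForm]
    simp [halfSymplectic_apply]
  simp [symplecticForm_eq, h2]
  ring

/-- The right action of a matrix, as a continuous linear map. -/
def rightMulL (A : Matrix (Fin M ⊕ Fin N) (Fin M ⊕ Fin N) ℂ) :
    TensorSpace H M N →L[ℝ] TensorSpace H M N where
  toFun ψ := rightMul ψ A
  map_add' ψ φ := by
    ext k
    simp [rightMul, Finset.sum_add_distrib]
  map_smul' c ψ := by
    ext k
    simp [rightMul, Finset.smul_sum, smul_comm c]
  cont := by
    unfold rightMul
    fun_prop

@[simp] lemma rightMulL_apply (A : Matrix (Fin M ⊕ Fin N) (Fin M ⊕ Fin N) ℂ)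
    (ψ : TensorSpace H M N) : rightMulL A ψ = rightMul ψ A := rfl

lemma sgn_mul_pseudoSkew (X : PseudoSkew M N) (i k : Fin M ⊕ Fin N) :
    sgn M N k * X.1 i k = -(sgn M N i * (starRingEnd ℂ) (X.1 k i)) := by
  have hX : (X : Matrix _ _ ℂ) * sigMatrix M N + sigMatrix M N * (X : Matrix _ _ ℂ)ᴴ = 0 := X.2
  have := congrFun (congrFun hX i) k
  rw [Matrix.add_apply, sigMatrix, Matrix.mul_diagonal, Matrix.diagonal_mul,
    Matrix.conjTranspose_apply] at this
  rw [eq_neg_iff_add_eq_zero, mul_comm]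
  exact this

lemma indefForm_rightMul_pseudoSkew (X : PseudoSkew M N) (ψ φ : TensorSpace H M N) :
    indefForm (rightMul ψ (X : Matrix _ _ ℂ)) φ =
      -indefForm ψ (rightMul φ (X : Matrix _ _ ℂ)) := by
  have h1 : indefForm (rightMul ψ (X : Matrix _ _ ℂ)) φ =
      ∑ k, ∑ i, sgn M N k * X.1 i k * ⟪φ k, ψ i⟫_ℂ := by
    simp only [indefForm, rightMul, inner_sum, inner_smul_right, Finset.mul_sum, mul_assoc]
  have h2 : indefForm ψ (rightMul φ (X : Matrix _ _ ℂ)) =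
      ∑ i, ∑ k, sgn M N i * (starRingEnd ℂ) (X.1 k i) * ⟪φ k, ψ i⟫_ℂ := by
    simp only [indefForm, rightMul, sum_inner, inner_smul_left, Finset.mul_sum, mul_assoc]
  rw [h1, h2, Finset.sum_comm, ← Finset.sum_neg_distrib]
  refine Finset.sum_congr rfl fun i _ => ?_
  rw [← Finset.sum_neg_distrib]
  refine Finset.sum_congr rfl fun k _ => ?_
  rw [sgn_mul_pseudoSkew, neg_mul]

lemma momentumRight_apply (ψ : TensorSpace H M N) (X : PseudoSkew M N) :
    momentumRight ψ X = (Complex.I * indefForm (rightMulL (X : Matrix _ _ ℂ) ψ) ψ).re := rfl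

lemma isMomentumMap_momentumRight :
    IsMomentumMap (H := H) (fun (X : PseudoSkew M N) ψ => rightMul ψ (X : Matrix _ _ ℂ))
      (fun ψ X => momentumRight ψ X) := by
  intro X ψ
  have h := isMomentumMap_aux (H := H) (M := M) (N := N) (rightMulL X.1)
    (indefForm_rightMul_pseudoSkew X) ψ
  simp only [← momentumRight_apply] at h
  exact h

/-- The left action of an operator, as a continuous linear map. -/
def leftMulL (A : H →L[ℂ] H) : TensorSpace H M N →L[ℝ] TensorSpace H M N where
  toFun ψ := leftMul A ψ
  map_add' ψ φ := by
    ext k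
    simp [leftMul]
  map_smul' c ψ := by
    ext k
    simp [leftMul]
  cont := by
    unfold leftMul
    fun_prop

@[simp] lemma leftMulL_apply (A : H →L[ℂ] H) (ψ : TensorSpace H M N) :
    leftMulL A ψ = leftMul A ψ := rfl

@[simp] lemma leftMul_apply (A : H →L[ℂ] H) (ψ : TensorSpace H M N) (k) :
    leftMul A ψ k = A (ψ k) := rfl

/-- The orbit map of the left action, as a continuous linear map. -/
def leftMulR (ψ : TensorSpace H M N) : (H →L[ℂ] H) →L[ℝ] TensorSpace H M N where
  toFun A := leftMul A ψ
  map_add' A B := by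
    ext k
    simp
  map_smul' c A := by
    ext k
    simp
  cont := by
    unfold leftMul
    fun_prop

@[simp] lemma leftMulR_apply (A : H →L[ℂ] H) (ψ : TensorSpace H M N) :
    leftMulR ψ A = leftMul A ψ := rfl

lemma leftMul_mul (A B : H →L[ℂ] H) (ψ : TensorSpace H M N) :
    leftMul (A * B) ψ = leftMul A (leftMul B ψ) := rfl

@[simp] lemma leftMul_one (ψ : TensorSpace H M N) : leftMul (1 : H →L[ℂ] H) ψ = ψ := rfl

lemma leftMul_rightMul (A : H →L[ℂ] H) (ψ : TensorSpace H M N)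
    (B : Matrix (Fin M ⊕ Fin N) (Fin M ⊕ Fin N) ℂ) :
    leftMul A (rightMul ψ B) = rightMul (leftMul A ψ) B := by
  ext k
  simp [rightMul]

variable [CompleteSpace H]

lemma indefForm_leftMul_skew (Y : SkewCompact H) (ψ φ : TensorSpace H M N) :
    indefForm (leftMul (Y : H →L[ℂ] H) ψ) φ = -indefForm ψ (leftMul (Y : H →L[ℂ] H) φ) := by
  simp [indefForm, inner_skew_left]

lemma isMomentumMap_momentumLeft :
    IsMomentumMap (M := M) (N := N) (fun (Y : SkewCompact H) ψ => leftMul (Y : H →L[ℂ] H) ψ)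
      (fun ψ Y => momentumLeft ψ Y) := fun Y ψ =>
  isMomentumMap_aux (leftMulL (Y : H →L[ℂ] H)) (indefForm_leftMul_skew Y) ψ

lemma indefForm_leftMul_left (A : H →L[ℂ] H) (ψ φ : TensorSpace H M N) :
    indefForm (leftMul A ψ) φ = indefForm ψ (leftMul (star A) φ) := by
  simp [indefForm, ContinuousLinearMap.star_eq_adjoint, ContinuousLinearMap.adjoint_inner_left]

lemma star_unitaryCompact_mul (U : UnitaryCompact H) :
    star (U : H →L[ℂ] H) * (U : H →L[ℂ] H) = 1 := Unitary.star_mul_self_of_mem U.1.2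

lemma unitaryCompact_mul_star (U : UnitaryCompact H) :
    (U : H →L[ℂ] H) * star (U : H →L[ℂ] H) = 1 := Unitary.mul_star_self_of_mem U.1.2

lemma coe_unitaryCompact_inv (U : UnitaryCompact H) :
    ((U⁻¹ : UnitaryCompact H) : H →L[ℂ] H) = star (U : H →L[ℂ] H) := by
  simp [← Unitary.star_eq_inv]

lemma inner_unitaryCompact (U : UnitaryCompact H) (x y : H) :
    ⟪(U : H →L[ℂ] H) x, (U : H →L[ℂ] H) y⟫_ℂ = ⟪x, y⟫_ℂ := by
  rw [← ContinuousLinearMap.adjoint_inner_right, ← ContinuousLinearMap.star_eq_adjoint,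
    ← mul_apply_eq_comp, star_unitaryCompact_mul, one_apply_eq_self]

/-- The left action of a unitary as a linear isomorphism. -/
def leftMulEquiv (U : UnitaryCompact H) : TensorSpace H M N ≃L[ℝ] TensorSpace H M N :=
  ContinuousLinearEquiv.equivOfInverse (leftMulL (U : H →L[ℂ] H))
    (leftMulL ((U⁻¹ : UnitaryCompact H) : H →L[ℂ] H))
    (fun ψ => by
      rw [leftMulL_apply, leftMulL_apply, ← leftMul_mul, coe_unitaryCompact_inv,
        star_unitaryCompact_mul, leftMul_one])
    (fun ψ => by
      rw [leftMulL_apply, leftMulL_apply, ← leftMul_mul, coe_unitaryCompact_inv,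
        unitaryCompact_mul_star, leftMul_one])

@[simp] lemma leftMulEquiv_apply (U : UnitaryCompact H) (ψ : TensorSpace H M N) :
    leftMulEquiv U ψ = leftMul (U : H →L[ℂ] H) ψ := rfl

@[simp] lemma leftMulEquiv_symm_apply (U : UnitaryCompact H) (ψ : TensorSpace H M N) :
    (leftMulEquiv U).symm ψ = leftMul ((U⁻¹ : UnitaryCompact H) : H →L[ℂ] H) ψ := rfl

lemma momentumLeft_apply (ψ : TensorSpace H M N) (Y : SkewCompact H) :
    momentumLeft ψ Y = halfSymplectic H M N (leftMul (Y : H →L[ℂ] H) ψ) ψ := by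
  simp [momentumLeft, halfSymplectic_apply]

lemma momentumLeft_leftMul (U : UnitaryCompact H) (ψ : TensorSpace H M N) :
    momentumLeft (leftMul (U : H →L[ℂ] H) ψ) = coadjointAction U (momentumLeft ψ) := by
  ext Y
  rw [coadjointAction, ContinuousLinearMap.comp_apply, momentumLeft_apply, momentumLeft_apply,
    halfSymplectic_apply, halfSymplectic_apply, coe_adjointAction, coe_unitaryCompact_inv,
    star_star, ← conj_indefForm, indefForm_leftMul_left, conj_indefForm, leftMul_mul, leftMul_mul]

/-- The functional `Y ↦ -Im (Y ψ, φ)_S`. -/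
def momentumPair (ψ φ : TensorSpace H M N) : SkewCompactDual H where
  toFun Y := halfSymplectic H M N (leftMul (Y : H →L[ℂ] H) ψ) φ
  map_add' X Y := by
    rw [Submodule.coe_add, ← leftMulR_apply, map_add, map_add]
    rfl
  map_smul' c X := by
    rw [Submodule.coe_smul, ← leftMulR_apply, map_smul, map_smul]
    rfl
  cont := by
    have h : Continuous fun Y : SkewCompact H =>
        halfSymplectic H M N (leftMulR ψ (Y : H →L[ℂ] H)) φ := by
      fun_prop
    exact h

lemma momentumPair_apply (ψ φ : TensorSpace H M N) (Y : SkewCompact H) :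
    momentumPair ψ φ Y = halfSymplectic H M N (leftMul (Y : H →L[ℂ] H) ψ) φ := rfl

lemma norm_momentumPair_le (ψ φ : TensorSpace H M N) :
    ‖momentumPair ψ φ‖ ≤ ‖halfSymplectic H M N‖ * ‖ψ‖ * ‖φ‖ := by
  refine ContinuousLinearMap.opNorm_le_bound _ (by positivity) fun Y => ?_
  refine ((halfSymplectic H M N).le_opNorm₂ _ _).trans ?_
  have := norm_leftMul_le (Y : H →L[ℂ] H) ψ
  calc _ ≤ ‖halfSymplectic H M N‖ * (‖(Y : H →L[ℂ] H)‖ * ‖ψ‖) * ‖φ‖ := by gcongr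
    _ = _ := by rw [Submodule.coe_norm]; ring

variable (H M N) in
/-- The functionals `Y ↦ -Im (Y ψ, φ)_S`, as a continuous bilinear map. -/
def momentumBilin : TensorSpace H M N →L[ℝ] TensorSpace H M N →L[ℝ] SkewCompactDual H :=
  LinearMap.mkContinuous₂ (LinearMap.mk₂ ℝ momentumPair
    (fun ψ ψ' φ => by
      ext Y
      rw [add_apply, momentumPair_apply, ← leftMulL_apply, map_add, map_add]
      rfl)
    (fun c ψ φ => by
      ext Y
      rw [smul_apply, momentumPair_apply, ← leftMulL_apply, map_smul, map_smul]
      rfl)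
    (fun ψ φ φ' => by
      ext Y
      rw [add_apply, momentumPair_apply, map_add]
      rfl)
    (fun c ψ φ => by
      ext Y
      rw [smul_apply, momentumPair_apply, map_smul]
      rfl)) ‖halfSymplectic H M N‖ norm_momentumPair_le

lemma momentumBilin_apply (ψ φ : TensorSpace H M N) :
    momentumBilin H M N ψ φ = momentumPair ψ φ := rfl

lemma momentumLeft_eq (ψ : TensorSpace H M N) : momentumLeft ψ = momentumBilin H M N ψ ψ :=
  ContinuousLinearMap.ext fun Y => momentumLeft_apply ψ Y

lemma contDiff_momentumLeft :
    ContDiff ℝ ∞ (momentumLeft : TensorSpace H M N → SkewCompactDual H) := by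
  have : (momentumLeft : TensorSpace H M N → SkewCompactDual H) =
    fun ψ => momentumBilin H M N ψ ψ := funext momentumLeft_eq
  rw [this]
  exact ((momentumBilin H M N).contDiff.comp contDiff_id).clm_apply contDiff_id

lemma fderiv_momentumLeft_apply (ψ ξ : TensorSpace H M N) (Y : SkewCompact H) :
    fderiv ℝ momentumLeft ψ ξ Y = symplecticForm (leftMul (Y : H →L[ℂ] H) ψ) ξ := by
  have h := ((isMomentumMap_momentumLeft (H := H) (M := M) (N := N)) Y ψ).2 ξ
  rw [← h]
  have h1 : HasFDerivAt (momentumLeft : TensorSpace H M N → SkewCompactDual H)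
    (fderiv ℝ momentumLeft ψ) ψ :=
    (contDiff_momentumLeft.differentiable (by simp) ψ).hasFDerivAt
  have h2 := (ContinuousLinearMap.apply ℝ ℝ Y).hasFDerivAt.comp ψ h1
  exact (DFunLike.congr_fun h2.fderiv ξ).symm

/-- The link between the two forms: the Kirillov–Kostant–Souriau form at `momentumLeft ψ` is ω
evaluated on the vectors generated at ψ. It follows by moving X and Y across the indefinite form. -/
lemma indefForm_bracket (X Y : SkewCompact H) (ψ : TensorSpace H M N) :
    momentumLeft ψ (bracket X Y) =
      symplecticForm (leftMul (X : H →L[ℂ] H) ψ) (leftMul (Y : H →L[ℂ] H) ψ) := by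
  have h1 := indefForm_leftMul_skew X (leftMul (Y : H →L[ℂ] H) ψ) ψ
  have h2 := indefForm_leftMul_skew Y (leftMul (X : H →L[ℂ] H) ψ) ψ
  rw [← conj_indefForm (leftMul (X : H →L[ℂ] H) ψ)] at h1
  rw [momentumLeft_apply, halfSymplectic_apply, coe_bracket, ← leftMulR_apply, map_sub,
    sub_eq_add_neg, indefForm_add_left, indefForm_neg_left, leftMulR_apply,
    leftMulR_apply, leftMul_mul, leftMul_mul, h1, h2, symplecticForm]
  simp
  ring

lemma fderiv_momentumLeft_leftMul (X : SkewCompact H) (ψ : TensorSpace H M N) :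
    fderiv ℝ momentumLeft ψ (leftMul (X : H →L[ℂ] H) ψ) = coadjointField X (momentumLeft ψ) := by
  ext Y
  rw [fderiv_momentumLeft_apply, coadjointField_apply, indefForm_bracket, symplecticForm_eq,
    halfSymplectic_swap, symplecticForm_eq]
  ring

/-- The two actions commute and U(M, N) preserves the form, so `momentumLeft` descends to the
quotient. -/
lemma momentumLeft_rightMul (U : PseudoUnitary M N) (ψ : TensorSpace H M N) :
    momentumLeft (rightMul ψ U.1.val) = momentumLeft ψ := by
  ext Y
  rw [momentumLeft_apply, momentumLeft_apply, halfSymplectic_apply, halfSymplectic_apply,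
    leftMul_rightMul, indefForm_rightMul]

end Momentum

/-! ### Frames -/

section Frames

variable {H : Type u} [NormedAddCommGroup H] [InnerProductSpace ℂ H]

section Transitivity

variable (V : Submodule ℂ H) [FiniteDimensional ℂ V]

/-- The extension of an isometry of `V` by the identity of the orthogonal complement. -/
def extendByOne (e : V ≃ₗᵢ[ℂ] V) : H →L[ℂ] H :=
  V.subtypeL.comp ((e : V →L[ℂ] V).comp V.orthogonalProjectionOnto) + (1 - V.starProjection)

variable {V}

lemma extendByOne_apply (e : V ≃ₗᵢ[ℂ] V) (x : H) :
    extendByOne V e x = e (V.orthogonalProjectionOnto x) + (x - V.starProjection x) := rfl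

lemma extendByOne_mul (e f : V ≃ₗᵢ[ℂ] V) (h : ∀ x, e (f x) = x) :
    extendByOne V e * extendByOne V f = 1 := by
  ext x
  have h1 : V.orthogonalProjectionOnto (extendByOne V f x) = f (V.orthogonalProjectionOnto x) := by
    rw [extendByOne_apply, map_add, map_sub, Submodule.starProjection_apply,
      Submodule.orthogonalProjectionOnto_mem_subspace_eq_self,
      Submodule.orthogonalProjectionOnto_mem_subspace_eq_self, sub_self, add_zero]
  have h2 : V.starProjection (extendByOne V f x) = f (V.orthogonalProjectionOnto x) := by
    rw [Submodule.starProjection_apply, h1]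
  rw [mul_apply_eq_comp, extendByOne_apply, h1, h2, h, extendByOne_apply,
    Submodule.starProjection_apply, one_apply_eq_self]
  abel

lemma isCompactOperator_extendByOne_sub_one (e : V ≃ₗᵢ[ℂ] V) :
    IsCompactOperator (extendByOne V e - 1 : H →L[ℂ] H) := by
  have h : extendByOne V e - 1 =
      (V.subtypeL.comp (e : V →L[ℂ] V) - V.subtypeL).comp V.orthogonalProjectionOnto := by
    ext x
    simp [extendByOne_apply]
    abel
  have h2 : IsCompactOperator (V.subtypeL.comp (e : V →L[ℂ] V) - V.subtypeL) :=
    isCompactOperator_of_locallyCompactSpace_rng _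
  rw [h]
  exact h2.comp_clm _

variable [CompleteSpace H]

lemma star_extendByOne (e : V ≃ₗᵢ[ℂ] V) : star (extendByOne V e) = extendByOne V e.symm := by
  rw [ContinuousLinearMap.star_eq_adjoint]
  symm
  rw [ContinuousLinearMap.eq_adjoint_iff]
  intro x y
  have h1 (z : V) (w : H) : ⟪(z : H), w⟫_ℂ = ⟪z, V.orthogonalProjectionOnto w⟫_ℂ := by
    simp
  have h2 (z : V) (w : H) : ⟪w, (z : H)⟫_ℂ = ⟪V.orthogonalProjectionOnto w, z⟫_ℂ := by
    simp
  rw [extendByOne_apply, extendByOne_apply, inner_add_left, inner_add_right, inner_sub_left,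
    inner_sub_right, h1, h2, ← e.inner_map_map, e.apply_symm_apply,
    Submodule.inner_starProjection_left_eq_right]

/-- The extension by the identity differs from 1 by an operator factoring through the
finite-dimensional space V, hence compact. -/
lemma exists_unitaryCompact_extend (e : V →ₗᵢ[ℂ] V) :
    ∃ U : UnitaryCompact H, ∀ v : V, (U : H →L[ℂ] H) v = e v := by
  let e' : V ≃ₗᵢ[ℂ] V := e.toLinearIsometryEquiv rfl
  refine ⟨⟨⟨extendByOne V e', ?_⟩, isCompactOperator_extendByOne_sub_one e'⟩, fun v => ?_⟩
  · rw [Unitary.mem_iff, star_extendByOne]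
    exact ⟨extendByOne_mul _ _ e'.symm_apply_apply, extendByOne_mul _ _ e'.apply_symm_apply⟩
  · change extendByOne V e' v = e v
    rw [extendByOne_apply]
    simp [e']

end Transitivity

variable {κ : Type*} [Fintype κ]

/-- Both families lie in one finite-dimensional V, where an isometry between two subspaces extends
to an isometry of V. -/
lemma exists_unitaryCompact_of_orthonormal [CompleteSpace H] {u u' : κ → H}
    (hu : Orthonormal ℂ u) (hu' : Orthonormal ℂ u') :
    ∃ U : UnitaryCompact H, ∀ k, (U : H →L[ℂ] H) (u k) = u' k := by
  let V : Submodule ℂ H := Submodule.span ℂ (range u ∪ range u')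
  have : FiniteDimensional ℂ V :=
    FiniteDimensional.span_of_finite ℂ ((finite_range u).union (finite_range u'))
  let v : κ → V := fun k => ⟨u k, Submodule.subset_span (Or.inl (mem_range_self k))⟩
  let v' : κ → V := fun k => ⟨u' k, Submodule.subset_span (Or.inr (mem_range_self k))⟩
  have hv : Orthonormal ℂ v := by
    rw [← V.subtypeₗᵢ.orthonormal_comp_iff]
    exact hu
  have hv' : Orthonormal ℂ v' := by
    rw [← V.subtypeₗᵢ.orthonormal_comp_iff]
    exact hu'
  let b := Module.Basis.span hv.linearIndependent
  let b' := Module.Basis.span hv'.linearIndependent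
  have hb (k) : (b k : V) = v k :=
    Module.Basis.coe_span_apply hv.linearIndependent k
  have hb' (k) : (b' k : V) = v' k :=
    Module.Basis.coe_span_apply hv'.linearIndependent k
  have hbo : Orthonormal ℂ b := by
    rw [← (Submodule.span ℂ (range v)).subtypeₗᵢ.orthonormal_comp_iff]
    convert hv using 1
    exact funext hb
  have hbo' : Orthonormal ℂ b' := by
    rw [← (Submodule.span ℂ (range v')).subtypeₗᵢ.orthonormal_comp_iff]
    convert hv' using 1
    exact funext hb'
  let L : Submodule.span ℂ (range v) →ₗᵢ[ℂ] V :=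
    (Submodule.span ℂ (range v')).subtypeₗᵢ.comp
      (hbo.equiv hbo' (Equiv.refl κ)).toLinearIsometry
  obtain ⟨U, hU⟩ := exists_unitaryCompact_extend L.extend
  refine ⟨U, fun k => ?_⟩
  have h1 : L.extend (v k) = v' k := by
    rw [← hb, LinearIsometry.extend_apply, ← hb']
    simp [L]
  exact (hU (v k)).trans (congrArg Subtype.val h1)

/-- The operator `∑ |z_k⟩⟨u_k| - |u_k⟩⟨z_k|`, where `z_k = ξ_k - (1/2) Q ξ_k` and `Q` is the
projection onto the span of the `u_k`. -/
def skewOfFrame [CompleteSpace H] (u ξ : κ → H) : SkewCompact H :=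
  ∑ k, ketBra (ξ k - (2⁻¹ : ℂ) • ∑ i, ⟪u i, ξ k⟫_ℂ • u i) (u k)

/-- Infinitesimal form of transitivity: the hypothesis is the equation of tangent vectors to
orthonormal families. In |z⟩⟨u| - |u⟩⟨z| the part of z in the span of the frame contributes twice,
which is why half of Qξ is removed. -/
lemma skewOfFrame_apply [CompleteSpace H] {u ξ : κ → H} (hu : Orthonormal ℂ u)
    (h : ∀ j k, ⟪u j, ξ k⟫_ℂ + ⟪ξ j, u k⟫_ℂ = 0) (j : κ) :
    (skewOfFrame u ξ : H →L[ℂ] H) (u j) = ξ j := by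
  classical
  have h1 (i k : κ) : ⟪u i, u k⟫_ℂ = if i = k then 1 else 0 := orthonormal_iff_ite.1 hu i k
  have h2 (k : κ) : ⟪ξ k, u j⟫_ℂ = -⟪u k, ξ j⟫_ℂ := by
    rw [eq_neg_iff_add_eq_zero, add_comm]
    exact h k j
  have h3 (k : κ) : ⟪ξ k - (2⁻¹ : ℂ) • ∑ i, ⟪u i, ξ k⟫_ℂ • u i, u j⟫_ℂ =
      -(2⁻¹ * ⟪u k, ξ j⟫_ℂ) := by
    simp [h1, h2]
    ring
  simp only [skewOfFrame, AddSubmonoidClass.coe_finsetSum, sum_apply, ketBra_apply,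
    Finset.sum_sub_distrib, h1, h3, ite_smul, one_smul, zero_smul, Finset.sum_ite_eq',
    Finset.mem_univ, if_true, neg_smul, Finset.sum_neg_distrib, mul_smul, ← Finset.smul_sum]
  abel

end Frames

/-! ### The level set of the right momentum map -/

section Level

variable {H : Type u} [NormedAddCommGroup H] [InnerProductSpace ℂ H] {M N : ℕ}

/-- The squared norms `m₁, …, m_M, n_N, …, n₁` of the vectors of a frame. -/
def normSqs (m : Fin M → ℝ) (n : Fin N → ℝ) : Fin M ⊕ Fin N → ℝ := Sum.elim m fun j => n j.rev

/-- The numbers `m₁, …, m_M, -n_N, …, -n₁`. -/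
def weights (m : Fin M → ℝ) (n : Fin N → ℝ) : Fin M ⊕ Fin N → ℝ := Sum.elim m fun j => -n j.rev

variable {m : Fin M → ℝ} {n : Fin N → ℝ}

lemma normSqs_pos (hm : ∀ i, 0 < m i) (hn : ∀ j, 0 < n j) (k) : 0 < normSqs m n k := by
  rcases k with k | k
  · exact hm k
  · exact hn _

lemma abs_weights (hm : ∀ i, 0 < m i) (hn : ∀ j, 0 < n j) (k) :
    |weights m n k| = normSqs m n k := by
  rcases k with k | k
  · exact abs_of_pos (hm k)
  · simpa [weights, normSqs] using (hn k.rev).le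

lemma weights_ne_zero (hm : ∀ i, 0 < m i) (hn : ∀ j, 0 < n j) (k) : weights m n k ≠ 0 := by
  rw [← abs_pos, abs_weights hm hn]
  exact normSqs_pos hm hn k

lemma sgn_mul_normSqs (k) : sgn M N k * (normSqs m n k : ℂ) = weights m n k := by
  rcases k with k | k <;> simp [sgn, normSqs, weights]

lemma sgn_mul_weights (k) : sgn M N k * (weights m n k : ℂ) = normSqs m n k := by
  rcases k with k | k <;> simp [sgn, normSqs, weights]

lemma sgn_mul_sgn (k) : sgn M N k * sgn M N k = 1 := by
  rcases k with k | k <;> simp [sgn]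

/-- The first M weights are positive and the others negative, so a matrix mixing only equal weights
also commutes with the signature. -/
lemma sgn_eq_of_weights_eq (hm : ∀ i, 0 < m i) (hn : ∀ j, 0 < n j) {j k}
    (h : weights m n j = weights m n k) : sgn M N j = sgn M N k := by
  rcases j with j | j <;> rcases k with k | k <;>
    simp only [weights, Sum.elim_inl, Sum.elim_inr] at h
  · rfl
  · have := hm j; have := hn k.rev; linarith
  · have := hm k; have := hn j.rev; linarith
  · rfl

lemma weightMatrix_eq : weightMatrix m n = Matrix.diagonal fun k => (weights m n k : ℂ) := by
  rw [weightMatrix]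
  congr 1
  ext k
  rcases k with k | k <;> simp [weights]

lemma momentumRight_apply_sum (ψ : TensorSpace H M N) (X : PseudoSkew M N) :
    momentumRight ψ X = (Complex.I * ∑ i, ∑ k, sgn M N k * X.1 i k * ⟪ψ k, ψ i⟫_ℂ).re := by
  rw [momentumRight_apply, rightMulL_apply, Finset.sum_comm]
  simp only [indefForm, rightMul, inner_sum, inner_smul_right, Finset.mul_sum, mul_assoc]

lemma weight_apply_sum (X : PseudoSkew M N) :
    weight m n X = (Complex.I * ∑ i, sgn M N i * X.1 i i * normSqs m n i).re := by
  change (Complex.I * (weightMatrix m n * X.1).trace).re = _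
  rw [weightMatrix_eq]
  simp only [Matrix.trace, Matrix.diag_apply, Matrix.diagonal_mul, ← sgn_mul_normSqs]
  congr 3
  ext i
  ring

/-- The level set of the right momentum map consists of the orthogonal frames with prescribed
norms. -/
theorem momentumRight_eq_weight_iff (ψ : TensorSpace H M N) :
    momentumRight ψ = weight m n ↔
      ∀ j k, ⟪ψ j, ψ k⟫_ℂ = if j = k then (normSqs m n k : ℂ) else 0 := by
  constructor
  · intro h
    let E : Matrix (Fin M ⊕ Fin N) (Fin M ⊕ Fin N) ℂ := fun j k =>
      ⟪ψ j, ψ k⟫_ℂ - if j = k then (normSqs m n k : ℂ) else 0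
    have hE (j k) : (starRingEnd ℂ) (E j k) = E k j := by
      simp only [E, map_sub, inner_conj_symm]
      by_cases hjk : j = k
      · simp [hjk]
      · simp [hjk, Ne.symm hjk]
    have h4 (k i) : E k i = ⟪ψ k, ψ i⟫_ℂ - if k = i then (normSqs m n i : ℂ) else 0 := rfl
    clear_value E
    -- The test element is built from the defect E of the Gram matrix itself: pairing the equation
    -- with it gives minus the sum of all |E i k|², which forces E = 0.
    let X : Matrix (Fin M ⊕ Fin N) (Fin M ⊕ Fin N) ℂ := fun i k => sgn M N k * (Complex.I * E i k)
    have hX : X ∈ PseudoSkew M N := by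
      change X * sigMatrix M N + sigMatrix M N * Xᴴ = 0
      ext i k
      rw [Matrix.add_apply, sigMatrix, Matrix.mul_diagonal, Matrix.diagonal_mul,
        Matrix.conjTranspose_apply, Matrix.zero_apply]
      simp only [X, ← starRingEnd_apply, map_mul, star_sgn, Complex.conj_I, hE]
      linear_combination (Complex.I * E i k) * sgn_mul_sgn k - (Complex.I * E i k) * sgn_mul_sgn i
    have h1 := DFunLike.congr_fun h ⟨X, hX⟩
    rw [momentumRight_apply_sum, weight_apply_sum, ← sub_eq_zero, ← Complex.sub_re, ← mul_sub,
      ← Finset.sum_sub_distrib] at h1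
    have h2 (i) : ∑ k, sgn M N k * X i k * ⟪ψ k, ψ i⟫_ℂ - sgn M N i * X i i * normSqs m n i =
        ∑ k, Complex.I * (Complex.normSq (E i k) : ℂ) := by
      have h3 (k) : Complex.I * (Complex.normSq (E i k) : ℂ) =
          sgn M N k * X i k * ⟪ψ k, ψ i⟫_ℂ -
            if k = i then sgn M N k * X i k * normSqs m n i else 0 := by
        rw [← Complex.mul_conj, hE]
        simp only [X]
        rw [h4 k i]
        split_ifs
        · linear_combination (-Complex.I * E i k * (⟪ψ k, ψ i⟫_ℂ - normSqs m n i)) * sgn_mul_sgn k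
        · linear_combination (-Complex.I * E i k * ⟪ψ k, ψ i⟫_ℂ) * sgn_mul_sgn k
      simp only [h3, Finset.sum_sub_distrib]
      simp
    simp only [h2, ← Finset.mul_sum, ← mul_assoc, Complex.I_mul_I, ← Complex.ofReal_sum] at h1
    simp only [neg_mul, one_mul, Complex.neg_re, Complex.ofReal_re, neg_eq_zero] at h1
    intro j k
    have h5 := (Finset.sum_eq_zero_iff_of_nonneg fun i _ =>
      Finset.sum_nonneg fun k _ => Complex.normSq_nonneg (E i k)).1 h1 j (Finset.mem_univ j)
    rw [Finset.sum_eq_zero_iff_of_nonneg fun k _ => Complex.normSq_nonneg (E j k)] at h5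
    have h6 := Complex.normSq_eq_zero.1 (h5 k (Finset.mem_univ k))
    rw [h4] at h6
    exact sub_eq_zero.1 h6
  · intro h
    ext X
    rw [momentumRight_apply_sum, weight_apply_sum]
    congr 3
    ext i
    simp [h]

lemma inner_self_of_level {ψ : TensorSpace H M N} (h : momentumRight ψ = weight m n) (j k) :
    ⟪ψ j, ψ k⟫_ℂ = if j = k then (normSqs m n k : ℂ) else 0 :=
  (momentumRight_eq_weight_iff ψ).1 h j k

lemma momentumRight_leftMul [CompleteSpace H] (U : UnitaryCompact H) {ψ : TensorSpace H M N}
    (h : momentumRight ψ = weight m n) :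
    momentumRight (leftMul (U : H →L[ℂ] H) ψ) = weight m n := by
  rw [momentumRight_eq_weight_iff] at h ⊢
  simpa [inner_unitaryCompact] using h

variable (m n) in
/-- The orthonormal frame underlying an element of the level set. -/
def unitFrame (ψ : TensorSpace H M N) (k : Fin M ⊕ Fin N) : H :=
  ((√(normSqs m n k))⁻¹ : ℂ) • ψ k

lemma sqrt_ne_zero_of_pos {x : ℝ} (hx : 0 < x) : ((√x : ℝ) : ℂ) ≠ 0 := by
  exact_mod_cast (Real.sqrt_pos.2 hx).ne'

lemma sqrt_mul_sqrt {x : ℝ} (hx : 0 < x) : ((√x : ℝ) : ℂ) * (√x : ℝ) = x := by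
  exact_mod_cast Real.mul_self_sqrt hx.le

lemma sqrt_smul_unitFrame (hm : ∀ i, 0 < m i) (hn : ∀ j, 0 < n j) (ψ : TensorSpace H M N) (k) :
    ((√(normSqs m n k) : ℝ) : ℂ) • unitFrame m n ψ k = ψ k := by
  rw [unitFrame, smul_smul, mul_inv_cancel₀ (sqrt_ne_zero_of_pos (normSqs_pos hm hn k)), one_smul]

lemma orthonormal_unitFrame (hm : ∀ i, 0 < m i) (hn : ∀ j, 0 < n j) {ψ : TensorSpace H M N}
    (h : momentumRight ψ = weight m n) : Orthonormal ℂ (unitFrame m n ψ) := by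
  rw [orthonormal_iff_ite]
  intro j k
  have h1 := sqrt_ne_zero_of_pos (normSqs_pos hm hn k)
  rw [unitFrame, unitFrame, inner_smul_left, inner_smul_right, inner_self_of_level h]
  split_ifs with hjk
  · subst hjk
    rw [map_inv₀, Complex.conj_ofReal, ← sqrt_mul_sqrt (normSqs_pos hm hn j)]
    field_simp
  · simp

lemma exists_leftMul_unitary_eq [CompleteSpace H] (hm : ∀ i, 0 < m i) (hn : ∀ j, 0 < n j)
    {ψ ψ' : TensorSpace H M N} (h : momentumRight ψ = weight m n)
    (h' : momentumRight ψ' = weight m n) :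
    ∃ U : UnitaryCompact H, leftMul (U : H →L[ℂ] H) ψ = ψ' := by
  obtain ⟨U, hU⟩ := exists_unitaryCompact_of_orthonormal (orthonormal_unitFrame hm hn h)
    (orthonormal_unitFrame hm hn h')
  refine ⟨U, ?_⟩
  ext k
  rw [leftMul_apply, ← sqrt_smul_unitFrame hm hn ψ, map_smul, hU, sqrt_smul_unitFrame hm hn]

lemma exists_leftMul_skew_eq [CompleteSpace H] (hm : ∀ i, 0 < m i) (hn : ∀ j, 0 < n j)
    {ψ ξ : TensorSpace H M N} (h : momentumRight ψ = weight m n)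
    (hξ : ∀ j k, ⟪ψ j, ξ k⟫_ℂ + ⟪ξ j, ψ k⟫_ℂ = 0) :
    ∃ X : SkewCompact H, leftMul (X : H →L[ℂ] H) ψ = ξ := by
  have h1 (j k) : ⟪unitFrame m n ψ j, unitFrame m n ξ k⟫_ℂ +
      ⟪unitFrame m n ξ j, unitFrame m n ψ k⟫_ℂ = 0 := by
    simp only [unitFrame, inner_smul_left, inner_smul_right]
    rw [← mul_add, ← mul_add, hξ, mul_zero, mul_zero]
  refine ⟨skewOfFrame (unitFrame m n ψ) (unitFrame m n ξ), ?_⟩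
  ext k
  rw [leftMul_apply, ← sqrt_smul_unitFrame hm hn ψ, map_smul,
    skewOfFrame_apply (orthonormal_unitFrame hm hn h) h1, sqrt_smul_unitFrame hm hn]

lemma inner_leftMul_skew_add [CompleteSpace H] (X : SkewCompact H) (ψ : TensorSpace H M N) (j k) :
    ⟪ψ j, leftMul (X : H →L[ℂ] H) ψ k⟫_ℂ + ⟪leftMul (X : H →L[ℂ] H) ψ j, ψ k⟫_ℂ = 0 := by
  rw [leftMul_apply, leftMul_apply, inner_skew_left, add_neg_cancel]

lemma nonempty_levelSet (hm : ∀ i, 0 < m i) (hn : ∀ j, 0 < n j)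
    (hdim : ((M + N : ℕ) : Cardinal.{u}) ≤ Module.rank ℂ H) :
    ∃ ψ : TensorSpace H M N, momentumRight ψ = weight m n := by
  obtain ⟨s, hs, hli⟩ := le_rank_iff_exists_linearIndependent_finset.1 hdim
  let e : Fin (M + N) ≃ s := (Finset.equivFinOfCardEq hs).symm
  have hli' : LinearIndependent ℂ (fun i : Fin (M + N) => ((e i : H))) :=
    hli.comp e e.injective
  have ho := InnerProductSpace.gramSchmidtNormed_orthonormal hli'
  let u : Fin M ⊕ Fin N → H := fun k => InnerProductSpace.gramSchmidtNormed ℂ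
    (fun i : Fin (M + N) => ((e i : H))) (finSumFinEquiv k)
  have hu : Orthonormal ℂ u := ho.comp _ finSumFinEquiv.injective
  refine ⟨WithLp.toLp 2 fun k => ((√(normSqs m n k) : ℝ) : ℂ) • u k, ?_⟩
  rw [momentumRight_eq_weight_iff]
  intro j k
  have h1 := orthonormal_iff_ite.1 hu j k
  simp only [inner_smul_left, inner_smul_right, h1]
  split_ifs with hjk
  · subst hjk
    rw [Complex.conj_ofReal, mul_one, sqrt_mul_sqrt (normSqs_pos hm hn j)]
  · simp

end Level

/-! ### The fibers of the left momentum map -/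

section Fibers

variable {H : Type u} [NormedAddCommGroup H] [InnerProductSpace ℂ H] {M N : ℕ}
  {m : Fin M → ℝ} {n : Fin N → ℝ}

/-- The operator `∑ ± |ψ_k⟩⟨ψ_k|`. -/
def frameOp (ψ : TensorSpace H M N) : H →L[ℂ] H :=
  ∑ k, sgn M N k • InnerProductSpace.rankOne ℂ (ψ k) (ψ k)

lemma frameOp_apply (ψ : TensorSpace H M N) (x : H) :
    frameOp ψ x = ∑ k, (sgn M N k * ⟪ψ k, x⟫_ℂ) • ψ k := by
  simp [frameOp, sum_apply, smul_smul]

lemma inner_frameOp (ψ : TensorSpace H M N) (x y : H) :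
    ⟪y, frameOp ψ x⟫_ℂ = ∑ k, sgn M N k * ⟪ψ k, x⟫_ℂ * ⟪y, ψ k⟫_ℂ := by
  simp [frameOp_apply]

lemma inner_frameOp_left (ψ : TensorSpace H M N) (x y : H) :
    ⟪frameOp ψ y, x⟫_ℂ = ⟪y, frameOp ψ x⟫_ℂ := by
  rw [inner_frameOp, frameOp_apply]
  simp only [sum_inner, inner_smul_left, map_mul, star_sgn, inner_conj_symm]
  exact Finset.sum_congr rfl fun k _ => by ring

lemma frameOp_self {ψ : TensorSpace H M N} (h : momentumRight ψ = weight m n) (k) :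
    frameOp ψ (ψ k) = (weights m n k : ℂ) • ψ k := by
  rw [frameOp_apply]
  simp [inner_self_of_level h, sgn_mul_normSqs]

/-- Testing on rank-two operators reads off the imaginary parts of the matrix elements of `frameOp
ψ`, and the real parts after multiplying a vector by i; the functional thus determines the operator.
-/
lemma momentumLeft_ketBra [CompleteSpace H] (ψ : TensorSpace H M N) (x y : H) :
    momentumLeft ψ (ketBra x y) = -2 * (⟪y, frameOp ψ x⟫_ℂ).im := by
  have h1 : indefForm (leftMul (ketBra x y : H →L[ℂ] H) ψ) ψ =
      ⟪y, frameOp ψ x⟫_ℂ - (starRingEnd ℂ) ⟪y, frameOp ψ x⟫_ℂ := by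
    rw [inner_conj_symm, inner_frameOp_left, inner_frameOp, inner_frameOp,
      ← Finset.sum_sub_distrib]
    refine Finset.sum_congr rfl fun k _ => ?_
    rw [leftMul_apply, ketBra_apply, inner_sub_right, inner_smul_right, inner_smul_right]
    ring
  rw [momentumLeft_apply, halfSymplectic_apply, h1, Complex.sub_im, Complex.conj_im]
  ring

/-- A functional with small values on the operators `ketBra x y` is represented by a small
operator. -/
lemma norm_apply_le_of_ketBra [CompleteSpace H] {δ : H →L[ℂ] H} {f : SkewCompactDual H}
    (h : ∀ x y, f (ketBra x y) = -2 * (⟪y, δ x⟫_ℂ).im) (x : H) : ‖δ x‖ ≤ ‖f‖ * ‖x‖ := by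
  rcases eq_or_ne (δ x) 0 with h0 | h0
  · rw [h0, norm_zero]
    positivity
  -- The choice y = i δx turns the imaginary part into -‖δx‖².
  have h1 := h x (Complex.I • δ x)
  rw [inner_smul_left, inner_self_eq_norm_sq_to_K] at h1
  have h2 : f (ketBra x (Complex.I • δ x)) = 2 * ‖δ x‖ ^ 2 := by
    rw [h1]
    simp [← Complex.ofReal_pow]
  have h3 := (f.le_opNorm _).trans (mul_le_mul_of_nonneg_left
    (norm_ketBra_le x (Complex.I • δ x)) (norm_nonneg f))
  rw [h2, norm_smul, Complex.norm_I, one_mul, Real.norm_of_nonneg (by positivity)] at h3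
  have h4 : 0 < ‖δ x‖ := norm_pos_iff.2 h0
  nlinarith

lemma frameOp_eq_of_momentumLeft_eq [CompleteSpace H] {ψ ψ' : TensorSpace H M N}
    (h : momentumLeft ψ = momentumLeft ψ') : frameOp ψ = frameOp ψ' := by
  ext x
  have h1 := norm_apply_le_of_ketBra (f := 0) (δ := frameOp ψ - frameOp ψ') (fun x y => by
    have h2 := momentumLeft_ketBra ψ x y
    rw [h, momentumLeft_ketBra] at h2
    rw [zero_apply, sub_apply, inner_sub_right, Complex.sub_im]
    linarith) x
  rw [norm_zero, zero_mul, norm_le_zero_iff, sub_apply, sub_eq_zero] at h1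
  exact h1

/-- Two points of the level set with the same operator differ by the stability group. -/
theorem exists_rightMul_eq_of_frameOp_eq [CompleteSpace H] (hm : ∀ i, 0 < m i)
    (hn : ∀ j, 0 < n j) {ψ ψ' : TensorSpace H M N} (h : momentumRight ψ = weight m n)
    (h' : momentumRight ψ' = weight m n) (hop : frameOp ψ = frameOp ψ') :
    ∃ U ∈ pseudoStabilizer (weight m n), ψ' = rightMul ψ U.1.val := by
  have hd (k) : (normSqs m n k : ℂ) ≠ 0 := by exact_mod_cast (normSqs_pos hm hn k).ne'
  let A : Matrix (Fin M ⊕ Fin N) (Fin M ⊕ Fin N) ℂ := fun k j => ⟪ψ k, ψ' j⟫_ℂ / normSqs m n k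
  have hA (k j) : ⟪ψ k, ψ' j⟫_ℂ = A k j * normSqs m n k := (div_mul_cancel₀ _ (hd k)).symm
  clear_value A
  -- Eigenvectors of the common symmetric operator with different eigenvalues are orthogonal.
  have hAw (k j) (hkj : A k j ≠ 0) : weights m n k = weights m n j := by
    have h1 : ⟪frameOp ψ (ψ k), ψ' j⟫_ℂ = ⟪ψ k, frameOp ψ' (ψ' j)⟫_ℂ := by
      rw [inner_frameOp_left, hop]
    rw [frameOp_self h, frameOp_self h', inner_smul_left, inner_smul_right, Complex.conj_ofReal,
      hA] at h1
    exact_mod_cast mul_right_cancel₀ (mul_ne_zero hkj (hd k)) h1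
  -- Used below for three functions of the eigenvalue: the squared norms, the signs and the weights.
  have hcomm {g : Fin M ⊕ Fin N → ℂ} (hg : ∀ j k, weights m n j = weights m n k → g j = g k) :
      A * Matrix.diagonal g = Matrix.diagonal g * A := by
    ext k j
    rw [Matrix.mul_diagonal, Matrix.diagonal_mul, mul_comm]
    by_cases hkj : A k j = 0
    · rw [hkj, mul_zero, mul_zero]
    · rw [hg k j (hAw k j hkj)]
  -- Applying the common operator to ψ'_j writes a nonzero multiple of ψ'_j as a combination of the
  -- ψ_k.
  have hψ : ψ' = rightMul ψ A := by
    ext j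
    have h1 : (weights m n j : ℂ) • ψ' j = (weights m n j : ℂ) • ∑ k, A k j • ψ k := by
      rw [← frameOp_self h', ← hop, frameOp_apply, Finset.smul_sum]
      refine Finset.sum_congr rfl fun k _ => ?_
      rw [hA, smul_smul]
      by_cases hkj : A k j = 0
      · simp [hkj]
      · rw [← hAw k j hkj, ← sgn_mul_normSqs]
        congr 1
        ring
    have hw : (weights m n j : ℂ) ≠ 0 := by exact_mod_cast weights_ne_zero hm hn j
    exact smul_right_injective H hw h1
  -- The Gram matrix of ψ' = ψA gives A* D A = D with D the squared norms; A commutes with D and D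
  -- is invertible, so A is unitary.
  have hdd : Aᴴ * A * Matrix.diagonal (fun k => (normSqs m n k : ℂ)) =
      Matrix.diagonal fun k => (normSqs m n k : ℂ) := by
    rw [mul_assoc, hcomm fun j k hjk => by rw [← abs_weights hm hn, hjk, abs_weights hm hn]]
    ext i j
    have h1 := inner_self_of_level h' i j
    nth_rw 1 [hψ] at h1
    simp only [rightMul, sum_inner, inner_smul_left, hA] at h1
    rw [Matrix.mul_apply, Matrix.diagonal_apply]
    simp only [Matrix.diagonal_mul, Matrix.conjTranspose_apply]
    rw [show (if i = j then (normSqs m n i : ℂ) else 0) = if i = j then (normSqs m n j : ℂ) else 0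
      by split_ifs with hij <;> simp [hij], ← h1]
    refine Finset.sum_congr rfl fun k _ => ?_
    rw [starRingEnd_apply]
    ring
  have hAA : Aᴴ * A = 1 := by
    have h1 : Matrix.diagonal (fun k => (normSqs m n k : ℂ)) *
        Matrix.diagonal (fun k => (normSqs m n k : ℂ)⁻¹) = 1 := by
      rw [Matrix.diagonal_mul_diagonal, ← Matrix.diagonal_one]
      congr 1
      ext k
      exact mul_inv_cancel₀ (hd k)
    calc Aᴴ * A = Aᴴ * A * Matrix.diagonal (fun k => (normSqs m n k : ℂ)) *
        Matrix.diagonal (fun k => (normSqs m n k : ℂ)⁻¹) := by rw [mul_assoc, h1, mul_one]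
      _ = 1 := by rw [hdd, h1]
  have hAA' : A * Aᴴ = 1 := mul_eq_one_comm.1 hAA
  refine ⟨⟨⟨A, Aᴴ, hAA', hAA⟩, ?_⟩, ?_, hψ⟩
  · change A * sigMatrix M N * Aᴴ = sigMatrix M N
    rw [sigMatrix, hcomm fun j k hjk => sgn_eq_of_weights_eq hm hn hjk, mul_assoc, hAA', mul_one]
  · have hD : A * weightMatrix m n = weightMatrix m n * A := by
      rw [weightMatrix_eq, hcomm fun j k hjk => by rw [hjk]]
    intro X
    change (Complex.I * (weightMatrix m n * (Aᴴ * X.1 * A)).trace).re =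
      (Complex.I * (weightMatrix m n * X.1).trace).re
    rw [← mul_assoc, Matrix.trace_mul_comm, ← mul_assoc, ← mul_assoc, hD, mul_assoc _ A, hAA',
      mul_one]

lemma momentumLeft_eq_of_frameOp_eq [CompleteSpace H] (hm : ∀ i, 0 < m i) (hn : ∀ j, 0 < n j)
    {ψ ψ' : TensorSpace H M N} (h : momentumRight ψ = weight m n)
    (h' : momentumRight ψ' = weight m n) (hop : frameOp ψ = frameOp ψ') :
    momentumLeft ψ = momentumLeft ψ' := by
  obtain ⟨U, -, rfl⟩ := exists_rightMul_eq_of_frameOp_eq hm hn h h' hop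
  rw [momentumLeft_rightMul]

lemma toReduced_eq_iff [CompleteSpace H] (hm : ∀ i, 0 < m i) (hn : ∀ j, 0 < n j)
    (ψ ψ' : LevelSet H (weight m n)) :
    toReduced (weight m n) ψ = toReduced (weight m n) ψ' ↔
      momentumLeft ψ.1 = momentumLeft ψ'.1 := by
  constructor
  · intro h
    obtain ⟨U, hU⟩ := MulAction.orbitRel_apply.1 (Quotient.exact h)
    have h1 : ψ.1 = rightMul ψ'.1 U.unop.1.1.val := congrArg Subtype.val hU.symm
    rw [h1, momentumLeft_rightMul]
  · intro h
    obtain ⟨U, hU, hψ⟩ := exists_rightMul_eq_of_frameOp_eq hm hn ψ'.2 ψ.2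
      (frameOp_eq_of_momentumLeft_eq h.symm)
    exact Quotient.sound (MulAction.orbitRel_apply.2 ⟨MulOpposite.op ⟨U, hU⟩, Subtype.ext hψ.symm⟩)

end Fibers

/-! ### Trace-class operators with prescribed eigenvalues -/

section TraceClass

variable {H : Type u} [NormedAddCommGroup H] [InnerProductSpace ℂ H]

lemma inner_self_eq_ofReal (x : H) : ⟪x, x⟫_ℂ = ((‖x‖ ^ 2 : ℝ) : ℂ) := by
  rw [inner_self_eq_norm_sq_to_K, Complex.ofReal_pow]
  rfl

lemma hasSum_norm_sq_inner {κ : Type*} (e : HilbertBasis κ ℂ H) (x : H) :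
    HasSum (fun i => ‖⟪e i, x⟫_ℂ‖ ^ 2) (‖x‖ ^ 2) := by
  have h := e.hasSum_inner_mul_inner x x
  have h1 (i) : ⟪x, e i⟫_ℂ * ⟪e i, x⟫_ℂ = ((‖⟪e i, x⟫_ℂ‖ ^ 2 : ℝ) : ℂ) := by
    rw [← inner_conj_symm, ← Complex.normSq_eq_conj_mul_self, Complex.normSq_eq_norm_sq]
  simp only [h1, inner_self_eq_ofReal] at h
  exact Complex.hasSum_ofReal.1 h

variable [CompleteSpace H]

/-- A Hilbert–Schmidt operator is compact. -/
lemma isCompactOperator_of_summable_norm_sq {κ : Type*} (e : HilbertBasis κ ℂ H)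
    {ρ : H →L[ℂ] H} (h : Summable fun i => ‖star ρ (e i)‖ ^ 2) : IsCompactOperator ρ := by
  classical
  -- Finite-rank truncations of ρ. By Parseval's identity and Cauchy–Schwarz in each coordinate, the
  -- squared norm of the error is at most the tail `t F` of the convergent series.
  let R (F : Finset κ) : H →L[ℂ] H := ∑ i ∈ F, InnerProductSpace.rankOne ℂ (e i) (star ρ (e i))
  have hR (F) : IsCompactOperator (R F) :=
    Submodule.sum_mem (compactOperator (RingHom.id ℂ) H H) fun i _ => isCompactOperator_rankOne _ _
  have hinner (F x i) : ⟪e i, (ρ - R F) x⟫_ℂ = if i ∈ F then 0 else ⟪star ρ (e i), x⟫_ℂ := by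
    have h1 : ⟪e i, ρ x⟫_ℂ = ⟪star ρ (e i), x⟫_ℂ := by
      rw [ContinuousLinearMap.star_eq_adjoint, ContinuousLinearMap.adjoint_inner_left]
    have h2 : ⟪e i, R F x⟫_ℂ = if i ∈ F then ⟪star ρ (e i), x⟫_ℂ else 0 := by
      simp [R, sum_apply, orthonormal_iff_ite.1 e.orthonormal]
    rw [sub_apply, inner_sub_right, h1, h2]
    split_ifs <;> simp
  let t (F : Finset κ) : ℝ := (∑' i, ‖star ρ (e i)‖ ^ 2) - ∑ i ∈ F, ‖star ρ (e i)‖ ^ 2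
  have ht (F) : HasSum (fun i => if i ∈ F then 0 else ‖star ρ (e i)‖ ^ 2) (t F) := by
    have h1 : HasSum (fun i => if i ∈ F then ‖star ρ (e i)‖ ^ 2 else 0)
        (∑ i ∈ F, ‖star ρ (e i)‖ ^ 2) := by
      have h2 := hasSum_sum_of_ne_finset_zero (L := SummationFilter.unconditional κ) (s := F)
        (f := fun i => if i ∈ F then ‖star ρ (e i)‖ ^ 2 else 0) fun i hi => if_neg hi
      rwa [Finset.sum_congr rfl fun i hi => if_pos hi] at h2
    have h3 : (fun i => if i ∈ F then 0 else ‖star ρ (e i)‖ ^ 2) =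
        fun i => ‖star ρ (e i)‖ ^ 2 - if i ∈ F then ‖star ρ (e i)‖ ^ 2 else 0 := by
      ext i
      split_ifs <;> simp
    rw [h3]
    exact h.hasSum.sub h1
  have hlim : Filter.Tendsto t Filter.atTop (𝓝 0) := by
    have := (tendsto_const_nhds (x := ∑' i, ‖star ρ (e i)‖ ^ 2)).sub h.hasSum
    simpa [t] using this
  have hbound (F) : ‖R F - ρ‖ ≤ √(t F) := by
    refine ContinuousLinearMap.opNorm_le_bound _ (Real.sqrt_nonneg _) fun x => ?_
    rw [← neg_sub, neg_apply, norm_neg]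
    apply le_of_sq_le_sq _ (by positivity)
    rw [mul_pow, Real.sq_sqrt ((ht F).nonneg fun i => by positivity)]
    refine hasSum_le (fun i => ?_) (hasSum_norm_sq_inner e _) ((ht F).mul_right (‖x‖ ^ 2))
    rw [hinner]
    split_ifs
    · simp
    · rw [← mul_pow]
      gcongr
      exact norm_inner_le_norm _ _
  refine isCompactOperator_of_tendsto (F := R) (l := Filter.atTop) ?_
    (Filter.Eventually.of_forall hR)
  rw [tendsto_iff_norm_sub_tendsto_zero]
  refine squeeze_zero (fun F => norm_nonneg _) hbound ?_
  have h1 := (Real.continuous_sqrt.tendsto 0).comp hlim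
  rwa [Real.sqrt_zero] at h1

/-- With B = |ρ| one has ‖ρ e_i‖² = ‖B e_i‖² ≤ ‖B^{1/2}‖² ⟨e_i, B e_i⟩, so ρ is Hilbert–Schmidt.
Compactness is what the spectral theorem needs. -/
lemma IsTraceClass.isCompactOperator {ρ : H →L[ℂ] H} (hρ : IsSelfAdjoint ρ)
    (h : IsTraceClass ρ) : IsCompactOperator ρ := by
  obtain ⟨w, e, -⟩ := exists_hilbertBasis ℂ H
  refine isCompactOperator_of_summable_norm_sq e ?_
  have h1 := h w e
  let B := CFC.abs ρ
  let C := CFC.sqrt B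
  have hB : 0 ≤ B := CFC.abs_nonneg ρ
  have hC : 0 ≤ C := CFC.sqrt_nonneg B
  have hCC : C * C = B := CFC.sqrt_mul_sqrt_self B hB
  have hBs : star B = B := (IsSelfAdjoint.of_nonneg hB).star_eq
  have hCs : star C = C := (IsSelfAdjoint.of_nonneg hC).star_eq
  have key {A D : H →L[ℂ] H} (hAD : star A * A = star D * D) (x : H) : ‖A x‖ = ‖D x‖ := by
    have h2 (T : H →L[ℂ] H) : ⟪T x, T x⟫_ℂ = ⟪x, (star T * T) x⟫_ℂ := by
      rw [mul_apply_eq_comp, ContinuousLinearMap.star_eq_adjoint,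
        ContinuousLinearMap.adjoint_inner_right]
    have h3 : ⟪A x, A x⟫_ℂ = ⟪D x, D x⟫_ℂ := by rw [h2, h2, hAD]
    rw [inner_self_eq_ofReal, inner_self_eq_ofReal] at h3
    have h4 : ‖A x‖ ^ 2 = ‖D x‖ ^ 2 := by exact_mod_cast h3
    exact (sq_eq_sq₀ (norm_nonneg _) (norm_nonneg _)).1 h4
  have hnorm (x : H) : ‖star ρ x‖ = ‖B x‖ := key (by
    rw [star_star, hBs, CFC.abs_mul_abs, hρ.star_eq]) x
  have hCx (x : H) : (⟪x, B x⟫_ℂ).re = ‖C x‖ ^ 2 := by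
    have h2 : ⟪x, B x⟫_ℂ = ⟪C x, C x⟫_ℂ := by
      rw [← hCC, mul_apply_eq_comp, ← ContinuousLinearMap.adjoint_inner_left,
        ← ContinuousLinearMap.star_eq_adjoint, hCs]
    rw [h2, inner_self_eq_ofReal, Complex.ofReal_re]
  refine Summable.of_nonneg_of_le (fun i => by positivity) (fun i => ?_) (h1.mul_left (‖C‖ ^ 2))
  change _ ≤ ‖C‖ ^ 2 * (⟪e i, B (e i)⟫_ℂ).re
  rw [hnorm, hCx, ← mul_pow, ← hCC]
  gcongr
  exact C.le_opNorm _

end TraceClass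

/-! ### Operators of frames and the set with prescribed eigenvalues -/

section OrbitSet

variable {H : Type u} [NormedAddCommGroup H] [InnerProductSpace ℂ H] {M N : ℕ}
  {m : Fin M → ℝ} {n : Fin N → ℝ}

lemma card_weights_eq (c : ℂ) :
    Nat.card {i // (m i : ℂ) = c} + Nat.card {j // (-(n j) : ℂ) = c} =
      Nat.card {k // (weights m n k : ℂ) = c} := by
  have e1 : {k // (weights m n k : ℂ) = c} ≃
      {i // (m i : ℂ) = c} ⊕ {j : Fin N // ((-(n j.rev) : ℝ) : ℂ) = c} := Equiv.subtypeSum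
  have e2 : {j : Fin N // ((-(n j.rev) : ℝ) : ℂ) = c} ≃ {j // (-(n j) : ℂ) = c} :=
    Fin.revPerm.subtypeEquiv fun j => by simp
  rw [Nat.card_congr e1, Nat.card_sum, Nat.card_congr e2]

/-- The operator `∑ |ψ_k⟩⟨ψ_k|`. -/
def frameAbs (ψ : TensorSpace H M N) : H →L[ℂ] H :=
  ∑ k, InnerProductSpace.rankOne ℂ (ψ k) (ψ k)

lemma frameAbs_apply (ψ : TensorSpace H M N) (x : H) :
    frameAbs ψ x = ∑ k, ⟪ψ k, x⟫_ℂ • ψ k := by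
  simp [frameAbs, sum_apply]

lemma frameAbs_nonneg (ψ : TensorSpace H M N) : 0 ≤ frameAbs ψ := by
  rw [ContinuousLinearMap.nonneg_iff_isPositive]
  exact ContinuousLinearMap.isPositive_sum _ fun k _ =>
    InnerProductSpace.isPositive_rankOne_self (ψ k)

/-- For c ≠ 0, an eigenvector x equals c⁻¹ `frameOp ψ` x and so lies in the span of the frame; by
symmetry its components along the ψ_k with weight other than c vanish. -/
lemma hasNonzeroEigenvalues_frameOp (hm : ∀ i, 0 < m i) (hn : ∀ j, 0 < n j)
    {ψ : TensorSpace H M N} (h : momentumRight ψ = weight m n) :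
    HasNonzeroEigenvalues m n (frameOp ψ) := by
  intro c hc
  let v : {k // (weights m n k : ℂ) = c} → H := fun k => ψ k.1
  have hv : LinearIndependent ℂ v := by
    have h1 : LinearIndependent ℂ ψ.ofLp := by
      have h2 := (orthonormal_unitFrame hm hn h).linearIndependent
      have h3 := h2.units_smul fun k => Units.mk0 _ (sqrt_ne_zero_of_pos (normSqs_pos hm hn k))
      have h4 : ψ.ofLp = (fun k => Units.mk0 _ (sqrt_ne_zero_of_pos (normSqs_pos hm hn k))) •
          unitFrame m n ψ := funext fun k => (sqrt_smul_unitFrame hm hn ψ k).symm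
      rw [h4]
      exact h3
    exact h1.comp _ Subtype.val_injective
  have hspan : Module.End.eigenspace (frameOp ψ : H →ₗ[ℂ] H) c = Submodule.span ℂ (range v) := by
    apply le_antisymm
    · intro x hx
      have hx' : frameOp ψ x = c • x := Module.End.mem_eigenspace_iff.1 hx
      have h1 (k) (hk : (weights m n k : ℂ) ≠ c) : ⟪ψ k, x⟫_ℂ = 0 := by
        have h2 : ⟪frameOp ψ (ψ k), x⟫_ℂ = c * ⟪ψ k, x⟫_ℂ := by
          rw [inner_frameOp_left, hx', inner_smul_right]
        rw [frameOp_self h, inner_smul_left, Complex.conj_ofReal] at h2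
        have h3 : ((weights m n k : ℂ) - c) * ⟪ψ k, x⟫_ℂ = 0 := by linear_combination h2
        exact (mul_eq_zero.1 h3).resolve_left (sub_ne_zero.2 hk)
      have h2 : x = c⁻¹ • frameOp ψ x := by
        rw [hx', smul_smul, inv_mul_cancel₀ hc, one_smul]
      rw [h2, frameOp_apply]
      refine Submodule.smul_mem _ _ (Submodule.sum_mem _ fun k _ => ?_)
      by_cases hk : (weights m n k : ℂ) = c
      · exact Submodule.smul_mem _ _ (Submodule.subset_span ⟨⟨k, hk⟩, rfl⟩)
      · rw [h1 k hk, mul_zero, zero_smul]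
        exact Submodule.zero_mem _
    · rw [Submodule.span_le]
      rintro _ ⟨k, rfl⟩
      refine Module.End.mem_eigenspace_iff.2 ?_
      exact (frameOp_self h k.1).trans (by rw [k.2])
  rw [hspan, rank_span hv, card_weights_eq]
  have h1 := Cardinal.mk_range_eq_of_injective hv.injective
  rw [Cardinal.lift_uzero] at h1
  rw [h1, Nat.card_eq_fintype_card, Cardinal.mk_fintype, Cardinal.lift_natCast]

variable [CompleteSpace H]

lemma isSelfAdjoint_frameOp (ψ : TensorSpace H M N) : IsSelfAdjoint (frameOp ψ) := by
  rw [ContinuousLinearMap.isSelfAdjoint_iff_isSymmetric]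
  exact fun x y => inner_frameOp_left ψ y x

/-- Changing all signs to + gives a positive operator with the same square. -/
lemma abs_frameOp {ψ : TensorSpace H M N} (h : momentumRight ψ = weight m n) :
    CFC.abs (frameOp ψ) = frameAbs ψ := by
  refine CFC.sqrt_unique ?_ (frameAbs_nonneg ψ)
  rw [(isSelfAdjoint_frameOp ψ).star_eq]
  ext x
  have h1 (j) : frameAbs ψ (ψ j) = (normSqs m n j : ℂ) • ψ j := by
    simp [frameAbs_apply, inner_self_of_level h]
  rw [mul_apply_eq_comp, mul_apply_eq_comp, frameAbs_apply ψ x, frameOp_apply ψ x, map_sum, map_sum]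
  refine Finset.sum_congr rfl fun k _ => ?_
  rw [map_smul, map_smul, h1, frameOp_self h, smul_smul, smul_smul, ← sgn_mul_weights]
  congr 1
  ring

lemma isTraceClass_frameOp {ψ : TensorSpace H M N} (h : momentumRight ψ = weight m n) :
    IsTraceClass (frameOp ψ) := by
  intro κ e
  rw [abs_frameOp h]
  have h1 (i) : (⟪e i, frameAbs ψ (e i)⟫_ℂ).re = ∑ k, ‖⟪e i, ψ k⟫_ℂ‖ ^ 2 := by
    rw [frameAbs_apply, inner_sum, Complex.re_sum]
    refine Finset.sum_congr rfl fun k _ => ?_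
    rw [inner_smul_right, ← inner_conj_symm, ← Complex.normSq_eq_conj_mul_self,
      Complex.ofReal_re, Complex.normSq_eq_norm_sq]
  simp only [h1]
  exact summable_sum fun k _ => (hasSum_norm_sq_inner e (ψ k)).summable

lemma isTracePairing_frameOp (ψ : TensorSpace H M N) :
    IsTracePairing (frameOp ψ) (momentumLeft ψ) := by
  intro X κ e
  have h1 : ((momentumLeft ψ X : ℝ) : ℂ) =
      Complex.I * ∑ k, sgn M N k * ⟪star (X : H →L[ℂ] H) (ψ k), ψ k⟫_ℂ := by
    have h2 : indefForm (leftMul (X : H →L[ℂ] H) ψ) ψ =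
        ∑ k, sgn M N k * ⟪star (X : H →L[ℂ] H) (ψ k), ψ k⟫_ℂ := by
      simp [indefForm, ContinuousLinearMap.star_eq_adjoint,
        ContinuousLinearMap.adjoint_inner_left]
    have h3 := indefForm_leftMul_skew X ψ ψ
    rw [← conj_indefForm (leftMul (X : H →L[ℂ] H) ψ)] at h3
    rw [← h2, momentumLeft_apply, halfSymplectic_apply]
    apply Complex.ext
    · simp
    · have h4 := congrArg Complex.re h3
      simp only [Complex.neg_re, Complex.conj_re] at h4
      simp
      linarith
  rw [h1]
  refine HasSum.mul_left _ ?_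
  have h2 (i) : ⟪e i, frameOp ψ ((X : H →L[ℂ] H) (e i))⟫_ℂ =
      ∑ k, sgn M N k * (⟪star (X : H →L[ℂ] H) (ψ k), e i⟫_ℂ * ⟪e i, ψ k⟫_ℂ) := by
    rw [inner_frameOp]
    refine Finset.sum_congr rfl fun k _ => ?_
    rw [ContinuousLinearMap.star_eq_adjoint, ContinuousLinearMap.adjoint_inner_left, mul_assoc]
  simp only [h2]
  exact hasSum_sum fun k _ => (e.hasSum_inner_mul_inner _ _).mul_left _

lemma momentumLeft_mem_orbitSet (hm : ∀ i, 0 < m i) (hn : ∀ j, 0 < n j)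
    {ψ : TensorSpace H M N} (h : momentumRight ψ = weight m n) :
    momentumLeft ψ ∈ orbitSet H m n :=
  ⟨frameOp ψ, isSelfAdjoint_frameOp ψ, isTraceClass_frameOp h,
    hasNonzeroEigenvalues_frameOp hm hn h, isTracePairing_frameOp ψ⟩

/-- Orthonormal bases of the eigenspaces, rescaled by the square roots of the |weights|, form a
frame in the level set; what remains of ρ after subtracting its operator has no nonzero eigenvalue.
-/
lemma exists_frameOp_eq (hm : ∀ i, 0 < m i) (hn : ∀ j, 0 < n j) {ρ : H →L[ℂ] H}
    (hρ : IsSelfAdjoint ρ) (hc : IsCompactOperator ρ) (he : HasNonzeroEigenvalues m n ρ) :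
    ∃ ψ : TensorSpace H M N, momentumRight ψ = weight m n ∧ frameOp ψ = ρ := by
  classical
  have hsymm : (ρ : H →ₗ[ℂ] H).IsSymmetric :=
    (ContinuousLinearMap.isSelfAdjoint_iff_isSymmetric).1 hρ
  have hb (c : ℂ) (hc0 : c ≠ 0) : Nonempty (OrthonormalBasis {k // (weights m n k : ℂ) = c} ℂ
      (Module.End.eigenspace (ρ : H →ₗ[ℂ] H) c)) := by
    have h1 := he c hc0
    rw [card_weights_eq] at h1
    have h2 : FiniteDimensional ℂ (Module.End.eigenspace (ρ : H →ₗ[ℂ] H) c) :=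
      Module.rank_lt_aleph0_iff.1 (by rw [h1]; exact Cardinal.natCast_lt_aleph0)
    have h3 := Module.finrank_eq_of_rank_eq h1
    rw [Nat.card_eq_fintype_card] at h3
    exact ⟨(stdOrthonormalBasis ℂ _).reindex
      ((finCongr h3).trans (Fintype.equivFin {k // (weights m n k : ℂ) = c}).symm)⟩
  have hw (k) : (weights m n k : ℂ) ≠ 0 := by exact_mod_cast weights_ne_zero hm hn k
  -- One basis is fixed for each c, so that all indices k with the same weight draw distinct vectors
  -- from the same basis.
  choose! b' hb' using fun (c : ℂ) => (⟨fun hc0 => (hb c hc0).some, trivial⟩ :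
    ∃ f : c ≠ 0 → OrthonormalBasis {k // (weights m n k : ℂ) = c} ℂ
      (Module.End.eigenspace (ρ : H →ₗ[ℂ] H) c), True)
  let b (c : ℂ) (hc0 : c ≠ 0) := b' c hc0
  let w (k : Fin M ⊕ Fin N) : H := b _ (hw k) ⟨k, rfl⟩
  have hbw (c : ℂ) (hc0 : c ≠ 0) (k) (hk : (weights m n k : ℂ) = c) :
      (b c hc0 ⟨k, hk⟩ : H) = w k := by
    subst hk
    rfl
  have hρw (k) : ρ (w k) = (weights m n k : ℂ) • w k :=
    Module.End.mem_eigenspace_iff.1 (b _ (hw k) ⟨k, rfl⟩).2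
  have hwo : Orthonormal ℂ w := by
    rw [orthonormal_iff_ite]
    intro j k
    by_cases hjk : weights m n j = weights m n k
    · have h1 := orthonormal_iff_ite.1 (b _ (hw k)).orthonormal ⟨j, by rw [hjk]⟩ ⟨k, rfl⟩
      rw [Submodule.coe_inner, hbw, hbw] at h1
      simpa using h1
    · have h1 := hsymm (w j) (w k)
      rw [if_neg (fun h => hjk (by rw [h]))]
      have h2 : ⟪ρ (w j), w k⟫_ℂ = ⟪w j, ρ (w k)⟫_ℂ := h1
      rw [hρw, hρw, inner_smul_left, inner_smul_right, Complex.conj_ofReal] at h2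
      have h3 : ((weights m n j : ℂ) - weights m n k) * ⟪w j, w k⟫_ℂ = 0 := by
        linear_combination h2
      refine (mul_eq_zero.1 h3).resolve_left (sub_ne_zero.2 ?_)
      exact_mod_cast hjk
  let ψ : TensorSpace H M N := WithLp.toLp 2 fun k => ((√(normSqs m n k) : ℝ) : ℂ) • w k
  have hψ : momentumRight ψ = weight m n := by
    rw [momentumRight_eq_weight_iff]
    intro j k
    have h1 := orthonormal_iff_ite.1 hwo j k
    simp only [ψ, inner_smul_left, inner_smul_right, h1]
    split_ifs with hjk
    · subst hjk
      rw [Complex.conj_ofReal, mul_one, sqrt_mul_sqrt (normSqs_pos hm hn j)]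
    · simp
  have hψw (k) (x : H) : ⟪ψ k, x⟫_ℂ = (√(normSqs m n k) : ℝ) * ⟪w k, x⟫_ℂ := by
    simp [ψ]
  have hρψ (k) : ρ (ψ k) = (weights m n k : ℂ) • ψ k := by
    simp only [ψ, map_smul, hρw]
    exact smul_comm _ _ _
  refine ⟨ψ, hψ, ?_⟩
  -- The difference kills every ψ_k. An eigenvector for a nonzero eigenvalue is thus orthogonal to
  -- the frame, hence an eigenvector of ρ orthogonal to the basis of its own eigenspace, which is
  -- impossible.
  have hδc : IsCompactOperator (ρ - frameOp ψ) := by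
    refine hc.sub ?_
    exact Submodule.sum_mem (compactOperator (RingHom.id ℂ) H H) fun k _ =>
      Submodule.smul_mem _ _ (isCompactOperator_rankOne _ _)
  have hδs : ((ρ - frameOp ψ : H →L[ℂ] H) : H →ₗ[ℂ] H).IsSymmetric :=
    (ContinuousLinearMap.isSelfAdjoint_iff_isSymmetric).1 (hρ.sub (isSelfAdjoint_frameOp ψ))
  symm
  rw [← sub_eq_zero,
    ← ContinuousLinearMap.eq_zero_of_forall_hasEigenvalue_eq_zero hδc hδs]
  intro μ hμ
  by_contra hμ0
  obtain ⟨x, hx, hx0⟩ := hμ.exists_hasEigenvector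
  have hx' : (ρ - frameOp ψ) x = μ • x := Module.End.mem_eigenspace_iff.1 hx
  have hperp (k) : ⟪ψ k, x⟫_ℂ = 0 := by
    have h1 : ⟪(ρ - frameOp ψ) (ψ k), x⟫_ℂ = ⟪ψ k, (ρ - frameOp ψ) x⟫_ℂ := hδs (ψ k) x
    rw [hx', sub_apply, hρψ, frameOp_self hψ, sub_self, inner_zero_left, inner_smul_right] at h1
    exact (mul_eq_zero.1 h1.symm).resolve_left hμ0
  have h1 : frameOp ψ x = 0 := by simp [frameOp_apply, hperp]
  rw [sub_apply, h1, sub_zero] at hx'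
  let x' : Module.End.eigenspace (ρ : H →ₗ[ℂ] H) μ := ⟨x, Module.End.mem_eigenspace_iff.2 hx'⟩
  have h2 : x' = 0 := by
    rw [← (b μ hμ0).sum_repr x']
    refine Finset.sum_eq_zero fun k _ => ?_
    rw [OrthonormalBasis.repr_apply_apply, Submodule.coe_inner, hbw μ hμ0 k.1 k.2]
    have h3 := hψw k.1 x
    rw [hperp] at h3
    rw [(mul_eq_zero.1 h3.symm).resolve_left (sqrt_ne_zero_of_pos (normSqs_pos hm hn k.1)),
      zero_smul]
  exact hx0 (congrArg Subtype.val h2)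

/-- The set with the prescribed eigenvalues is the image of the level set under the left momentum
map. -/
theorem mem_orbitSet_iff (hm : ∀ i, 0 < m i) (hn : ∀ j, 0 < n j) (f : SkewCompactDual H) :
    f ∈ orbitSet H m n ↔
      ∃ ψ : TensorSpace H M N, momentumRight ψ = weight m n ∧ momentumLeft ψ = f := by
  constructor
  · rintro ⟨ρ, hρ, ht, he, hp⟩
    obtain ⟨ψ, hψ, rfl⟩ := exists_frameOp_eq hm hn hρ (ht.isCompactOperator hρ) he
    refine ⟨ψ, hψ, ?_⟩
    ext X
    obtain ⟨w, e, -⟩ := exists_hilbertBasis ℂ H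
    exact_mod_cast (isTracePairing_frameOp ψ X w e).unique (hp X w e)
  · rintro ⟨ψ, hψ, rfl⟩
    exact momentumLeft_mem_orbitSet hm hn hψ

theorem orbitSet_eq_coadjointOrbit (hm : ∀ i, 0 < m i) (hn : ∀ j, 0 < n j)
    {ψ : TensorSpace H M N} (h : momentumRight ψ = weight m n) :
    orbitSet H m n = coadjointOrbit (momentumLeft ψ) := by
  ext f
  rw [mem_orbitSet_iff hm hn]
  constructor
  · rintro ⟨ψ', hψ', rfl⟩
    obtain ⟨U, rfl⟩ := exists_leftMul_unitary_eq hm hn h hψ'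
    exact ⟨U, (momentumLeft_leftMul U ψ).symm⟩
  · rintro ⟨U, rfl⟩
    exact ⟨leftMul (U : H →L[ℂ] H) ψ, momentumRight_leftMul U h, momentumLeft_leftMul U ψ⟩

lemma coadjointAction_mem_orbitSet (hm : ∀ i, 0 < m i) (hn : ∀ j, 0 < n j) (U : UnitaryCompact H)
    {f : SkewCompactDual H} (hf : f ∈ orbitSet H m n) : coadjointAction U f ∈ orbitSet H m n := by
  rw [mem_orbitSet_iff hm hn] at hf ⊢
  obtain ⟨ψ, hψ, rfl⟩ := hf
  exact ⟨leftMul (U : H →L[ℂ] H) ψ, momentumRight_leftMul U hψ, momentumLeft_leftMul U ψ⟩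

end OrbitSet

/-! ### Schur multipliers with respect to a resolution of the identity -/

section Schur

variable {H : Type u} [NormedAddCommGroup H] [InnerProductSpace ℂ H] [CompleteSpace H]
  {ι : Type*} [Fintype ι] [DecidableEq ι]

/-- A finite family of orthogonal projections onto mutually orthogonal subspaces with sum `1`. -/
structure IsResolution (p : ι → H →L[ℂ] H) : Prop where
  mul (a b) : p a * p b = if a = b then p a else 0
  sum : ∑ a, p a = 1
  star_eq (a) : star (p a) = p a

/-- The operator with the blocks `c a b • p a * A * p b`. -/
def schurOp (p : ι → H →L[ℂ] H) (c : ι → ι → ℂ) (A : H →L[ℂ] H) : H →L[ℂ] H :=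
  ∑ a, ∑ b, c a b • (p a * A * p b)

variable {p : ι → H →L[ℂ] H} (hp : IsResolution p)

lemma star_schurOp (hp : IsResolution p) (c : ι → ι → ℂ) (A : H →L[ℂ] H) :
    star (schurOp p c A) = schurOp p (fun a b => (starRingEnd ℂ) (c b a)) (star A) := by
  simp only [schurOp, star_sum, star_smul, star_mul, hp.star_eq, mul_assoc]
  exact Finset.sum_comm

lemma mul_schurOp_mul (hp : IsResolution p) (c : ι → ι → ℂ) (A : H →L[ℂ] H) (a b : ι) :
    p a * schurOp p c A * p b = c a b • (p a * A * p b) := by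
  have h1 (a' b') : p a * (c a' b' • (p a' * A * p b')) * p b =
      if b' = b then (if a' = a then c a' b' • (p a * A * p b) else 0) else 0 := by
    calc _ = c a' b' • ((p a * p a') * A * (p b' * p b)) := by
          simp only [mul_smul_comm, smul_mul_assoc, mul_assoc]
      _ = _ := by
          rw [hp.mul, hp.mul]
          by_cases ha : a' = a
          · by_cases hb : b' = b
            · subst ha; subst hb; simp
            · simp [hb]
          · simp [ha, Ne.symm ha]
  simp only [schurOp, Finset.mul_sum, Finset.sum_mul, h1]
  simp

/-- Identities between multipliers, inverses on blocks included, reduce to pointwise identities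
between symbols. -/
lemma schurOp_schurOp (hp : IsResolution p) (c d : ι → ι → ℂ) (A : H →L[ℂ] H) :
    schurOp p c (schurOp p d A) = schurOp p (fun a b => c a b * d a b) A := by
  rw [schurOp]
  simp only [mul_schurOp_mul hp, smul_smul]
  rfl

/-- The commutator with a diagonal operator is itself a Schur multiplier, so inverting it means
dividing by the eigenvalue differences. -/
lemma sum_smul_mul_sub_mul_sum_smul (hp : IsResolution p) (l : ι → ℂ) (A : H →L[ℂ] H) :
    (∑ a, l a • p a) * A - A * (∑ a, l a • p a) = schurOp p (fun a b => l a - l b) A := by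
  have h1 : (∑ a, l a • p a) * A = schurOp p (fun a _ => l a) A := by
    simp only [schurOp, ← Finset.smul_sum, ← Finset.mul_sum, hp.sum, mul_one, Finset.sum_mul,
      smul_mul_assoc]
  have h2 : A * (∑ a, l a • p a) = schurOp p (fun _ b => l b) A := by
    rw [schurOp, Finset.sum_comm]
    simp only [← Finset.smul_sum, ← Finset.sum_mul, hp.sum, one_mul, Finset.mul_sum,
      mul_smul_comm]
  rw [h1, h2, schurOp, schurOp, schurOp, ← Finset.sum_sub_distrib]
  refine Finset.sum_congr rfl fun a _ => ?_
  rw [← Finset.sum_sub_distrib]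
  simp only [sub_smul]

/-- The Schur multiplier with hermitian symbol, on the skew-adjoint compact operators. -/
def schur (hp : IsResolution p) (c : ι → ι → ℂ) (hc : ∀ a b, (starRingEnd ℂ) (c b a) = c a b) :
    SkewCompact H →L[ℝ] SkewCompact H where
  toFun X := ⟨schurOp p c X,
    Submodule.sum_mem (compactOperator (RingHom.id ℂ) H H) fun a _ =>
      Submodule.sum_mem _ fun b _ =>
        Submodule.smul_mem _ _ ((X.2.1.clm_comp (p a)).comp_clm (p b)), by
    rw [star_schurOp hp, SkewCompact.star_eq]
    simp only [hc, schurOp, mul_neg, neg_mul, smul_neg, Finset.sum_neg_distrib]⟩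
  map_add' X Y := by
    ext1
    simp only [schurOp, Submodule.coe_add, mul_add, add_mul, smul_add, Finset.sum_add_distrib]
  map_smul' r X := by
    ext1
    simp only [schurOp, Submodule.coe_smul, mul_smul_comm, smul_mul_assoc, smul_comm _ r,
      Finset.smul_sum, RingHom.id_apply]
  cont := by
    refine Continuous.subtype_mk ?_ _
    simp only [schurOp]
    fun_prop

lemma coe_schur (c : ι → ι → ℂ) (hc : ∀ a b, (starRingEnd ℂ) (c b a) = c a b)
    (X : SkewCompact H) : (schur hp c hc X : H →L[ℂ] H) = schurOp p c X := rfl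

/-- A skew-adjoint operator with only one nonzero block is killed by the multipliers whose symbol
vanishes there. -/
lemma schur_eq_zero (c : ι → ι → ℂ) (hc : ∀ a b, (starRingEnd ℂ) (c b a) = c a b) {o : ι}
    (ho : c o o = 0) {X : SkewCompact H} (hX : ∀ b, b ≠ o → (X : H →L[ℂ] H) * p b = 0) :
    schur hp c hc X = 0 := by
  ext1
  rw [coe_schur, schurOp]
  refine Finset.sum_eq_zero fun a _ => Finset.sum_eq_zero fun b _ => ?_
  by_cases hb : b = o
  · by_cases ha : a = o
    · rw [ha, hb, ho, zero_smul]
    · have h1 := congrArg star (hX a ha)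
      rw [star_mul, hp.star_eq, SkewCompact.star_eq, star_zero, mul_neg, neg_eq_zero] at h1
      rw [h1, zero_mul, smul_zero]
  · rw [mul_assoc, hX b hb, mul_zero, smul_zero]

end Schur

/-! ### The resolution of the identity attached to an orthonormal family -/

section FrameResolution

variable {H : Type u} [NormedAddCommGroup H] [InnerProductSpace ℂ H]
  {κ : Type*} [Fintype κ]

/-- The projections onto the lines spanned by the vectors of an orthonormal family, and onto the
orthogonal complement of their span. -/
def frameProj (u : κ → H) : Option κ → H →L[ℂ] H
  | some k => InnerProductSpace.rankOne ℂ (u k) (u k)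
  | none => 1 - ∑ k, InnerProductSpace.rankOne ℂ (u k) (u k)

lemma frameProj_some_apply (u : κ → H) (k : κ) (x : H) :
    frameProj u (some k) x = ⟪u k, x⟫_ℂ • u k := by
  simp [frameProj]

lemma frameProj_none_apply (u : κ → H) (x : H) :
    frameProj u none x = x - ∑ k, ⟪u k, x⟫_ℂ • u k := by
  simp [frameProj, sum_apply]

variable [DecidableEq κ]

lemma frameProj_apply_self {u : κ → H} (hu : Orthonormal ℂ u) (a : Option κ) (k : κ) :
    frameProj u a (u k) = if a = some k then u k else 0 := by
  have h1 (i k : κ) : ⟪u i, u k⟫_ℂ = if i = k then 1 else 0 := orthonormal_iff_ite.1 hu i k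
  rcases a with _ | j
  · simp [frameProj_none_apply, h1]
  · rw [frameProj_some_apply, h1]
    by_cases hjk : j = k
    · simp [hjk]
    · simp [hjk]

lemma isResolution_frameProj [CompleteSpace H] {u : κ → H} (hu : Orthonormal ℂ u) :
    IsResolution (frameProj u) where
  mul a b := by
    ext x
    rw [mul_apply_eq_comp]
    rcases b with _ | k
    · rw [frameProj_none_apply, map_sub, map_sum]
      simp only [map_smul, frameProj_apply_self hu]
      rcases a with _ | j
      · simp
      · simp [frameProj_some_apply]
    · rw [frameProj_some_apply, map_smul, frameProj_apply_self hu]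
      split_ifs with h
      · rw [h, frameProj_some_apply]
      · simp
  sum := by
    rw [Fintype.sum_option]
    simp [frameProj]
  star_eq a := by
    rcases a with _ | k <;> simp [frameProj, star_rankOne]

lemma schurOp_apply_self {u : κ → H} (hu : Orthonormal ℂ u) (c : Option κ → Option κ → ℂ)
    (A : H →L[ℂ] H) (k : κ) :
    schurOp (frameProj u) c A (u k) = ∑ a, c a (some k) • frameProj u a (A (u k)) := by
  simp only [schurOp, sum_apply, smul_apply, mul_apply_eq_comp, frameProj_apply_self hu]
  refine Finset.sum_congr rfl fun a _ => ?_
  rw [Finset.sum_eq_single (some k)]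
  · rw [if_pos rfl]
  · intro b _ hb
    rw [if_neg hb, map_zero, map_zero, smul_zero]
  · simp

variable [CompleteSpace H]

lemma inner_frameProj_left {u : κ → H} (hu : Orthonormal ℂ u) (a : Option κ) (x y : H) :
    ⟪frameProj u a x, y⟫_ℂ = ⟪x, frameProj u a y⟫_ℂ := by
  conv_rhs => rw [← (isResolution_frameProj hu).star_eq a, ContinuousLinearMap.star_eq_adjoint,
    ContinuousLinearMap.adjoint_inner_right]

lemma schur_ketBra {u : κ → H} (hu : Orthonormal ℂ u) (c : Option κ → Option κ → ℂ)
    (hc : ∀ a b, (starRingEnd ℂ) (c b a) = c a b) (z : H) (k : κ) :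
    schur (isResolution_frameProj hu) c hc (ketBra z (u k)) =
      ketBra (∑ a, c a (some k) • frameProj u a z) (u k) := by
  ext1
  ext x
  have h1 (a b : Option κ) : (c a b • (frameProj u a * (ketBra z (u k) : H →L[ℂ] H) *
      frameProj u b)) x = (if b = some k then (c a b * ⟪u k, x⟫_ℂ) • frameProj u a z else 0) -
        if a = some k then (c a b * ⟪frameProj u b z, x⟫_ℂ) • u k else 0 := by
    rw [smul_apply, mul_apply_eq_comp, mul_apply_eq_comp, ketBra_apply, map_sub, map_smul,
      map_smul, frameProj_apply_self hu, ← inner_frameProj_left hu, ← inner_frameProj_left hu,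
      frameProj_apply_self hu, smul_sub, smul_smul, smul_smul]
    congr 1
    · split_ifs <;> simp
    · split_ifs <;> simp
  simp only [coe_schur, schurOp, sum_apply, h1, Finset.sum_sub_distrib, Finset.sum_ite_eq',
    Finset.mem_univ, if_true, ketBra_apply]
  congr 1
  · rw [Finset.smul_sum]
    exact Finset.sum_congr rfl fun a _ => by rw [smul_smul, mul_comm]
  · rw [Finset.sum_comm]
    simp only [Finset.sum_ite_eq', Finset.mem_univ, if_true, sum_inner, inner_smul_left, hc,
      Finset.sum_smul]

end FrameResolution

/-! ### The infinitesimal coadjoint action at a point of the orbit -/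

section Infinitesimal

variable {H : Type u} [NormedAddCommGroup H] [InnerProductSpace ℂ H] [CompleteSpace H]

lemma bracket_ketBra (X : SkewCompact H) (x y : H) :
    bracket X (ketBra x y) =
      ketBra ((X : H →L[ℂ] H) x) y + ketBra x ((X : H →L[ℂ] H) y) := by
  ext1
  ext z
  rw [coe_bracket, sub_apply, mul_apply_eq_comp, mul_apply_eq_comp, Submodule.coe_add, add_apply]
  simp only [ketBra_apply, map_sub, map_smul, inner_skew_left, neg_smul]
  abel

lemma bracket_swap (X Y : SkewCompact H) : bracket X Y = -bracket Y X := by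
  ext1
  simp [coe_bracket]

lemma bracket_add_left (X Y Z : SkewCompact H) :
    bracket (X + Y) Z = bracket X Z + bracket Y Z := by
  rw [bracket_swap, map_add, neg_add, ← bracket_swap, ← bracket_swap]

/-- Riesz representation of the complex-linear extension of a real functional. -/
lemma exists_re_inner_eq (l : H →L[ℝ] ℝ) : ∃ r : H, ∀ x, (⟪x, r⟫_ℂ).re = l x := by
  refine ⟨(InnerProductSpace.toDual ℂ H).symm (StrongDual.extendRCLike (𝕜 := ℂ) l), fun x => ?_⟩
  rw [← inner_conj_symm, Complex.conj_re, InnerProductSpace.toDual_symm_apply]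
  exact StrongDual.re_extendRCLike_apply (𝕜 := ℂ) l x

/-- The operator `ketBra x y` as a linear function of `x`. -/
def ketBraL (y : H) : H →L[ℝ] SkewCompact H :=
  LinearMap.mkContinuous
    { toFun := fun x => ketBra x y
      map_add' := fun x x' => by
        ext1
        ext z
        simp [add_smul]
        abel
      map_smul' := fun c x => by
        ext1
        ext z
        simp [smul_sub, smul_smul, mul_comm, ← Complex.coe_smul] } (2 * ‖y‖)
    fun x => (norm_ketBra_le x y).trans_eq (by ring)

lemma ketBraL_apply (x y : H) : ketBraL y x = ketBra x y := rfl

lemma ketBra_swap (x y : H) : ketBra y x = -ketBra x y := by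
  ext1
  ext z
  simp

lemma ketBra_smul_left (c : ℂ) (x y : H) : ketBra (c • x) y = ketBra x ((starRingEnd ℂ) c • y) := by
  ext1
  ext z
  simp only [ketBra_apply, inner_smul_left, Complex.conj_conj, smul_smul]
  congr 2 <;> ring

variable {M N : ℕ} {m : Fin M → ℝ} {n : Fin N → ℝ}

/-- The skew-adjoint operator `i ∑ ± |ψ_k⟩⟨ψ_k|`. -/
def frameSkew (ψ : TensorSpace H M N) : SkewCompact H :=
  ⟨Complex.I • frameOp ψ, IsCompactOperator.smul (S := ℂ) (c := Complex.I) (Submodule.sum_mem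
    (compactOperator (RingHom.id ℂ) H H) fun k _ =>
      Submodule.smul_mem _ _ (isCompactOperator_rankOne _ _)), by
    rw [star_smul, (isSelfAdjoint_frameOp ψ).star_eq]
    simp⟩

lemma frameSkew_apply (ψ : TensorSpace H M N) (x : H) :
    (frameSkew ψ : H →L[ℂ] H) x = Complex.I • frameOp ψ x := rfl

/-- This is Tr(ρ[X, Z]) = Tr([ρ, X]Z) tested on Z = `ketBra x y`: it replaces the bracket with the
test operator by the commutator of X with i ρ. -/
lemma momentumLeft_bracket_ketBra (ψ : TensorSpace H M N) (X : SkewCompact H) (x y : H) :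
    momentumLeft ψ (bracket X (ketBra x y)) =
      -2 * (⟪x, (bracket (frameSkew ψ) X : H →L[ℂ] H) y⟫_ℂ).re := by
  rw [bracket_ketBra, map_add, momentumLeft_ketBra, momentumLeft_ketBra, coe_bracket, sub_apply,
    mul_apply_eq_comp, mul_apply_eq_comp, frameSkew_apply, frameSkew_apply, map_smul, ← smul_sub,
    inner_smul_right, inner_sub_right]
  have h1 : ⟪y, frameOp ψ ((X : H →L[ℂ] H) x)⟫_ℂ =
      -(starRingEnd ℂ) ⟪x, (X : H →L[ℂ] H) (frameOp ψ y)⟫_ℂ := by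
    rw [← inner_frameOp_left, inner_conj_symm, inner_skew_left, neg_neg]
  have h2 : ⟪(X : H →L[ℂ] H) y, frameOp ψ x⟫_ℂ =
      (starRingEnd ℂ) ⟪x, frameOp ψ ((X : H →L[ℂ] H) y)⟫_ℂ := by
    rw [inner_conj_symm, inner_frameOp_left]
  rw [h1, h2, Complex.neg_im, Complex.conj_im, Complex.conj_im, Complex.I_mul_re, Complex.sub_im]
  ring

/-- The pairing is ω(Xψ, Yψ), which sees Y only on the frame. A compact Y may therefore be replaced
by a finite sum of operators `ketBra`. -/
lemma momentumLeft_bracket_congr (hm : ∀ i, 0 < m i) (hn : ∀ j, 0 < n j) {ψ : TensorSpace H M N}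
    (X : SkewCompact H) {Y Z : SkewCompact H}
    (h : ∀ k, (Y : H →L[ℂ] H) (unitFrame m n ψ k) = (Z : H →L[ℂ] H) (unitFrame m n ψ k)) :
    momentumLeft ψ (bracket X Y) = momentumLeft ψ (bracket X Z) := by
  have h1 : leftMul (Y : H →L[ℂ] H) ψ = leftMul (Z : H →L[ℂ] H) ψ := by
    ext k
    rw [leftMul_apply, leftMul_apply, ← sqrt_smul_unitFrame hm hn ψ, map_smul, map_smul, h]
  rw [indefForm_bracket, indefForm_bracket, h1]

/-- The eigenvalue of `frameOp ψ` on the range of a projection of the frame. -/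
def optWeights (m : Fin M → ℝ) (n : Fin N → ℝ) (a : Option (Fin M ⊕ Fin N)) : ℝ :=
  a.elim 0 (weights m n)

lemma coe_frameSkew_eq (hm : ∀ i, 0 < m i) (hn : ∀ j, 0 < n j) (ψ : TensorSpace H M N) :
    (frameSkew ψ : H →L[ℂ] H) =
      ∑ a, (Complex.I * optWeights m n a) • frameProj (unitFrame m n ψ) a := by
  ext x
  rw [frameSkew_apply, frameOp_apply, Fintype.sum_option, Finset.smul_sum]
  simp only [optWeights, Option.elim_none, Complex.ofReal_zero, mul_zero, zero_smul, zero_add,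
    Option.elim_some, sum_apply, smul_apply, frameProj_some_apply]
  refine Finset.sum_congr rfl fun k _ => ?_
  nth_rw 1 2 [← sqrt_smul_unitFrame hm hn ψ]
  rw [inner_smul_left, Complex.conj_ofReal, smul_smul, smul_smul, smul_smul, ← sgn_mul_normSqs,
    ← sqrt_mul_sqrt (normSqs_pos hm hn k)]
  congr 1
  ring

lemma coadjointField_eq_zero_iff (Y : SkewCompact H) (f : SkewCompactDual H) :
    coadjointField Y f = 0 ↔ ∀ X, f (bracket Y X) = 0 := by
  rw [ContinuousLinearMap.ext_iff]
  simp [coadjointField_apply]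

/-- A complement of the stabilizer of `momentumLeft ψ`, given by a projection `T` of the Lie
algebra, on which the Kirillov–Kostant–Souriau form is strongly nondegenerate. -/
theorem exists_transversal (hm : ∀ i, 0 < m i) (hn : ∀ j, 0 < n j) {ψ : TensorSpace H M N}
    (h : momentumRight ψ = weight m n) :
    ∃ T : SkewCompact H →L[ℝ] SkewCompact H, (∀ X, T (T X) = T X) ∧
      (∀ Y, coadjointField (T Y) (momentumLeft ψ) = coadjointField Y (momentumLeft ψ)) ∧
      (∀ X, T X = X → (∀ Y, T Y = Y → momentumLeft ψ (bracket X Y) = 0) → X = 0) ∧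
      (∀ g : SkewCompactDual H, ∃ X, T X = X ∧
        ∀ Y, T Y = Y → momentumLeft ψ (bracket X Y) = g Y) ∧
      ∀ (x y : H) (a b : ℝ), frameOp ψ x = (a : ℂ) • x → frameOp ψ y = (b : ℂ) • y → a ≠ b →
        T (ketBra x y) = ketBra x y := by
  classical
  let u := unitFrame m n ψ
  have hu : Orthonormal ℂ u := orthonormal_unitFrame hm hn h
  have hp := isResolution_frameProj hu
  let l := optWeights m n
  -- c is the symbol of the commutator with `frameSkew ψ`.
  let c : Option (Fin M ⊕ Fin N) → Option (Fin M ⊕ Fin N) → ℂ := fun a b =>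
    Complex.I * (l a : ℂ) - Complex.I * (l b : ℂ)
  -- Since 0⁻¹ = 0, s is the pseudo-inverse of c, and χ is the indicator of the pairs with different
  -- eigenvalues. All three vanish at (none, none), the block of the orthogonal complement of the
  -- frame.
  let s : Option (Fin M ⊕ Fin N) → Option (Fin M ⊕ Fin N) → ℂ := fun a b => (c a b)⁻¹
  let χ : Option (Fin M ⊕ Fin N) → Option (Fin M ⊕ Fin N) → ℂ := fun a b => c a b * s a b
  have hc (a b) : (starRingEnd ℂ) (c b a) = c a b := by
    simp only [c, map_sub, map_mul, Complex.conj_I, Complex.conj_ofReal]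
    ring
  have hs (a b) : (starRingEnd ℂ) (s b a) = s a b := by rw [map_inv₀, hc]
  have hχ (a b) : (starRingEnd ℂ) (χ b a) = χ a b := by rw [map_mul, hc, hs]
  have hcc : c none none = 0 := sub_self _
  have hss : s none none = 0 := by simp only [s, hcc, inv_zero]
  have hχχ : χ none none = 0 := by simp only [χ, hcc, zero_mul]
  let T := schur hp χ hχ
  have hTdef : T = schur hp χ hχ := rfl
  have hbr (X : SkewCompact H) : bracket (frameSkew ψ) X = schur hp c hc X := by
    ext1
    rw [coe_bracket, coe_frameSkew_eq hm hn, coe_schur]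
    exact sum_smul_mul_sub_mul_sum_smul hp _ _
  have hχ1 (a b) : χ a b * χ a b = χ a b := by
    by_cases h0 : c a b = 0
    · simp [χ, h0]
    · simp [χ, s, h0]
  have hχc (a b) : χ a b * c a b = c a b := by
    by_cases h0 : c a b = 0
    · simp [h0]
    · simp [χ, s, h0]
  have hχs (a b) : χ a b * s a b = s a b := by
    by_cases h0 : c a b = 0
    · simp [χ, s, h0]
    · simp [χ, s, h0]
  have hTT (X) : T (T X) = T X := by
    ext1
    rw [hTdef, coe_schur, coe_schur, schurOp_schurOp hp]
    simp only [hχ1]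
  have hTc (X) : T (schur hp c hc X) = schur hp c hc X := by
    ext1
    rw [hTdef, coe_schur, coe_schur, schurOp_schurOp hp]
    simp only [hχc]
  have hcT (X) : schur hp c hc (T X) = schur hp c hc X := by
    ext1
    rw [hTdef, coe_schur, coe_schur, coe_schur, schurOp_schurOp hp]
    simp only [mul_comm (c _ _), hχc]
  have hTs (X) : T (schur hp s hs X) = schur hp s hs X := by
    ext1
    rw [hTdef, coe_schur, coe_schur, schurOp_schurOp hp]
    simp only [hχs]
  have hcs (X) : schur hp c hc (schur hp s hs X) = T X := by
    ext1
    rw [hTdef, coe_schur, coe_schur, coe_schur, schurOp_schurOp hp]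
  have hsc (X) : schur hp s hs (schur hp c hc X) = T X := by
    ext1
    rw [hTdef, coe_schur, coe_schur, coe_schur, schurOp_schurOp hp]
    simp only [mul_comm (s _ _)]
    rfl
  -- operators vanishing on the frame
  have hvan {d : Option (Fin M ⊕ Fin N) → Option (Fin M ⊕ Fin N) → ℂ}
      (hd : ∀ a b, (starRingEnd ℂ) (d b a) = d a b) (hdd : d none none = 0) {X : SkewCompact H}
      (hX : ∀ k, (X : H →L[ℂ] H) (u k) = 0) : schur hp d hd X = 0 := by
    refine schur_eq_zero hp d hd hdd fun b hb => ?_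
    obtain ⟨k, rfl⟩ := Option.ne_none_iff_exists'.1 hb
    ext x
    rw [mul_apply_eq_comp, frameProj_some_apply, map_smul, hX, smul_zero]
    rfl
  -- replacing an operator by a sum of operators `ketBra`
  let Fr (Y : SkewCompact H) : SkewCompact H := skewOfFrame u fun k => (Y : H →L[ℂ] H) (u k)
  have hFr (Y : SkewCompact H) (k) : (Fr Y : H →L[ℂ] H) (u k) = (Y : H →L[ℂ] H) (u k) :=
    skewOfFrame_apply hu (fun j k => by rw [inner_skew_left, add_neg_cancel]) k
  have hcongr (X Y : SkewCompact H) :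
      momentumLeft ψ (bracket X Y) = momentumLeft ψ (bracket X (Fr Y)) :=
    momentumLeft_bracket_congr hm hn X fun k => (hFr Y k).symm
  have hzero {Y : SkewCompact H} (hY : schur hp c hc Y = 0) :
      coadjointField Y (momentumLeft ψ) = 0 := by
    rw [coadjointField_eq_zero_iff]
    intro X
    rw [hcongr]
    simp only [Fr, skewOfFrame, map_sum]
    refine Finset.sum_eq_zero fun k _ => ?_
    rw [momentumLeft_bracket_ketBra, hbr, hY]
    simp
  -- T Y - Y commutes with `frameSkew ψ`, hence acts trivially at `momentumLeft ψ`.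
  have htan (Y) : coadjointField (T Y) (momentumLeft ψ) = coadjointField Y (momentumLeft ψ) := by
    have h1 := hzero (Y := T Y - Y) (by rw [map_sub, hcT, sub_self])
    rw [coadjointField_eq_zero_iff] at h1
    ext X
    have h2 := h1 X
    have h3 : bracket (-Y) X = bracket X Y := by rw [bracket_swap, map_neg, neg_neg]
    rw [sub_eq_add_neg, bracket_add_left, map_add, h3, bracket_swap X, map_neg] at h2
    rw [coadjointField_apply, coadjointField_apply]
    linarith
  have hpair (X Y) : momentumLeft ψ (bracket X (T Y)) = momentumLeft ψ (bracket X Y) := by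
    have h1 := DFunLike.congr_fun (htan Y) X
    rw [coadjointField_apply, coadjointField_apply] at h1
    rw [bracket_swap X, bracket_swap X, map_neg, map_neg]
    exact h1
  refine ⟨T, hTT, htan, fun X hX h0 => ?_, fun g => ?_, fun x y a b hx hy hab => ?_⟩
  -- Testing against `ketBra z (u k)` with z the value at u_k of the commutator with X yields
  -- -2‖z‖², so the commutator vanishes on the frame; applying s recovers X.
  · have h1 (k) : (schur hp c hc X : H →L[ℂ] H) (u k) = 0 := by
      have h2 := momentumLeft_bracket_ketBra ψ X
        ((schur hp c hc X : H →L[ℂ] H) (u k)) (u k)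
      rw [← hpair, h0 _ (hTT _), hbr, inner_self_eq_ofReal, Complex.ofReal_re] at h2
      have h3 : ‖(schur hp c hc X : H →L[ℂ] H) (u k)‖ ^ 2 = 0 := by linarith
      exact norm_eq_zero.1 (pow_eq_zero_iff (two_ne_zero) |>.1 h3)
    rw [← hX, ← hsc]
    exact hvan hs hss h1
  -- The functional is represented column by column. It suffices to find a skew-adjoint A with A u_k
  -- = -r_k / 2, where the factor cancels the -2 of `momentumLeft_bracket_ketBra`; then X is
  -- obtained by dividing A by the symbol c.
  · choose r hr using fun k => exists_re_inner_eq (((g.comp T).comp (ketBraL (u k))))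
    have hr' (k) (x : H) : (⟪x, r k⟫_ℂ).re = g (T (ketBra x (u k))) := hr k x
    have hre (w : H) (hw : ∀ x, (⟪x, w⟫_ℂ).re = 0) : w = 0 := by
      have h1 := hw w
      rw [inner_self_eq_ofReal, Complex.ofReal_re] at h1
      exact norm_eq_zero.1 (pow_eq_zero_iff (two_ne_zero) |>.1 h1)
    -- T is idempotent, so the functional represented by r_k is unchanged when x is replaced by its
    -- χ-part; this carries over to r_k and later gives T A the same columns as A.
    have hrχ (k) : ∑ a, χ a (some k) • frameProj u a (r k) = r k := by
      rw [← sub_eq_zero]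
      refine hre _ fun x => ?_
      have h1 : ⟪x, ∑ a, χ a (some k) • frameProj u a (r k)⟫_ℂ =
          ⟪∑ a, χ a (some k) • frameProj u a x, r k⟫_ℂ := by
        rw [inner_sum, sum_inner]
        refine Finset.sum_congr rfl fun a _ => ?_
        have h2 : (starRingEnd ℂ) (χ a (some k)) = χ a (some k) := by
          by_cases h0 : c a (some k) = 0
          · simp [χ, h0]
          · simp [χ, s, h0]
        rw [inner_smul_left, inner_smul_right, h2, inner_frameProj_left hu]
      have h2 : T (schur hp χ hχ (ketBra x (u k))) = T (ketBra x (u k)) := hTT _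
      rw [inner_sub_right, Complex.sub_re, h1, hr', hr', ← schur_ketBra hu χ hχ, h2, sub_self]
    -- Antisymmetry of `ketBra`, tested with arbitrary complex multiples z, is the compatibility
    -- condition for the r_k to be the columns of a skew-adjoint operator.
    have hskew (j k) : ⟪u j, (-(2⁻¹ : ℂ)) • r k⟫_ℂ + ⟪(-(2⁻¹ : ℂ)) • r j, u k⟫_ℂ = 0 := by
      have h2 (z : ℂ) : (z * (⟪u j, r k⟫_ℂ + ⟪r j, u k⟫_ℂ)).re = 0 := by
        have h3 := hr' k ((starRingEnd ℂ) z • u j)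
        have h4 := hr' j (z • u k)
        rw [ketBra_smul_left, Complex.conj_conj, ketBra_swap, map_neg, map_neg, ← h4,
          inner_smul_left, inner_smul_left, Complex.conj_conj] at h3
        have h5 : ((starRingEnd ℂ) z * ⟪u k, r j⟫_ℂ).re = (z * ⟪r j, u k⟫_ℂ).re := by
          rw [← Complex.conj_re, map_mul, Complex.conj_conj, inner_conj_symm]
        rw [mul_add, Complex.add_re, h3, h5, neg_add_cancel]
      have h3 := h2 ((starRingEnd ℂ) (⟪u j, r k⟫_ℂ + ⟪r j, u k⟫_ℂ))
      rw [← Complex.normSq_eq_conj_mul_self, Complex.ofReal_re, Complex.normSq_eq_zero] at h3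
      rw [inner_smul_left, inner_smul_right]
      have h4 : (starRingEnd ℂ) (-(2⁻¹ : ℂ)) = -(2⁻¹ : ℂ) := by
        rw [map_neg, map_inv₀, Complex.conj_ofNat]
      rw [h4, ← mul_add, h3, mul_zero]
    let A : SkewCompact H := skewOfFrame u fun k => (-(2⁻¹ : ℂ)) • r k
    have hA (k) : (A : H →L[ℂ] H) (u k) = (-(2⁻¹ : ℂ)) • r k := skewOfFrame_apply hu hskew k
    have hTA (k) : (T A : H →L[ℂ] H) (u k) = (-(2⁻¹ : ℂ)) • r k := by
      rw [hTdef, coe_schur, schurOp_apply_self hu, hA]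
      simp only [map_smul, smul_comm _ (-(2⁻¹ : ℂ))]
      rw [← Finset.smul_sum, hrχ]
    refine ⟨schur hp s hs A, hTs A, fun Y hY => ?_⟩
    have h1 (z : H) (k) : momentumLeft ψ (bracket (schur hp s hs A) (ketBra z (u k))) =
        g (T (ketBra z (u k))) := by
      rw [momentumLeft_bracket_ketBra, hbr, hcs, hTA, ← hr', inner_smul_right]
      rw [show (-(2⁻¹ : ℂ)) = ((-(2⁻¹ : ℝ) : ℝ) : ℂ) by push_cast; rfl, Complex.re_ofReal_mul]
      ring
    -- T kills operators vanishing on the frame, and Y = T Y, so g Y depends only on the values of Y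
    -- on the frame.
    have h2 : g Y = g (T (Fr Y)) := by
      have h3 : T (Y - Fr Y) = 0 := hvan hχ hχχ fun k => by
        rw [Submodule.coe_sub, sub_apply, hFr, sub_self]
      rw [map_sub, hY, sub_eq_zero] at h3
      exact congrArg g h3
    rw [hcongr, h2]
    simp only [Fr, skewOfFrame, map_sum, h1]
  · have hab' : (a : ℂ) - b ≠ 0 := by
      rw [sub_ne_zero]
      exact_mod_cast hab
    -- On eigenvectors x, y the commutator multiplies `ketBra x y` by i(a - b), so this operator is
    -- a commutator and T fixes it.
    have h1 : bracket (frameSkew ψ) (ketBra ((Complex.I * (a - b))⁻¹ • x) y) = ketBra x y := by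
      have h0 : Complex.I * ((a : ℂ) - b) ≠ 0 := mul_ne_zero Complex.I_ne_zero hab'
      have h2 : (Complex.I * (b : ℂ)) • y = (starRingEnd ℂ) (-(Complex.I * b)) • y := by
        rw [map_neg, map_mul, Complex.conj_I, Complex.conj_ofReal, neg_mul, neg_neg]
      rw [bracket_ketBra, frameSkew_apply, frameSkew_apply, map_smul, hx, hy,
        smul_smul Complex.I (b : ℂ), h2, ← ketBra_smul_left, ← ketBraL_apply,
        ← ketBraL_apply, ← map_add, ketBraL_apply, smul_smul, smul_smul, smul_smul, ← add_smul]
      have h3 : Complex.I * ((Complex.I * ((a : ℂ) - b))⁻¹ * a) +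
          -(Complex.I * b) * (Complex.I * ((a : ℂ) - b))⁻¹ = 1 := by
        rw [← mul_inv_cancel₀ h0]
        ring
      rw [mul_assoc, h3, one_smul]
    rw [← h1, hbr, hTc]

end Infinitesimal

/-! ### Transversal slices of the orbit -/

section Rigidity

variable {H : Type u} [NormedAddCommGroup H] [InnerProductSpace ℂ H]
  {M N : ℕ} {m : Fin M → ℝ} {n : Fin N → ℝ}

lemma frameOp_frameProj [CompleteSpace H] (hm : ∀ i, 0 < m i) (hn : ∀ j, 0 < n j)
    {ψ : TensorSpace H M N} (h : momentumRight ψ = weight m n) (a : Option (Fin M ⊕ Fin N)) (x : H) :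
    frameOp ψ (frameProj (unitFrame m n ψ) a x) =
      (optWeights m n a : ℂ) • frameProj (unitFrame m n ψ) a x := by
  classical
  have hp := isResolution_frameProj (orthonormal_unitFrame hm hn h)
  have h1 := congrArg (fun A : H →L[ℂ] H => A (frameProj (unitFrame m n ψ) a x))
    (coe_frameSkew_eq hm hn ψ)
  have h2 (b) : frameProj (unitFrame m n ψ) b (frameProj (unitFrame m n ψ) a x) =
      if b = a then frameProj (unitFrame m n ψ) a x else 0 := by
    rw [← mul_apply_eq_comp, hp.mul]
    by_cases hba : b = a
    · simp [hba]
    · simp [hba]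
  simp only [frameSkew_apply, sum_apply, smul_apply, h2, smul_ite, smul_zero, Finset.sum_ite_eq',
    Finset.mem_univ, if_true, mul_smul] at h1
  exact smul_right_injective H Complex.I_ne_zero h1

lemma eq_zero_of_inner_frameProj [CompleteSpace H] {κ : Type*} [Fintype κ] [DecidableEq κ]
    {u : κ → H} (hu : Orthonormal ℂ u) {x : H}
    (hx : ∀ a y, ⟪frameProj u a y, x⟫_ℂ = 0) : x = 0 := by
  have h1 : ∑ a, frameProj u a x = x := by
    rw [← sum_apply, (isResolution_frameProj hu).sum, one_apply_eq_self]
  have h2 : ⟪x, x⟫_ℂ = 0 := by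
    nth_rw 1 [← h1]
    rw [sum_inner]
    exact Finset.sum_eq_zero fun a _ => hx a x
  exact inner_self_eq_zero.1 h2

/-- A linear functional on a subspace that is an eigenvector of the transpose of a small operator
with a large eigenvalue vanishes. -/
lemma eq_zero_of_transpose_eigenvector {p : Submodule ℂ H} {d : H →L[ℂ] H} (hd : ∀ x ∈ p, d x ∈ p)
    {ε : ℝ} (hdε : ∀ x, ‖d x‖ ≤ ε * ‖x‖) {w : H} {c : ℂ} (hc : ε < ‖c‖) (hε : 0 ≤ ε)
    (hw : ∀ x ∈ p, c * ⟪w, x⟫_ℂ = ⟪w, d x⟫_ℂ) {x : H} (hx : x ∈ p) : ⟪w, x⟫_ℂ = 0 := by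
  have hc0 : 0 < ‖c‖ := hε.trans_lt hc
  -- The eigenvalue relation is iterated along x, dx, d²x, ..., all of which stay in p.
  have h1 (k : ℕ) : ∀ x ∈ p, ‖⟪w, x⟫_ℂ‖ ≤ (ε / ‖c‖) ^ k * (‖w‖ * ‖x‖) := by
    induction k with
    | zero => intro x _; simpa using norm_inner_le_norm w x
    | succ k ih =>
      intro x hx
      have h2 := ih _ (hd x hx)
      rw [← hw x hx, norm_mul] at h2
      have h3 : (ε / ‖c‖) ^ k * (‖w‖ * ‖d x‖) ≤ (ε / ‖c‖) ^ k * (‖w‖ * (ε * ‖x‖)) := by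
        gcongr
        exact hdε x
      rw [pow_succ, ← mul_le_mul_iff_right₀ hc0]
      refine (h2.trans h3).trans_eq ?_
      field_simp
  have h2 : Filter.Tendsto (fun k : ℕ => (ε / ‖c‖) ^ k * (‖w‖ * ‖x‖)) Filter.atTop (𝓝 0) := by
    have h3 := (tendsto_pow_atTop_nhds_zero_of_lt_one (r := ε / ‖c‖) (by positivity)
      ((div_lt_one hc0).2 hc)).mul_const (‖w‖ * ‖x‖)
    rwa [zero_mul] at h3
  exact norm_le_zero_iff.1 (ge_of_tendsto' h2 fun k => h1 k x hx)

/-- The gap of the spectrum. -/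
lemma exists_weights_gap (m : Fin M → ℝ) (n : Fin N → ℝ) :
    ∃ ε > 0, ∀ a b : Option (Fin M ⊕ Fin N), optWeights m n a ≠ optWeights m n b →
      ε ≤ |optWeights m n a - optWeights m n b| := by
  classical
  let S := {p : Option (Fin M ⊕ Fin N) × Option (Fin M ⊕ Fin N) //
    optWeights m n p.1 ≠ optWeights m n p.2}
  rcases isEmpty_or_nonempty S with hS | hS
  · exact ⟨1, one_pos, fun a b hab => (hS.false ⟨(a, b), hab⟩).elim⟩
  · obtain ⟨p, hp⟩ := Finite.exists_min fun p : S => |optWeights m n p.1.1 - optWeights m n p.1.2|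
    exact ⟨_, abs_pos.2 (sub_ne_zero.2 p.2), fun a b hab => hp ⟨(a, b), hab⟩⟩

/-- Points of the orbit close to `momentumLeft ψ` in a direction annihilating all operators that
mix different eigenspaces coincide with `momentumLeft ψ`. -/
theorem exists_pos_forall_annihilator_eq_zero [CompleteSpace H] (hm : ∀ i, 0 < m i)
    (hn : ∀ j, 0 < n j) {ψ : TensorSpace H M N} (h : momentumRight ψ = weight m n) :
    ∃ ε > 0, ∀ f : SkewCompactDual H, ‖f‖ < ε →
      (∀ (x y : H) (a b : ℝ), frameOp ψ x = (a : ℂ) • x → frameOp ψ y = (b : ℂ) • y → a ≠ b →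
        f (ketBra x y) = 0) →
      momentumLeft ψ + f ∈ orbitSet H m n → f = 0 := by
  obtain ⟨ε, hε, hgap⟩ := exists_weights_gap m n
  refine ⟨ε, hε, fun f hf hann hO => ?_⟩
  obtain ⟨ψ', h', hL⟩ := (mem_orbitSet_iff hm hn _).1 hO
  have hu := orthonormal_unitFrame hm hn h
  have hu' := orthonormal_unitFrame hm hn h'
  -- d is the operator of f, so its norm is at most ‖f‖, below the spectral gap. The annihilation
  -- hypothesis makes it block diagonal for the eigenspaces of `frameOp ψ`.
  let d := frameOp ψ' - frameOp ψ
  have hd (x) : d x = frameOp ψ' x - frameOp ψ x := rfl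
  have hfd (x y) : f (ketBra x y) = -2 * (⟪y, d x⟫_ℂ).im := by
    have h1 := momentumLeft_ketBra ψ' x y
    rw [hL, add_apply, momentumLeft_ketBra] at h1
    rw [hd, inner_sub_right, Complex.sub_im]
    linarith
  have hdf := norm_apply_le_of_ketBra hfd
  have horth {x y : H} {a b : ℝ} (hx : frameOp ψ x = (a : ℂ) • x) (hy : frameOp ψ y = (b : ℂ) • y)
      (hab : a ≠ b) : ⟪y, d x⟫_ℂ = 0 := by
    have h1 := hann x y a b hx hy hab
    -- The functional only gives imaginary parts; i x supplies the real one.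
    have h2 := hann (Complex.I • x) y a b (by rw [map_smul, hx, smul_comm]) hy hab
    rw [hfd] at h1 h2
    rw [map_smul, inner_smul_right, Complex.I_mul_im] at h2
    apply Complex.ext
    · simpa using h2
    · simpa using h1
  have hinv {x : H} {a : ℝ} (hx : frameOp ψ x = (a : ℂ) • x) :
      frameOp ψ (d x) = (a : ℂ) • d x := by
    rw [← sub_eq_zero]
    refine eq_zero_of_inner_frameProj hu fun b y => ?_
    have hy := frameOp_frameProj hm hn h b y
    rw [inner_sub_right, ← inner_frameOp_left, hy, inner_smul_left, inner_smul_right,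
      Complex.conj_ofReal]
    by_cases hab : a = optWeights m n b
    · rw [hab, sub_self]
    · rw [horth hx hy hab, mul_zero, mul_zero, sub_self]
  -- On the a-eigenspace of `frameOp ψ`, an eigenvector w of `frameOp ψ'` with eigenvalue b
  -- satisfies (b - a)⟨w, z⟩ = ⟨w, dz⟩. If b = a the right side is zero; if b ≠ a the gap exceeds
  -- ‖f‖, so w is orthogonal to the invariant eigenspace. Either way dx is orthogonal to every such
  -- w, and these span H.
  have hzero (a : Option (Fin M ⊕ Fin N)) {x : H}
      (hx : frameOp ψ x = (optWeights m n a : ℂ) • x) : d x = 0 := by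
    refine eq_zero_of_inner_frameProj hu' fun b y => ?_
    have hw := frameOp_frameProj hm hn h' b y
    set w := frameProj (unitFrame m n ψ') b y
    have hwd {z : H} (hz : frameOp ψ z = (optWeights m n a : ℂ) • z) :
        ((optWeights m n b : ℂ) - optWeights m n a) * ⟪w, z⟫_ℂ = ⟪w, d z⟫_ℂ := by
      rw [hd, inner_sub_right, ← inner_frameOp_left, hw, hz, inner_smul_left, inner_smul_right,
        Complex.conj_ofReal]
      ring
    by_cases hab : optWeights m n b = optWeights m n a
    · rw [← hwd hx, hab, sub_self, zero_mul]
    · refine eq_zero_of_transpose_eigenvector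
        (p := LinearMap.ker ((frameOp ψ : H →ₗ[ℂ] H) - (optWeights m n a : ℂ) • LinearMap.id))
        (d := d) (ε := ‖f‖) (c := (optWeights m n b : ℂ) - optWeights m n a)
        ?_ hdf ?_ (norm_nonneg f) ?_ ?_
      · intro z hz
        rw [LinearMap.mem_ker] at hz ⊢
        exact sub_eq_zero.2 (hinv (sub_eq_zero.1 hz))
      · rw [← Complex.ofReal_sub, Complex.norm_real, Real.norm_eq_abs]
        exact hf.trans_le (hgap b a hab)
      · intro z hz
        exact hwd (sub_eq_zero.1 hz)
      · exact sub_eq_zero.2 (hinv hx)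
  have hop : frameOp ψ = frameOp ψ' := by
    ext x
    have h1 : ∑ a, frameProj (unitFrame m n ψ) a x = x := by
      rw [← sum_apply, (isResolution_frameProj hu).sum, one_apply_eq_self]
    have h2 : d x = 0 := by
      rw [← h1, map_sum]
      exact Finset.sum_eq_zero fun a _ => hzero a (frameOp_frameProj hm hn h a x)
    exact (sub_eq_zero.1 h2).symm
  rw [momentumLeft_eq_of_frameOp_eq hm hn h h' hop, ← sub_eq_zero, sub_add_cancel_left,
    neg_eq_zero] at hL
  exact hL

end Rigidity

/-! ### Slice charts from parametrizations and from submersions -/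

section SliceConstruction

variable {V E W : Type*} [NormedAddCommGroup V] [NormedSpace ℝ V] [NormedAddCommGroup E]
  [NormedSpace ℝ E] [NormedAddCommGroup W] [NormedSpace ℝ W]

/-- The chart is the local inverse of Θ. -/
theorem SliceChart.exists_of_param [CompleteSpace (E × W)] {A : Set V} {U : Set (E × W)}
    (hU : IsOpen U) {Θ : E × W → V} (hΘ : ContDiffOn ℝ ∞ Θ U) {a : E × W} (ha : a ∈ U)
    (e : (E × W) ≃L[ℝ] V) (he : HasFDerivAt Θ (e : (E × W) →L[ℝ] V) a)
    (hA : ∀ p ∈ U, Θ p ∈ A ↔ p.2 = 0) :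
    ∃ c : SliceChart A E W, Θ a ∈ c.toOpenPartialHomeomorph.source ∧
      c.toOpenPartialHomeomorph (Θ a) = a ∧ ∀ y, c.param y = Θ (y, 0) := by
  obtain ⟨Φ, haΦ, hΦU, hΦ, h1, h2⟩ := exists_openPartialHomeomorph_contDiffOn hU hΘ ha e he
  refine ⟨⟨e, Φ.symm, h2, h1, fun x hx => ?_⟩, ?_, ?_, fun y => hΦ _⟩
  · rw [← hA _ (hΦU (Φ.map_target hx)), ← hΦ, Φ.right_inv hx]
  · rw [← hΦ]
    exact Φ.map_source haΦ
  · rw [← hΦ]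
    exact Φ.left_inv haΦ

/-- The rearrangement of a triple product. -/
def prodRightComm (E F G : Type*) [NormedAddCommGroup E] [NormedSpace ℝ E] [NormedAddCommGroup F]
    [NormedSpace ℝ F] [NormedAddCommGroup G] [NormedSpace ℝ G] :
    ((E × F) × G) ≃L[ℝ] (E × G) × F :=
  ContinuousLinearEquiv.equivOfInverse
    ((((ContinuousLinearMap.fst ℝ E F).comp (ContinuousLinearMap.fst ℝ (E × F) G)).prod
      (ContinuousLinearMap.snd ℝ (E × F) G)).prod
      ((ContinuousLinearMap.snd ℝ E F).comp (ContinuousLinearMap.fst ℝ (E × F) G)))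
    ((((ContinuousLinearMap.fst ℝ E G).comp (ContinuousLinearMap.fst ℝ (E × G) F)).prod
      (ContinuousLinearMap.snd ℝ (E × G) F)).prod
      ((ContinuousLinearMap.snd ℝ E G).comp (ContinuousLinearMap.fst ℝ (E × G) F)))
    (fun _ => rfl) (fun _ => rfl)

/-- Adjoining to f the projection onto the kernel of its derivative makes it a local diffeomorphism;
the kernel becomes an additional coordinate along the slice. -/
theorem SliceChart.exists_of_submersion [CompleteSpace V] {A : Set V} {U : Set V}
    (hU : IsOpen U) {f : V → E × W} (hf : ContDiffOn ℝ ∞ f U) {a : V} (ha : a ∈ U)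
    {R : V →L[ℝ] E × W} (hR : HasFDerivAt f R a) {s : E × W →L[ℝ] V}
    (hs : Function.RightInverse s R) (hA : ∀ x ∈ U, x ∈ A ↔ (f x).2 = 0) :
    ∃ c : SliceChart A (E × R.ker) W, a ∈ c.toOpenPartialHomeomorph.source ∧
      ∀ x, (c.toOpenPartialHomeomorph x).1.1 = (f x).1 := by
  let e := (ContinuousLinearEquiv.equivOfRightInverse R s hs).trans (prodRightComm E W R.ker)
  let π := R.projKerOfRightInverse s hs
  obtain ⟨Φ, haΦ, hΦU, hΦ, h1, h2⟩ := exists_openPartialHomeomorph_contDiffOn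
    (f := fun x => prodRightComm E W R.ker (f x, π x)) hU
    ((prodRightComm E W R.ker).contDiff.comp_contDiffOn (hf.prodMk π.contDiff.contDiffOn)) ha e
    ((prodRightComm E W R.ker).hasFDerivAt.comp a (hR.prodMk π.hasFDerivAt))
  refine ⟨⟨e.symm, Φ, h1, h2, fun x hx => ?_⟩, haΦ, fun x => ?_⟩
  · rw [hΦ, hA x (hΦU hx)]
    rfl
  · change (Φ x).1.1 = _
    rw [hΦ]
    rfl

/-- A slice chart for an action that is transversal, at `f`, to the annihilator of the range of the
projection `T`. -/
theorem SliceChart.exists_of_projection {D : Type*} [NormedAddCommGroup D] [NormedSpace ℝ D]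
    [CompleteSpace D] {T : D →L[ℝ] D} (hTT : ∀ X, T (T X) = T X) {F : D →L[ℝ] D →L[ℝ] ℝ}
    (hinj : ∀ X, T X = X → (∀ Y, T Y = Y → F X Y = 0) → X = 0)
    (hsurj : ∀ g : D →L[ℝ] ℝ, ∃ X, T X = X ∧ ∀ Y, T Y = Y → F X Y = g Y)
    {act : D × (D →L[ℝ] ℝ) → D →L[ℝ] ℝ} (hact : ContDiff ℝ ∞ act) {f : D →L[ℝ] ℝ}
    {L₀ : D × (D →L[ℝ] ℝ) →L[ℝ] D →L[ℝ] ℝ} (hd : HasFDerivAt act L₀ (0, f))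
    (hL₀ : ∀ p, L₀ p = F p.1 + p.2) {A : Set (D →L[ℝ] ℝ)} {ε : ℝ} (hε : 0 < ε)
    (hA : ∀ X g, (∀ Y, T Y = Y → g Y = 0) → ‖g‖ < ε → (act (X, f + g) ∈ A ↔ g = 0)) :
    ∃ c : SliceChart A (T - ContinuousLinearMap.id ℝ D).ker
        ((ContinuousLinearMap.compL ℝ D D ℝ).flip T).ker,
      act (0, f) ∈ c.toOpenPartialHomeomorph.source ∧
      c.toOpenPartialHomeomorph (act (0, f)) = 0 ∧ ∀ y, c.param y = act (y.1, f) := by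
  set 𝔪 : Submodule ℝ D := (T - ContinuousLinearMap.id ℝ D).ker
  set 𝔫 : Submodule ℝ (D →L[ℝ] ℝ) := ((ContinuousLinearMap.compL ℝ D D ℝ).flip T).ker
  have hmem (X) : X ∈ 𝔪 ↔ T X = X := by
    rw [← sub_eq_zero]
    exact Iff.rfl
  have hmem' (g) : g ∈ 𝔫 ↔ ∀ X, T X = X → g X = 0 := by
    refine ⟨fun hg X hX => ?_, fun hg => ContinuousLinearMap.ext fun X => hg _ (hTT X)⟩
    have h1 : g (T X) = 0 := DFunLike.congr_fun hg X
    rwa [hX] at h1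
  have h𝔪 : CompleteSpace 𝔪 := ContinuousLinearMap.completeSpace_ker _
  have h𝔫 : CompleteSpace 𝔫 := ContinuousLinearMap.completeSpace_ker _
  clear_value 𝔪 𝔫
  let ι : 𝔪 × 𝔫 →L[ℝ] D × (D →L[ℝ] ℝ) := 𝔪.subtypeL.prodMap 𝔫.subtypeL
  let L : 𝔪 × 𝔫 →L[ℝ] D →L[ℝ] ℝ := L₀.comp ι
  have hL (p) : L p = F p.1.1 + p.2.1 := hL₀ _
  have hLker : L.ker = ⊥ := by
    rw [LinearMap.ker_eq_bot']
    rintro ⟨X, g⟩ hXg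
    replace hXg : F X.1 + g.1 = 0 := (hL (X, g)).symm.trans hXg
    have h1 : X.1 = 0 := by
      refine hinj X.1 ((hmem _).1 X.2) fun Y hY => ?_
      have h2 := DFunLike.congr_fun hXg Y
      rwa [add_apply, (hmem' _).1 g.2 Y hY, add_zero] at h2
    rw [h1, map_zero, zero_add] at hXg
    exact Prod.ext (Subtype.ext h1) (Subtype.ext hXg)
  -- X is chosen so that F X agrees with g on 𝔪; the remainder g - F X annihilates 𝔪.
  have hLrange : L.range = ⊤ := by
    rw [LinearMap.range_eq_top]
    intro g
    obtain ⟨X, hX, hXg⟩ := hsurj g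
    refine ⟨(⟨X, (hmem X).2 hX⟩, ⟨g - F X, (hmem' _).2 fun Y hY => ?_⟩), ?_⟩
    · rw [sub_apply, hXg Y hY, sub_self]
    · refine (hL _).trans ?_
      exact add_sub_cancel _ _
  let j : 𝔪 × 𝔫 → D × (D →L[ℝ] ℝ) := fun p => ι p + (0, f)
  have hj : ContDiff ℝ ∞ j := ι.contDiff.add contDiff_const
  have hjd : HasFDerivAt j ι 0 := ι.hasFDerivAt.add_const _
  have hj0 : j 0 = (0, f) := by simp only [j, map_zero, zero_add]
  have hjp (p) : j p = (p.1.1, f + p.2.1) :=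
    Prod.ext (add_zero _) (add_comm _ _)
  have he : HasFDerivAt (act ∘ j)
      (ContinuousLinearEquiv.ofBijective L hLker hLrange : 𝔪 × 𝔫 →L[ℝ] D →L[ℝ] ℝ) 0 := by
    rw [ContinuousLinearEquiv.coe_ofBijective]
    rw [← hj0] at hd
    exact hd.comp 0 hjd
  obtain ⟨c, hc1, hc2, hc3⟩ := SliceChart.exists_of_param (A := A)
    (U := {p : 𝔪 × 𝔫 | ‖p.2‖ < ε}) (isOpen_lt (by fun_prop) continuous_const)
    (hact.comp hj).contDiffOn (a := 0) (by simpa using hε) _ he fun p hp => by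
      rw [Function.comp_apply, hjp, hA _ _ ((hmem' _).1 p.2.2) hp]
      exact ZeroMemClass.coe_eq_zero
  rw [Function.comp_apply, hj0] at hc1 hc2
  refine ⟨c, hc1, hc2, fun y => ?_⟩
  rw [hc3, Function.comp_apply, hjp]
  simp

/-- A slice chart for a level set of `f₂`, in which the map `f₁` is a projection. -/
theorem SliceChart.exists_of_submersion_prod [CompleteSpace V] {A : Set V} {U : Set V}
    (hU : IsOpen U) {f₁ : V → E} {f₂ : V → W} (hf₁ : ContDiffOn ℝ ∞ f₁ U)
    (hf₂ : ContDiffOn ℝ ∞ f₂ U) {a : V} (ha : a ∈ U) {R₁ : V →L[ℝ] E} {R₂ : V →L[ℝ] W}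
    (hR₁ : HasFDerivAt f₁ R₁ a) (hR₂ : HasFDerivAt f₂ R₂ a) {s₁ : E →L[ℝ] V} {s₂ : W →L[ℝ] V}
    (h₁₁ : ∀ x, R₁ (s₁ x) = x) (h₂₁ : ∀ x, R₂ (s₁ x) = 0) (h₂₂ : ∀ w, R₂ (s₂ w) = w)
    (hA : ∀ x ∈ U, x ∈ A ↔ f₂ x = 0) :
    ∃ c : SliceChart A (E × (R₁.prod R₂).ker) W, a ∈ c.toOpenPartialHomeomorph.source ∧
      ∀ x, (c.toOpenPartialHomeomorph x).1.1 = f₁ x :=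
  SliceChart.exists_of_submersion hU (hf₁.prodMk hf₂) ha (hR₁.prodMk hR₂)
    -- R₂ vanishes on the range of s₁, so the derivative is block triangular: the right inverse
    -- corrects s₂ by the amount R₁ sees of it.
    (s := (s₁.comp (ContinuousLinearMap.fst ℝ E W - (R₁.comp s₂).comp
      (ContinuousLinearMap.snd ℝ E W))) + s₂.comp (ContinuousLinearMap.snd ℝ E W))
    (fun p => by
      refine Prod.ext ?_ ?_
      · change R₁ (s₁ (p.1 - R₁ (s₂ p.2)) + s₂ p.2) = p.1
        rw [map_add, h₁₁, sub_add_cancel]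
      · change R₂ (s₁ (p.1 - R₁ (s₂ p.2)) + s₂ p.2) = p.2
        rw [map_add, h₂₁, h₂₂, zero_add]) hA

end SliceConstruction

/-! ### The slice chart of the orbit -/

section OrbitChart

variable {H : Type u} [NormedAddCommGroup H] [InnerProductSpace ℂ H] [CompleteSpace H]
  {M N : ℕ} {m : Fin M → ℝ} {n : Fin N → ℝ}

/-- The infinitesimal coadjoint action at `f` as a continuous linear map. -/
def coadjointFieldL (f : SkewCompactDual H) : SkewCompact H →L[ℝ] SkewCompactDual H :=
  (ContinuousLinearMap.compL ℝ (SkewCompact H) (SkewCompact H) ℝ f).comp (conjCayleyDeriv (H := H))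

lemma coadjointFieldL_apply (f : SkewCompactDual H) (X : SkewCompact H) :
    coadjointFieldL f X = coadjointField X f := by
  ext Z
  change f (conjCayleyDeriv X Z) = _
  rw [conjCayleyDeriv_apply, neg_apply, map_neg, coadjointField_apply]

lemma cayley_zero : cayley (0 : SkewCompact H) = 1 := by
  apply Subtype.ext
  apply Subtype.ext
  rw [coe_cayley]
  exact cayleyOp_zero

/-- A subspace `𝔪` of the Lie algebra on which the Kirillov–Kostant–Souriau form at `f` is
strongly nondegenerate, and which represents all tangent vectors at `f`. -/
structure IsTransversal (f : SkewCompactDual H) (𝔪 : Submodule ℝ (SkewCompact H)) : Prop where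
  exists_eq (Y : SkewCompact H) : ∃ X : 𝔪, coadjointField X.1 f = coadjointField Y f
  eq_zero (X : 𝔪) : (∀ Y : 𝔪, f (bracket X.1 Y.1) = 0) → X = 0
  exists_dual (l : 𝔪 →L[ℝ] ℝ) : ∃ X : 𝔪, ∀ Y : 𝔪, f (bracket X.1 Y.1) = l Y

/-- `exists_transversal` makes the derivative of (X, g) ↦ Ad*(Cayley X)(f + g) invertible, and the
rigidity statement identifies the orbit with g = 0; invariance of the orbit removes Cayley X. -/
theorem exists_sliceChart_orbitSet (hm : ∀ i, 0 < m i) (hn : ∀ j, 0 < n j) {ψ : TensorSpace H M N}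
    (h : momentumRight ψ = weight m n) :
    ∃ (𝔪 : Submodule ℝ (SkewCompact H)) (𝔫 : Submodule ℝ (SkewCompactDual H)),
      CompleteSpace 𝔪 ∧ IsTransversal (momentumLeft ψ) 𝔪 ∧
      ∃ c : SliceChart (orbitSet H m n) 𝔪 𝔫,
        momentumLeft ψ ∈ c.toOpenPartialHomeomorph.source ∧
        c.toOpenPartialHomeomorph (momentumLeft ψ) = 0 ∧
        ∀ y, c.param y = coadjointAction (cayley y.1) (momentumLeft ψ) := by
  obtain ⟨T, hTT, htan, hinj, hsurj, hmix⟩ := exists_transversal hm hn h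
  obtain ⟨ε, hε, hrig⟩ := exists_pos_forall_annihilator_eq_zero hm hn h
  have hmem (X) : X ∈ (T - ContinuousLinearMap.id ℝ (SkewCompact H)).ker ↔ T X = X := by
    rw [← sub_eq_zero]
    exact Iff.rfl
  have hF (X Y) : coadjointFieldL (momentumLeft ψ) X Y = -momentumLeft ψ (bracket X Y) := by
    rw [coadjointFieldL_apply, coadjointField_apply]

  let L₀ : SkewCompact H × SkewCompactDual H →L[ℝ] SkewCompactDual H :=
    (coadjointFieldL (momentumLeft ψ)).comp (ContinuousLinearMap.fst ℝ _ _) +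
      ContinuousLinearMap.snd ℝ _ _
  have hL₀ (p) : L₀ p = coadjointFieldL (momentumLeft ψ) p.1 + p.2 := rfl
  have hd := hasFDerivAt_coadjointAction_cayley (momentumLeft ψ) (L := L₀) fun p => by
    rw [hL₀, coadjointFieldL_apply]
  have hinj' (X : SkewCompact H) (hX : T X = X)
      (h0 : ∀ Y, T Y = Y → coadjointFieldL (momentumLeft ψ) X Y = 0) : X = 0 :=
    hinj X hX fun Y hY => neg_eq_zero.1 ((hF X Y).symm.trans (h0 Y hY))
  have hsurj' (g : SkewCompactDual H) :
      ∃ X, T X = X ∧ ∀ Y, T Y = Y → coadjointFieldL (momentumLeft ψ) X Y = g Y := by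
    obtain ⟨X, hX, hg⟩ := hsurj (-g)
    refine ⟨X, hX, fun Y hY => ?_⟩
    rw [hF, hg Y hY, neg_apply, neg_neg]
  have hO (X : SkewCompact H) (g : SkewCompactDual H) (hg : ∀ Y, T Y = Y → g Y = 0)
      (hgε : ‖g‖ < ε) :
      coadjointAction (cayley X) (momentumLeft ψ + g) ∈ orbitSet H m n ↔ g = 0 := by
    constructor
    · intro hO
      have h1 := coadjointAction_mem_orbitSet hm hn (cayley X)⁻¹ hO
      rw [coadjointAction_inv_self] at h1
      exact hrig g hgε (fun x y a b hx hy hab => hg _ (hmix x y a b hx hy hab)) h1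
    · intro h0
      refine coadjointAction_mem_orbitSet hm hn _ ?_
      rw [h0, add_zero]
      exact (mem_orbitSet_iff hm hn _).2 ⟨ψ, h, rfl⟩
  have h0 : coadjointAction (cayley 0) (momentumLeft ψ) = momentumLeft ψ := by
    rw [cayley_zero, coadjointAction_one]
  have hc : ∃ c : SliceChart (orbitSet H m n) (T - ContinuousLinearMap.id ℝ (SkewCompact H)).ker
        ((ContinuousLinearMap.compL ℝ (SkewCompact H) (SkewCompact H) ℝ).flip T).ker,
      momentumLeft ψ ∈ c.toOpenPartialHomeomorph.source ∧
      c.toOpenPartialHomeomorph (momentumLeft ψ) = 0 ∧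
      ∀ y, c.param y = coadjointAction (cayley y.1) (momentumLeft ψ) := by
    have hc := SliceChart.exists_of_projection hTT hinj' hsurj'
      (act := fun p => coadjointAction (cayley p.1) p.2) contDiff_coadjointAction_cayley hd hL₀
      (A := orbitSet H m n) hε hO
    simp only [h0] at hc
    exact hc

  obtain ⟨c, hc1, hc2, hc3⟩ := hc
  refine ⟨_, _, ContinuousLinearMap.completeSpace_ker _,
    ⟨fun Y => ⟨⟨T Y, (hmem _).2 (hTT Y)⟩, htan Y⟩, fun X hX => ?_, fun l => ?_⟩,
    c, hc1, hc2, hc3⟩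
  · exact Subtype.ext (hinj X.1 ((hmem _).1 X.2) fun Y hY => hX ⟨Y, (hmem Y).2 hY⟩)
  · obtain ⟨X, hX, hXl⟩ := hsurj (l.comp (T.codRestrict _ fun Y => (hmem _).2 (hTT Y)))
    refine ⟨⟨X, (hmem X).2 hX⟩, fun Y => (hXl Y.1 ((hmem _).1 Y.2)).trans ?_⟩
    exact congrArg l (Subtype.ext ((hmem _).1 Y.2))

end OrbitChart

/-! ### The slice chart of the level set -/

section Fibration

variable {V E W : Type*} [NormedAddCommGroup V] [NormedSpace ℝ V] [NormedAddCommGroup E]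
  [NormedSpace ℝ E] [NormedAddCommGroup W] [NormedSpace ℝ W]

/-- Differentiate the identity "first chart coordinate after parametrization is the identity". -/
lemma SliceChart.exists_hasFDerivAt_fst {A : Set V} (c : SliceChart A E W) {y : E}
    (hy : y ∈ c.dom) {L : E →L[ℝ] V} (hL : HasFDerivAt c.param L y) :
    ∃ D : V →L[ℝ] E, HasFDerivAt (fun x => (c.toOpenPartialHomeomorph x).1) D (c.param y) ∧
      ∀ X, D (L X) = X := by
  have h1 : ContDiffOn ℝ ∞ (fun x => (c.toOpenPartialHomeomorph x).1)
      c.toOpenPartialHomeomorph.source := contDiff_fst.comp_contDiffOn c.contDiffOn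
  have h2 := ((h1.contDiffAt (c.toOpenPartialHomeomorph.open_source.mem_nhds
    (c.param_mem_source hy))).differentiableAt (by simp)).hasFDerivAt
  refine ⟨_, h2, fun X => ?_⟩
  have h3 : HasFDerivAt ((fun x => (c.toOpenPartialHomeomorph x).1) ∘ c.param)
      (ContinuousLinearMap.id ℝ E) y := by
    refine (hasFDerivAt_id y).congr_of_eventuallyEq ?_
    filter_upwards [c.isOpen_dom.mem_nhds hy] with z hz
    exact congrArg Prod.fst (c.apply_param hz)
  exact DFunLike.congr_fun ((h2.comp y hL).unique h3) X

/-- A slice chart for a level set `A` of `g`, in which the map `J` to the set `B` with the slice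
chart `c` is a projection. -/
theorem SliceChart.exists_of_comp {B : Set V} (c : SliceChart B E W) {S G : Type*}
    [NormedAddCommGroup S] [NormedSpace ℝ S] [CompleteSpace S] [NormedAddCommGroup G]
    [NormedSpace ℝ G] {A : Set S} {J : S → V} (hJ : ContDiff ℝ ∞ J) {g : S → G}
    (hg : ContDiff ℝ ∞ g) (hA : ∀ x, x ∈ A ↔ g x = 0) {a : S} {y : E} (hy : y ∈ c.dom)
    (hay : c.param y = J a) {L : E →L[ℝ] V} (hL : HasFDerivAt c.param L y) {R : S →L[ℝ] G}
    (hR : HasFDerivAt g R a) {s₁ : E →L[ℝ] S} {s₂ : G →L[ℝ] S}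
    (h₁₁ : ∀ X, fderiv ℝ J a (s₁ X) = L X) (h₂₁ : ∀ X, R (s₁ X) = 0) (h₂₂ : ∀ w, R (s₂ w) = w) :
    ∃ (k : Submodule ℝ S), CompleteSpace k ∧ ∃ c' : SliceChart A (E × k) G,
      a ∈ c'.toOpenPartialHomeomorph.source ∧
      ∀ x, (c'.toOpenPartialHomeomorph x).1.1 = (c.toOpenPartialHomeomorph (J x)).1 := by
  obtain ⟨D, hD, hDL⟩ := c.exists_hasFDerivAt_fst hy hL
  rw [hay] at hD
  have ha := c.param_mem_source hy
  rw [hay] at ha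
  have h1 : ContDiffOn ℝ ∞ (fun x => (c.toOpenPartialHomeomorph x).1)
      c.toOpenPartialHomeomorph.source := contDiff_fst.comp_contDiffOn c.contDiffOn
  obtain ⟨c', hc'1, hc'2⟩ := SliceChart.exists_of_submersion_prod (A := A)
    (c.toOpenPartialHomeomorph.open_source.preimage hJ.continuous)
    (h1.comp hJ.contDiffOn fun _ hx => hx) hg.contDiffOn (a := a) ha
    (hD.comp a (hJ.differentiable (by simp) a).hasFDerivAt) hR (s₁ := s₁) (s₂ := s₂)
    (fun X => by rw [ContinuousLinearMap.comp_apply, h₁₁, hDL]) h₂₁ h₂₂ fun x _ => hA x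
  exact ⟨_, ContinuousLinearMap.completeSpace_ker _, c', hc'1, hc'2⟩

end Fibration

/-! ### Hermitian kernels, the target of the equations of the level set -/

section Hermitian

variable (K : Type*) [Fintype K]

/-- The hermitian kernels on a finite set. -/
def hermitianKernels : Submodule ℝ (K → K → ℂ) where
  carrier := {B | ∀ j k, (starRingEnd ℂ) (B k j) = B j k}
  zero_mem' := fun _ _ => map_zero _
  add_mem' := fun hA hB j k => by
    rw [Pi.add_apply, Pi.add_apply, map_add, hA, hB]
    rfl
  smul_mem' := fun c B hB j k => by
    rw [Pi.smul_apply, Pi.smul_apply, Complex.real_smul, map_mul, Complex.conj_ofReal, hB]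
    rfl

/-- The hermitian part of a kernel. -/
def hermitianPart : (K → K → ℂ) →L[ℝ] hermitianKernels K :=
  LinearMap.toContinuousLinearMap
    { toFun := fun B => ⟨fun j k => 2⁻¹ * (B j k + (starRingEnd ℂ) (B k j)), fun j k => by
        simp only [map_mul, map_inv₀, Complex.conj_ofNat, map_add, Complex.conj_conj]
        ring⟩
      map_add' := fun A B => by
        ext j k
        simp only [Pi.add_apply, map_add, Submodule.coe_add]
        ring
      map_smul' := fun c B => by
        ext j k
        simp only [Pi.smul_apply, Complex.real_smul, map_mul, Complex.conj_ofReal,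
          Submodule.coe_smul, RingHom.id_apply]
        ring }

variable {K}

lemma hermitianPart_apply (B : K → K → ℂ) (j k : K) :
    (hermitianPart K B).1 j k = 2⁻¹ * (B j k + (starRingEnd ℂ) (B k j)) := rfl

lemma hermitianPart_of_mem {B : K → K → ℂ} (hB : ∀ j k, (starRingEnd ℂ) (B k j) = B j k) :
    (hermitianPart K B).1 = B := by
  ext j k
  rw [hermitianPart_apply, hB]
  ring

end Hermitian

/-! ### The Gram matrix as a submersion at the points of the level set -/

section Gram

variable {H : Type u} [NormedAddCommGroup H] [InnerProductSpace ℂ H]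
  {M N : ℕ} {m : Fin M → ℝ} {n : Fin N → ℝ}

/-- The matrix of inner products. -/
def gram (ψ : TensorSpace H M N) (j k : Fin M ⊕ Fin N) : ℂ := ⟪ψ j, ψ k⟫_ℂ

/-- The derivative of the matrix of inner products. -/
def gramDeriv (ψ : TensorSpace H M N) :
    TensorSpace H M N →L[ℝ] Fin M ⊕ Fin N → Fin M ⊕ Fin N → ℂ :=
  ContinuousLinearMap.pi fun j => ContinuousLinearMap.pi fun k =>
    (fderivInnerCLM ℂ (ψ j, ψ k)).comp
      ((PiLp.proj (𝕜 := ℝ) 2 (fun _ : Fin M ⊕ Fin N => H) j).prod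
        (PiLp.proj (𝕜 := ℝ) 2 (fun _ : Fin M ⊕ Fin N => H) k))

lemma gramDeriv_apply (ψ ξ : TensorSpace H M N) (j k : Fin M ⊕ Fin N) :
    gramDeriv ψ ξ j k = ⟪ψ j, ξ k⟫_ℂ + ⟪ξ j, ψ k⟫_ℂ := rfl

lemma hasFDerivAt_gram (ψ : TensorSpace H M N) : HasFDerivAt gram (gramDeriv ψ) ψ := by
  rw [hasFDerivAt_pi']
  intro j
  rw [hasFDerivAt_pi']
  intro k
  exact ((PiLp.proj (𝕜 := ℝ) 2 (fun _ : Fin M ⊕ Fin N => H) j).hasFDerivAt).inner ℂ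
    ((PiLp.proj (𝕜 := ℝ) 2 (fun _ : Fin M ⊕ Fin N => H) k).hasFDerivAt)

lemma contDiff_gram : ContDiff ℝ ∞ (gram : TensorSpace H M N → _) := by
  rw [contDiff_pi]
  intro j
  rw [contDiff_pi]
  intro k
  exact ((PiLp.proj (𝕜 := ℝ) 2 (fun _ : Fin M ⊕ Fin N => H) j).contDiff).inner ℂ
    ((PiLp.proj (𝕜 := ℝ) 2 (fun _ : Fin M ⊕ Fin N => H) k).contDiff)

/-- The matrix of inner products of the points of the level set. -/
def levelGram (m : Fin M → ℝ) (n : Fin N → ℝ) (j k : Fin M ⊕ Fin N) : ℂ :=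
  if j = k then normSqs m n k else 0

/-- The map whose zero set is the level set. -/
def gramDefect (m : Fin M → ℝ) (n : Fin N → ℝ) (ψ : TensorSpace H M N) :
    hermitianKernels (Fin M ⊕ Fin N) :=
  hermitianPart _ (gram ψ - levelGram m n)

/-- The Gram matrix is already hermitian, so taking the hermitian part loses nothing; it is taken to
land in a space onto which the derivative is surjective. -/
lemma momentumRight_eq_iff_gramDefect (ψ : TensorSpace H M N) :
    momentumRight ψ = weight m n ↔ gramDefect m n ψ = 0 := by
  have h1 : (gramDefect m n ψ).1 = gram ψ - levelGram m n := by
    refine hermitianPart_of_mem fun j k => ?_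
    rw [Pi.sub_apply, Pi.sub_apply, map_sub, gram, inner_conj_symm, levelGram]
    congr 1
    rw [levelGram]
    by_cases hjk : j = k
    · simp [hjk]
    · simp [hjk, Ne.symm hjk]
  rw [momentumRight_eq_weight_iff, Subtype.ext_iff, h1, Submodule.coe_zero, sub_eq_zero,
    funext_iff]
  exact forall_congr' fun j => funext_iff.symm

lemma contDiff_gramDefect : ContDiff ℝ ∞ (gramDefect m n : TensorSpace H M N → _) :=
  (hermitianPart (Fin M ⊕ Fin N)).contDiff.comp
    (f := fun ψ : TensorSpace H M N => gram ψ - levelGram m n) (contDiff_gram.sub contDiff_const)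

lemma hasFDerivAt_gramDefect (ψ : TensorSpace H M N) :
    HasFDerivAt (gramDefect m n) ((hermitianPart _).comp (gramDeriv ψ)) ψ :=
  (hermitianPart _).hasFDerivAt.comp ψ ((hasFDerivAt_gram ψ).sub_const _)

/-- A right inverse of the derivative of `gramDefect` at a point of the level set. -/
def gramSection (m : Fin M → ℝ) (n : Fin N → ℝ) (ψ : TensorSpace H M N) :
    hermitianKernels (Fin M ⊕ Fin N) →L[ℝ] TensorSpace H M N :=
  LinearMap.toContinuousLinearMap
    { toFun := fun B => rightMul ψ fun j k => (2 * (normSqs m n j : ℂ))⁻¹ * B.1 j k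
      map_add' := fun A B => by
        ext k
        simp [rightMul, mul_add, add_smul, Finset.sum_add_distrib]
      map_smul' := fun c B => by
        ext k
        simp only [rightMul, Submodule.coe_smul, Pi.smul_apply, RingHom.id_apply, PiLp.smul_apply,
          Finset.smul_sum, ← Complex.coe_smul, smul_smul]
        exact Finset.sum_congr rfl fun j _ => by congr 1; ring }

/-- The displacement is a combination of the frame vectors scaled by 1 / (2 × squared norm), so that
each of the two terms of the derivative contributes half of B. -/
lemma gramDeriv_gramSection (hm : ∀ i, 0 < m i) (hn : ∀ j, 0 < n j) {ψ : TensorSpace H M N}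
    (h : momentumRight ψ = weight m n) (B : hermitianKernels (Fin M ⊕ Fin N)) :
    hermitianPart _ (gramDeriv ψ (gramSection m n ψ B)) = B := by
  have h1 (j k) : ⟪ψ j, gramSection m n ψ B k⟫_ℂ = 2⁻¹ * B.1 j k := by
    have h2 : gramSection m n ψ B k = ∑ i, ((2 * (normSqs m n i : ℂ))⁻¹ * B.1 i k) • ψ i := rfl
    have h3 : (normSqs m n j : ℂ) ≠ 0 := by exact_mod_cast (normSqs_pos hm hn j).ne'
    rw [h2]
    simp only [inner_sum, inner_smul_right, inner_self_of_level h, mul_ite, mul_zero,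
      Finset.sum_ite_eq, Finset.mem_univ, if_true]
    field_simp
  have h2 : gramDeriv ψ (gramSection m n ψ B) = B.1 := by
    ext j k
    rw [gramDeriv_apply, h1, ← inner_conj_symm, h1, map_mul, map_inv₀, Complex.conj_ofNat, B.2]
    ring
  rw [h2]
  exact Subtype.ext (hermitianPart_of_mem B.2)

end Gram

/-! ### Charts of the level set adapted to the left momentum map -/

section LevelChart

variable {H : Type u} [NormedAddCommGroup H] [InnerProductSpace ℂ H] [CompleteSpace H]
  {M N : ℕ} {m : Fin M → ℝ} {n : Fin N → ℝ}

lemma hasFDerivAt_param_zero {A : Set (SkewCompactDual H)} {𝔪 : Submodule ℝ (SkewCompact H)}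
    {W : Type*} [NormedAddCommGroup W] [NormedSpace ℝ W] {c : SliceChart A 𝔪 W}
    {f : SkewCompactDual H} (hc : ∀ y, c.param y = coadjointAction (cayley y.1) f) :
    HasFDerivAt c.param ((coadjointFieldL f).comp 𝔪.subtypeL) 0 := by
  let L₀ : SkewCompact H × SkewCompactDual H →L[ℝ] SkewCompactDual H :=
    (coadjointFieldL f).comp (ContinuousLinearMap.fst ℝ _ _) + ContinuousLinearMap.snd ℝ _ _
  have hL₀ (p) : L₀ p = coadjointFieldL f p.1 + p.2 := rfl
  have hd := hasFDerivAt_coadjointAction_cayley f (L := L₀) fun p => by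
    rw [hL₀, coadjointFieldL_apply]
  have h1 : HasFDerivAt (fun y : 𝔪 => ((y.1, f) : SkewCompact H × SkewCompactDual H))
      (𝔪.subtypeL.prod 0) 0 := 𝔪.subtypeL.hasFDerivAt.prodMk (hasFDerivAt_const f (0 : 𝔪))
  have h2 := HasFDerivAt.comp (g := fun p : SkewCompact H × SkewCompactDual H =>
    coadjointAction (cayley p.1) p.2) (0 : 𝔪) hd h1
  have h3 : c.param = (fun p : SkewCompact H × SkewCompactDual H =>
      coadjointAction (cayley p.1) p.2) ∘ fun y : 𝔪 => (y.1, f) := funext hc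
  rw [h3]
  refine h2.congr_fderiv (ContinuousLinearMap.ext fun y => ?_)
  exact add_zero _

/-- The vectors Xψ with X in 𝔪 lift the tangent vectors of the orbit without changing the Gram
matrix, and `gramSection` solves the Gram equations, so the orbit coordinate and `gramDefect`
together are submersive at ψ. -/
theorem exists_sliceChart_levelSet (hm : ∀ i, 0 < m i) (hn : ∀ j, 0 < n j) {ψ : TensorSpace H M N}
    (h : momentumRight ψ = weight m n) {𝔪 : Submodule ℝ (SkewCompact H)} {W : Type*}
    [NormedAddCommGroup W] [NormedSpace ℝ W] {c : SliceChart (orbitSet H m n) 𝔪 W}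
    (hc1 : momentumLeft ψ ∈ c.toOpenPartialHomeomorph.source)
    (hc2 : c.toOpenPartialHomeomorph (momentumLeft ψ) = 0)
    (hc3 : ∀ y, c.param y = coadjointAction (cayley y.1) (momentumLeft ψ)) :
    ∃ (𝔨 : Submodule ℝ (TensorSpace H M N)), CompleteSpace 𝔨 ∧
      ∃ c' : SliceChart {φ : TensorSpace H M N | momentumRight φ = weight m n} (𝔪 × 𝔨)
          (hermitianKernels (Fin M ⊕ Fin N)),
        ψ ∈ c'.toOpenPartialHomeomorph.source ∧
        ∀ φ, (c'.toOpenPartialHomeomorph φ).1.1 =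
          (c.toOpenPartialHomeomorph (momentumLeft φ)).1 := by
  have hdom : (0 : 𝔪) ∈ c.dom := by
    have h1 := c.fst_mem_dom hc1 ((mem_orbitSet_iff hm hn _).2 ⟨ψ, h, rfl⟩)
    rwa [hc2] at h1
  have hparam0 : c.param 0 = momentumLeft ψ := by
    rw [hc3, Submodule.coe_zero, cayley_zero, coadjointAction_one]
  have h11 (X : 𝔪) : fderiv ℝ momentumLeft ψ
      ((((leftMulR ψ).comp (SkewCompact H).subtypeL).comp 𝔪.subtypeL) X) =
      ((coadjointFieldL (momentumLeft ψ)).comp 𝔪.subtypeL) X :=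
    (fderiv_momentumLeft_leftMul X.1 ψ).trans (coadjointFieldL_apply _ _).symm
  have h21 (X : 𝔪) : ((hermitianPart (Fin M ⊕ Fin N)).comp (gramDeriv ψ))
      ((((leftMulR ψ).comp (SkewCompact H).subtypeL).comp 𝔪.subtypeL) X) = 0 := by
    have h1 : gramDeriv ψ (leftMul X.1.1 ψ) = 0 := by
      ext j k
      rw [gramDeriv_apply, inner_leftMul_skew_add]
      rfl
    change hermitianPart _ (gramDeriv ψ (leftMul X.1.1 ψ)) = 0
    rw [h1, map_zero]
  exact c.exists_of_comp (A := {φ : TensorSpace H M N | momentumRight φ = weight m n})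
    contDiff_momentumLeft (contDiff_gramDefect (m := m) (n := n)) momentumRight_eq_iff_gramDefect
    hdom hparam0 (hasFDerivAt_param_zero hc3) (hasFDerivAt_gramDefect ψ) (s₂ := gramSection m n ψ)
    h11 h21 (gramDeriv_gramSection hm hn h)

end LevelChart

/-! ### Spaces embedded onto the orbit -/

section LevelTangent

variable {H : Type u} [NormedAddCommGroup H] [InnerProductSpace ℂ H]
  {M N : ℕ} {m : Fin M → ℝ} {n : Fin N → ℝ}

lemma gramDeriv_fderiv_eq_zero {D : Type*} [NormedAddCommGroup D] [NormedSpace ℝ D]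
    {g : D → TensorSpace H M N} {y : D} (hg : DifferentiableAt ℝ g y)
    (hlev : ∀ᶠ z in 𝓝 y, momentumRight (g z) = weight m n) (v : D) :
    gramDeriv (g y) (fderiv ℝ g y v) = 0 := by
  have h1 := (hasFDerivAt_gram (g y)).comp y hg.hasFDerivAt
  have h2 : HasFDerivAt (gram ∘ g) (0 : D →L[ℝ] Fin M ⊕ Fin N → Fin M ⊕ Fin N → ℂ) y := by
    refine (hasFDerivAt_const (levelGram m n) y).congr_of_eventuallyEq ?_
    filter_upwards [hlev] with z hz
    ext j k
    exact (momentumRight_eq_weight_iff _).1 hz j k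
  exact DFunLike.congr_fun (h1.unique h2) v

/-- Differentiating the constant Gram matrix gives the tangency equation solved by
`exists_leftMul_skew_eq`. Later, every comparison of forms is reduced to Lie algebra elements by
this. -/
lemma exists_leftMul_eq_fderiv [CompleteSpace H] (hm : ∀ i, 0 < m i) (hn : ∀ j, 0 < n j)
    {D : Type*} [NormedAddCommGroup D] [NormedSpace ℝ D] {g : D → TensorSpace H M N} {y : D}
    (hg : DifferentiableAt ℝ g y) (hlev : ∀ᶠ z in 𝓝 y, momentumRight (g z) = weight m n) (v : D) :
    ∃ X : SkewCompact H, leftMul (X : H →L[ℂ] H) (g y) = fderiv ℝ g y v :=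
  exists_leftMul_skew_eq hm hn hlev.self_of_nhds fun j k =>
    congrFun (congrFun (gramDeriv_fderiv_eq_zero hg hlev v) j) k

lemma fderiv_momentumLeft_comp [CompleteSpace H] {D : Type*} [NormedAddCommGroup D]
    [NormedSpace ℝ D] {g : D → TensorSpace H M N} {y v : D} (hg : DifferentiableAt ℝ g y)
    {X : SkewCompact H} (hX : leftMul (X : H →L[ℂ] H) (g y) = fderiv ℝ g y v) :
    fderiv ℝ (fun z => momentumLeft (g z)) y v = coadjointField X (momentumLeft (g y)) := by
  have h1 : DifferentiableAt ℝ (momentumLeft (H := H) (M := M) (N := N)) (g y) :=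
    contDiff_momentumLeft.differentiable (by simp) _
  have h2 := DFunLike.congr_fun (fderiv_comp y h1 hg) v
  refine h2.trans ?_
  rw [ContinuousLinearMap.comp_apply, ← hX]
  exact fderiv_momentumLeft_leftMul X (g y)

end LevelTangent

/-! ### Charts and symplectic form on a space embedded onto the orbit -/

section OrbitSlice

variable {H : Type u} [NormedAddCommGroup H] [InnerProductSpace ℂ H] [CompleteSpace H]
  {M N : ℕ}

/-- A slice chart of the orbit at the image of a point `ψ` of the level set, parametrized by a
transversal subspace of the Lie algebra. -/
structure OrbitSlice (m : Fin M → ℝ) (n : Fin N → ℝ) (ψ : TensorSpace H M N)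
    (𝔪 : Submodule ℝ (SkewCompact H)) (W : Type u) [NormedAddCommGroup W] [NormedSpace ℝ W] where
  pos_left : ∀ i, 0 < m i
  pos_right : ∀ j, 0 < n j
  level : momentumRight ψ = weight m n
  transversal : IsTransversal (momentumLeft ψ) 𝔪
  slice : SliceChart (orbitSet H m n) 𝔪 W
  mem_source : momentumLeft ψ ∈ slice.toOpenPartialHomeomorph.source
  apply_eq : slice.toOpenPartialHomeomorph (momentumLeft ψ) = 0
  param_eq : ∀ y, slice.param y = coadjointAction (cayley y.1) (momentumLeft ψ)

namespace OrbitSlice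

variable {m : Fin M → ℝ} {n : Fin N → ℝ} {ψ : TensorSpace H M N}
  {𝔪 : Submodule ℝ (SkewCompact H)} {W : Type u} [NormedAddCommGroup W] [NormedSpace ℝ W]
  (s : OrbitSlice m n ψ 𝔪 W)

/-- The translates of the slice chart. -/
def translate (U : UnitaryCompact H) : SliceChart (orbitSet H m n) 𝔪 W :=
  s.slice.translate (coadjointEquiv U) fun f => by
    rw [coadjointEquiv_symm_apply]
    refine ⟨fun hf => ?_, coadjointAction_mem_orbitSet s.pos_left s.pos_right _⟩
    have h1 := coadjointAction_mem_orbitSet s.pos_left s.pos_right U hf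
    rwa [coadjointAction_self_inv] at h1

/-- The lift of the parametrization of the orbit to the level set. -/
def lift (ψ : TensorSpace H M N) (𝔪 : Submodule ℝ (SkewCompact H)) (U : UnitaryCompact H) (y : 𝔪) :
    TensorSpace H M N :=
  leftMul (U : H →L[ℂ] H) (leftMul (cayley y.1 : H →L[ℂ] H) ψ)

lemma contDiff_lift (U : UnitaryCompact H) : ContDiff ℝ ∞ (lift ψ 𝔪 U) :=
  (leftMulEquiv U).contDiff.comp ((leftMulR ψ).contDiff.comp
    (contDiff_cayleyOp.comp 𝔪.subtypeL.contDiff))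

lemma momentumRight_lift (h : momentumRight ψ = weight m n) (U : UnitaryCompact H) (y : 𝔪) :
    momentumRight (lift ψ 𝔪 U y) = weight m n :=
  momentumRight_leftMul U (momentumRight_leftMul (cayley y.1) h)

/-- The parametrization factors through the level set, so the form on the orbit can be computed as a
pullback of ω along `lift`. -/
lemma param_translate (U : UnitaryCompact H) (y : 𝔪) :
    (s.translate U).param y = momentumLeft (lift ψ 𝔪 U y) := by
  rw [lift, momentumLeft_leftMul, momentumLeft_leftMul, ← s.param_eq]
  rfl

lemma fderiv_param_translate_zero (U : UnitaryCompact H) (v : 𝔪) :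
    fderiv ℝ (s.translate U).param 0 v =
      coadjointAction U (coadjointField v.1 (momentumLeft ψ)) := by
  have h1 : HasFDerivAt (s.translate U).param
      ((coadjointEquiv U : SkewCompactDual H →L[ℝ] SkewCompactDual H).comp
        ((coadjointFieldL (momentumLeft ψ)).comp 𝔪.subtypeL)) 0 :=
    (coadjointEquiv U).hasFDerivAt.comp (0 : 𝔪) (hasFDerivAt_param_zero s.param_eq)
  rw [h1.fderiv, ← coadjointFieldL_apply]
  rfl

/-- The tangent vectors of the parametrization are generated by the Lie algebra. -/
lemma exists_fderiv_param_eq (U : UnitaryCompact H) (y v : 𝔪) :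
    ∃ X : SkewCompact H, leftMul (X : H →L[ℂ] H) (lift ψ 𝔪 U y) = fderiv ℝ (lift ψ 𝔪 U) y v ∧
      fderiv ℝ (s.translate U).param y v = coadjointField X ((s.translate U).param y) := by
  have hd : DifferentiableAt ℝ (lift ψ 𝔪 U) y := (contDiff_lift U).differentiable (by simp) y
  obtain ⟨X, hX⟩ := exists_leftMul_eq_fderiv s.pos_left s.pos_right hd
    (Filter.Eventually.of_forall (momentumRight_lift s.level U)) v
  refine ⟨X, hX, ?_⟩
  rw [s.param_translate, ← fderiv_momentumLeft_comp hd hX, ← funext (s.param_translate U)]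

variable {X : Type*} [TopologicalSpace X] [Nonempty X] {j : X → SkewCompactDual H}
  (hj : IsEmbedding j) (hA : range j = orbitSet H m n) {i : X → UnitaryCompact H}
  (hi : ∀ x, j x = coadjointAction (i x) (momentumLeft ψ))

lemma symm_coadjointEquiv_apply {U : UnitaryCompact H} {f g : SkewCompactDual H}
    (h : f = coadjointAction U g) : (coadjointEquiv U).symm f = g := by
  rw [h, coadjointEquiv_symm_apply, coadjointAction_inv_self]

lemma mem_translate_source {U : UnitaryCompact H} {f : SkewCompactDual H}
    (h : f = coadjointAction U (momentumLeft ψ)) :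
    f ∈ (s.translate U).toOpenPartialHomeomorph.source := by
  rw [translate, SliceChart.translate_source, mem_preimage, symm_coadjointEquiv_apply h]
  exact s.mem_source

/-- The preferred chart at each point puts it at the origin. The tangent space there is thus 𝔪 in
the coordinates of the base point, which is why `twoForm` can be the same form on 𝔪 everywhere. -/
lemma translate_apply_eq {U : UnitaryCompact H} {f : SkewCompactDual H}
    (h : f = coadjointAction U (momentumLeft ψ)) :
    (s.translate U).toOpenPartialHomeomorph f = 0 := by
  rw [translate, SliceChart.translate_apply, symm_coadjointEquiv_apply h]
  exact s.apply_eq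

/-- The charted space structure on a space embedded onto the orbit. -/
@[reducible] def chartedSpace : ChartedSpace 𝔪 X :=
  SliceChart.chartedSpace hj hA s.translate i fun x => s.mem_translate_source (hi x)

/-- The Kirillov–Kostant–Souriau form at `momentumLeft ψ`, on the transversal subspace. -/
def form (ψ : TensorSpace H M N) (𝔪 : Submodule ℝ (SkewCompact H)) : 𝔪 [⋀^Fin 2]→L[ℝ] ℝ :=
  (skewForm (TensorSpace H M N) (halfSymplectic H M N)).compContinuousLinearMap
    (((leftMulR ψ).comp (SkewCompact H).subtypeL).comp 𝔪.subtypeL)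

lemma form_apply (v w : 𝔪) : form ψ 𝔪 ![v, w] = momentumLeft ψ (bracket v.1 w.1) := by
  rw [indefForm_bracket]
  exact skewForm_halfSymplectic _

/-- The Kirillov–Kostant–Souriau form on a space embedded onto the orbit. -/
def twoForm : letI := s.chartedSpace hj hA hi; TwoForm 𝔪 X :=
  fun _ => form ψ 𝔪

lemma isManifold : letI := s.chartedSpace hj hA hi; IsManifold 𝓘(ℝ, 𝔪) ∞ X :=
  SliceChart.isManifold hj hA s.translate i fun x => s.mem_translate_source (hi x)

lemma isSmoothEmbedding : letI := s.chartedSpace hj hA hi;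
    Manifold.IsSmoothEmbedding 𝓘(ℝ, 𝔪) 𝓘(ℝ, SkewCompactDual H) ∞ j :=
  SliceChart.isSmoothEmbedding hj hA s.translate i fun x => s.mem_translate_source (hi x)

lemma mfderiv_apply (x : X) (v : 𝔪) : letI := s.chartedSpace hj hA hi;
    mfderiv 𝓘(ℝ, 𝔪) 𝓘(ℝ, SkewCompactDual H) j x v =
      coadjointAction (i x) (coadjointField v.1 (momentumLeft ψ)) := by
  let := s.chartedSpace hj hA hi
  have h1 := SliceChart.mfderiv_eq hj hA s.translate i
    (fun x => s.mem_translate_source (hi x)) x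
  rw [s.translate_apply_eq (hi x)] at h1
  rw [← s.fderiv_param_translate_zero]
  exact DFunLike.congr_fun h1 v

lemma range_mfderiv (x : X) : letI := s.chartedSpace hj hA hi;
    range (mfderiv 𝓘(ℝ, 𝔪) 𝓘(ℝ, SkewCompactDual H) j x) =
      range fun X : SkewCompact H => coadjointField X (j x) := by
  let := s.chartedSpace hj hA hi
  apply Subset.antisymm
  · rintro _ ⟨v, rfl⟩
    refine ⟨adjointAction (i x) (v : 𝔪).1, ?_⟩
    refine Eq.trans ?_ (s.mfderiv_apply hj hA hi x v).symm
    rw [coadjointAction_coadjointField, ← hi]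
  · rintro _ ⟨Y, rfl⟩
    obtain ⟨v, hv⟩ := s.transversal.exists_eq (adjointAction (i x)⁻¹ Y)
    refine ⟨v, (s.mfderiv_apply hj hA hi x v).trans ?_⟩
    rw [hv, coadjointAction_coadjointField, ← hi, ← adjointAction_mul, mul_inv_cancel,
      adjointAction_one]

/-- Well-definedness of the Kirillov–Kostant–Souriau form: f([X, Y]) is, up to sign, the vector X •
f evaluated at Y, and likewise in the other slot. -/
lemma apply_bracket_congr {f : SkewCompactDual H} {X X' Y Y' : SkewCompact H}
    (hX : coadjointField X f = coadjointField X' f)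
    (hY : coadjointField Y f = coadjointField Y' f) :
    f (bracket X Y) = f (bracket X' Y') := by
  have h1 := DFunLike.congr_fun hX Y
  have h2 := DFunLike.congr_fun hY X'
  rw [coadjointField_apply, coadjointField_apply, neg_inj] at h1 h2
  rw [h1, bracket_swap X' Y, bracket_swap X' Y', map_neg, map_neg, h2]

/-- Invariance under the coadjoint action moves the pairing at j x back to the base point, where it
is `form`. -/
lemma twoForm_apply (x : X) (Y Z : SkewCompact H) (v w : 𝔪) :
    letI := s.chartedSpace hj hA hi;
    mfderiv 𝓘(ℝ, 𝔪) 𝓘(ℝ, SkewCompactDual H) j x v = coadjointField Y (j x) →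
    mfderiv 𝓘(ℝ, 𝔪) 𝓘(ℝ, SkewCompactDual H) j x w = coadjointField Z (j x) →
    s.twoForm hj hA hi x ![v, w] = j x (bracket Y Z) := by
  intro hv hw
  replace hv := (s.mfderiv_apply hj hA hi x v).symm.trans hv
  replace hw := (s.mfderiv_apply hj hA hi x w).symm.trans hw
  rw [coadjointAction_coadjointField, ← hi] at hv hw
  rw [← apply_bracket_congr hv hw, ← adjointAction_bracket, hi, coadjointAction,
    ContinuousLinearMap.comp_apply, ← adjointAction_mul, inv_mul_cancel, adjointAction_one]
  exact form_apply v w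

/-- A coordinate vector is generated by one Lie algebra element both on the orbit and along the
lift, so both sides equal the pairing with the bracket of these elements. -/
lemma inChart_eq (U : UnitaryCompact H) {y : 𝔪} (hy : y ∈ (s.translate U).dom) :
    letI := s.chartedSpace hj hA hi;
    (s.twoForm hj hA hi).inChart ((s.translate U).chart hj hA) y =
      pullbackForm (skewForm (TensorSpace H M N) (halfSymplectic H M N)) (lift ψ 𝔪 U) y := by
  let := s.chartedSpace hj hA hi
  have := s.isManifold hj hA hi
  set φ := (s.translate U).chart hj hA with hφ
  have hat : φ ∈ atlas 𝔪 X := mem_range_self U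
  have hφd : MDifferentiableAt 𝓘(ℝ, 𝔪) 𝓘(ℝ, 𝔪) φ.symm y :=
    mdifferentiableAt_atlas_symm hat hy
  have hjd : MDifferentiableAt 𝓘(ℝ, 𝔪) 𝓘(ℝ, SkewCompactDual H) j (φ.symm y) :=
    (s.isSmoothEmbedding hj hA hi).contMDiff.mdifferentiable (by simp) _
  have hjy : j (φ.symm y) = (s.translate U).param y :=
    (s.translate U).apply_chart_symm hj hA hy
  have key (v : 𝔪) : mfderiv 𝓘(ℝ, 𝔪) 𝓘(ℝ, SkewCompactDual H) j (φ.symm y)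
      (mfderiv 𝓘(ℝ, 𝔪) 𝓘(ℝ, 𝔪) φ.symm y v) = fderiv ℝ (s.translate U).param y v := by
    have h1 := mfderiv_comp y hjd hφd
    have h2 : mfderiv 𝓘(ℝ, 𝔪) 𝓘(ℝ, SkewCompactDual H) (j ∘ φ.symm) y =
        fderiv ℝ (s.translate U).param y := by
      rw [mfderiv_eq_fderiv]
      apply Filter.EventuallyEq.fderiv_eq
      filter_upwards [(s.translate U).isOpen_dom.mem_nhds hy] with z hz
      exact (s.translate U).apply_chart_symm hj hA hz
    exact (DFunLike.congr_fun h1 v).symm.trans (DFunLike.congr_fun h2 v)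
  ext v
  obtain ⟨Y, hY, hY'⟩ := s.exists_fderiv_param_eq U y (v 0)
  obtain ⟨Z, hZ, hZ'⟩ := s.exists_fderiv_param_eq U y (v 1)
  have h1 := s.twoForm_apply hj hA hi (φ.symm y) Y Z _ _
    ((key (v 0)).trans (by rw [hY', hjy])) ((key (v 1)).trans (by rw [hZ', hjy]))
  have h2 : pullbackForm (skewForm (TensorSpace H M N) (halfSymplectic H M N)) (lift ψ 𝔪 U) y v =
      symplecticForm (fderiv ℝ (lift ψ 𝔪 U) y (v 0)) (fderiv ℝ (lift ψ 𝔪 U) y (v 1)) :=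
    skewForm_halfSymplectic _
  rw [h2, ← hY, ← hZ, ← indefForm_bracket, ← s.param_translate, ← hjy, ← h1]
  refine congrArg (s.twoForm hj hA hi (φ.symm y)) (funext fun a => ?_)
  fin_cases a <;> rfl

/-- Smoothness and closedness come from the pullback expression in the charts; strong nondegeneracy
is that of 𝔪. -/
theorem isSymplectic : letI := s.chartedSpace hj hA hi;
    (s.twoForm hj hA hi).IsSymplectic := by
  let := s.chartedSpace hj hA hi
  refine ⟨?_, ?_, fun x v hv => ?_, fun x l => ?_⟩
  · rintro _ ⟨U, rfl⟩
    exact (contDiffOn_pullbackForm (halfSymplectic H M N) (s.translate U).isOpen_dom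
      (contDiff_lift U).contDiffOn).congr fun y hy => s.inChart_eq hj hA hi U hy
  · rintro _ ⟨U, rfl⟩ y hy
    have h1 : (s.twoForm hj hA hi).inChart ((s.translate U).chart hj hA) =ᶠ[𝓝 y]
        pullbackForm (skewForm (TensorSpace H M N) (halfSymplectic H M N)) (lift ψ 𝔪 U) := by
      filter_upwards [(s.translate U).isOpen_dom.mem_nhds hy] with z hz
      exact s.inChart_eq hj hA hi U hz
    rw [h1.extDeriv_eq]
    exact extDeriv_pullbackForm _ (contDiff_lift U).contDiffAt
  · exact s.transversal.eq_zero v fun w => (form_apply v w).symm.trans (hv w)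
  · obtain ⟨v, hv⟩ := s.transversal.exists_dual l
    exact ⟨v, fun w => (form_apply v w).trans (hv w)⟩

end OrbitSlice

end OrbitSlice

/-! ### The reduced space -/

/-- Near x, a point x' is recovered continuously from j x' as σ (j x'). -/
lemma Topology.IsInducing.of_local_sections {X Y : Type*} [TopologicalSpace X] [TopologicalSpace Y]
    {j : X → Y} (hj : Continuous j) (h : ∀ x, ∃ σ : Y → X, ContinuousAt σ (j x) ∧
      ∀ᶠ y in 𝓝 (j x), ∀ x', j x' = y → σ y = x') : IsInducing j := by
  rw [isInducing_iff_nhds]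
  refine fun x => le_antisymm hj.continuousAt.le_comap ?_
  obtain ⟨σ, hσ, hσj⟩ := h x
  have hx : σ (j x) = x := hσj.self_of_nhds x rfl
  have h1 : Filter.Tendsto (fun x' => σ (j x')) (Filter.comap j (𝓝 (j x))) (𝓝 x) := by
    have h2 : Filter.Tendsto σ (𝓝 (j x)) (𝓝 x) := by
      have h3 : Filter.Tendsto σ (𝓝 (j x)) (𝓝 (σ (j x))) := hσ
      rwa [hx] at h3
    exact h2.comp Filter.tendsto_comap
  refine Filter.tendsto_id'.1 (h1.congr' ?_)
  filter_upwards [Filter.tendsto_comap.eventually hσj] with x' hx'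
  exact hx' x' rfl

lemma toReduced_surjective {H : Type u} [NormedAddCommGroup H] [InnerProductSpace ℂ H] {M N : ℕ}
    (μ : Module.Dual ℝ (PseudoSkew M N)) (q : ReducedSpace H μ) :
    ∃ φ, toReduced μ φ = q := Quotient.exists_rep q

lemma continuous_toReduced {H : Type u} [NormedAddCommGroup H] [InnerProductSpace ℂ H] {M N : ℕ}
    (μ : Module.Dual ℝ (PseudoSkew M N)) :
    Continuous (toReduced (H := H) μ) := continuous_quotient_mk'

section Reduced

variable {H : Type u} [NormedAddCommGroup H] [InnerProductSpace ℂ H] [CompleteSpace H]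
  {M N : ℕ}

/-- The map induced by the left momentum map on the reduced space. -/
def reducedMomentum (μ : Module.Dual ℝ (PseudoSkew M N)) : ReducedSpace H μ → SkewCompactDual H :=
  Quotient.lift (fun φ : LevelSet H μ => momentumLeft φ.1) fun φ φ' h => by
    obtain ⟨U, rfl⟩ := MulAction.orbitRel_apply.1 h
    exact momentumLeft_rightMul _ _

lemma reducedMomentum_toReduced {μ : Module.Dual ℝ (PseudoSkew M N)} (φ : LevelSet H μ) :
    reducedMomentum μ (toReduced μ φ) = momentumLeft φ.1 := rfl

variable {m : Fin M → ℝ} {n : Fin N → ℝ}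

lemma reducedMomentum_injective (hm : ∀ i, 0 < m i) (hn : ∀ j, 0 < n j) :
    Function.Injective (reducedMomentum (H := H) (weight m n)) := by
  intro q q' h
  obtain ⟨φ, rfl⟩ := toReduced_surjective _ q
  obtain ⟨φ', rfl⟩ := toReduced_surjective _ q'
  exact (toReduced_eq_iff hm hn φ φ').2 h

lemma range_reducedMomentum (hm : ∀ i, 0 < m i) (hn : ∀ j, 0 < n j) :
    range (reducedMomentum (H := H) (weight m n)) = orbitSet H m n := by
  ext f
  rw [mem_orbitSet_iff hm hn]
  constructor
  · rintro ⟨q, rfl⟩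
    obtain ⟨φ, rfl⟩ := toReduced_surjective _ q
    exact ⟨φ.1, φ.2, rfl⟩
  · rintro ⟨ψ, h, rfl⟩
    exact ⟨toReduced _ ⟨ψ, h⟩, rfl⟩

lemma continuous_reducedMomentum (μ : Module.Dual ℝ (PseudoSkew M N)) :
    Continuous (reducedMomentum (H := H) μ) :=
  Continuous.quotient_lift (contDiff_momentumLeft.continuous.comp continuous_subtype_val) _

namespace OrbitSlice

variable {ψ : TensorSpace H M N} {𝔪 : Submodule ℝ (SkewCompact H)} {W : Type u}
  [NormedAddCommGroup W] [NormedSpace ℝ W]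

lemma exists_coadjointAction_eq (s : OrbitSlice m n ψ 𝔪 W) {f : SkewCompactDual H} (hf : f ∈ orbitSet H m n) :
    ∃ U, f = coadjointAction U (momentumLeft ψ) := by
  rw [orbitSet_eq_coadjointOrbit s.pos_left s.pos_right s.level] at hf
  obtain ⟨U, hU⟩ := hf
  exact ⟨U, hU.symm⟩

/-- The orbit chart followed by `lift` and the projection is a continuous local inverse, so the
quotient topology agrees with the topology induced from the dual Banach space. -/
lemma isEmbedding_reducedMomentum (s : OrbitSlice m n ψ 𝔪 W) :
    IsEmbedding (reducedMomentum (H := H) (weight m n)) := by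
  have hinj := reducedMomentum_injective (H := H) s.pos_left s.pos_right
  refine ⟨IsInducing.of_local_sections (continuous_reducedMomentum _) fun q => ?_, hinj⟩
  have hq : reducedMomentum (weight m n) q ∈ orbitSet H m n :=
    range_reducedMomentum (H := H) s.pos_left s.pos_right ▸ mem_range_self q
  obtain ⟨U, hU⟩ := s.exists_coadjointAction_eq hq
  have hsrc := s.mem_translate_source hU
  let c := s.translate U
  let p : SkewCompactDual H → 𝔪 := fun g => (c.toOpenPartialHomeomorph g).1
  refine ⟨fun g => toReduced _ ⟨lift ψ 𝔪 U (p g), momentumRight_lift s.level U _⟩, ?_, ?_⟩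
  · have h1 : ContinuousAt p (reducedMomentum (weight m n) q) :=
      continuous_fst.continuousAt.comp (c.toOpenPartialHomeomorph.continuousAt hsrc)
    have h2 : Continuous fun y : 𝔪 =>
        (⟨lift ψ 𝔪 U y, momentumRight_lift s.level U y⟩ : LevelSet H (weight m n)) :=
      (contDiff_lift U).continuous.subtype_mk _
    exact ((continuous_toReduced _).comp h2).continuousAt.comp h1
  · filter_upwards [c.toOpenPartialHomeomorph.open_source.mem_nhds hsrc] with g hg q' hq'
    refine hinj ?_
    rw [reducedMomentum_toReduced, hq']
    refine (s.param_translate U _).symm.trans (c.param_fst hg ?_)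
    rw [← hq', ← range_reducedMomentum (H := H) s.pos_left s.pos_right]
    exact mem_range_self q'

end OrbitSlice

end Reduced

/-! ### Two spaces embedded onto the same orbit are symplectomorphic -/

section Comparison

variable {H : Type u} [NormedAddCommGroup H] [InnerProductSpace ℂ H] [CompleteSpace H]
  {M N : ℕ} {m : Fin M → ℝ} {n : Fin N → ℝ}
  {ψ : TensorSpace H M N} {𝔪 : Submodule ℝ (SkewCompact H)} {W : Type u}
  [NormedAddCommGroup W] [NormedSpace ℝ W] (s : OrbitSlice m n ψ 𝔪 W)
  {X Y : Type*} [TopologicalSpace X] [Nonempty X] [TopologicalSpace Y] [Nonempty Y]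
  {j : X → SkewCompactDual H} {j' : Y → SkewCompactDual H}
  (hj : IsEmbedding j) (hA : range j = orbitSet H m n) {i : X → UnitaryCompact H}
  (hi : ∀ x, j x = coadjointAction (i x) (momentumLeft ψ))
  (hj' : IsEmbedding j') (hA' : range j' = orbitSet H m n) {i' : Y → UnitaryCompact H}
  (hi' : ∀ y, j' y = coadjointAction (i' y) (momentumLeft ψ))

/-- A map between two spaces embedded onto the orbit that commutes with the embeddings is smooth. -/
lemma OrbitSlice.contMDiff_of_comp {g : X → Y} (hg : ∀ x, j' (g x) = j x) :
    letI := s.chartedSpace hj hA hi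
    letI := s.chartedSpace hj' hA' hi'
    ContMDiff 𝓘(ℝ, 𝔪) 𝓘(ℝ, 𝔪) ∞ g := by
  let := s.chartedSpace hj hA hi
  let := s.chartedSpace hj' hA' hi'
  have := s.isManifold hj hA hi
  have := s.isManifold hj' hA' hi'
  have hgj : j' ∘ g = j := funext hg
  -- A continuous map into an embedded submanifold is smooth as soon as its composition with the
  -- embedding is.
  rw [ContMDiff.iff_comp_isImmersion (s.isSmoothEmbedding hj' hA' hi').isImmersion, hgj]
  refine ⟨?_, (s.isSmoothEmbedding hj hA hi).contMDiff⟩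
  rw [hj'.continuous_iff, hgj]
  exact hj.continuous

lemma OrbitSlice.mfderiv_comp {g : X → Y} (hg : ∀ x, j' (g x) = j x) (x : X) (v : 𝔪) :
    letI := s.chartedSpace hj hA hi
    letI := s.chartedSpace hj' hA' hi'
    mfderiv 𝓘(ℝ, 𝔪) 𝓘(ℝ, SkewCompactDual H) j' (g x) (mfderiv 𝓘(ℝ, 𝔪) 𝓘(ℝ, 𝔪) g x v) =
      mfderiv 𝓘(ℝ, 𝔪) 𝓘(ℝ, SkewCompactDual H) j x v := by
  let := s.chartedSpace hj hA hi
  let := s.chartedSpace hj' hA' hi'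
  have := s.isManifold hj hA hi
  have := s.isManifold hj' hA' hi'
  have hgd : MDifferentiableAt 𝓘(ℝ, 𝔪) 𝓘(ℝ, 𝔪) g x :=
    (s.contMDiff_of_comp hj hA hi hj' hA' hi' hg).mdifferentiable (by simp) x
  have hjd : MDifferentiableAt 𝓘(ℝ, 𝔪) 𝓘(ℝ, SkewCompactDual H) j' (g x) :=
    (s.isSmoothEmbedding hj' hA' hi').contMDiff.mdifferentiable (by simp) _
  obtain rfl : j = j' ∘ g := funext fun x => (hg x).symm
  exact (DFunLike.congr_fun (_root_.mfderiv_comp x hjd hgd) v).symm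

lemma OrbitSlice.exists_mfderiv_eq (x : X) (v : 𝔪) :
    letI := s.chartedSpace hj hA hi
    ∃ Z, mfderiv 𝓘(ℝ, 𝔪) 𝓘(ℝ, SkewCompactDual H) j x v = coadjointField Z (j x) := by
  let := s.chartedSpace hj hA hi
  refine ⟨adjointAction (i x) v.1, (s.mfderiv_apply hj hA hi x v).trans ?_⟩
  rw [coadjointAction_coadjointField, ← hi]

/-- Both forms are determined by the images of the vectors in the dual Banach space, and g preserves
these. -/
lemma OrbitSlice.twoForm_comp {g : X → Y} (hg : ∀ x, j' (g x) = j x) (x : X) (v w : 𝔪) :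
    letI := s.chartedSpace hj hA hi
    letI := s.chartedSpace hj' hA' hi'
    s.twoForm hj' hA' hi' (g x) ![mfderiv 𝓘(ℝ, 𝔪) 𝓘(ℝ, 𝔪) g x v, mfderiv 𝓘(ℝ, 𝔪) 𝓘(ℝ, 𝔪) g x w] =
      s.twoForm hj hA hi x ![v, w] := by
  obtain ⟨A, hA₀⟩ := s.exists_mfderiv_eq hj hA hi x v
  obtain ⟨B, hB₀⟩ := s.exists_mfderiv_eq hj hA hi x w
  have h1 := s.twoForm_apply hj hA hi x A B v w hA₀ hB₀
  have h2 := s.twoForm_apply hj' hA' hi' (g x) A B _ _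
    ((s.mfderiv_comp hj hA hi hj' hA' hi' hg x v).trans
      (hA₀.trans (congrArg (coadjointField A) (hg x).symm)))
    ((s.mfderiv_comp hj hA hi hj' hA' hi' hg x w).trans
      (hB₀.trans (congrArg (coadjointField B) (hg x).symm)))
  refine h2.trans (Eq.trans ?_ h1.symm)
  rw [hg]

end Comparison

/-! ### The level set as a manifold -/

lemma LevelSet.range_val {H : Type u} [NormedAddCommGroup H] [InnerProductSpace ℂ H] {M N : ℕ}
    {m : Fin M → ℝ} {n : Fin N → ℝ} :
    range (Subtype.val : LevelSet H (weight m n) → TensorSpace H M N) =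
      {φ : TensorSpace H M N | momentumRight φ = weight m n} := Subtype.range_coe

section LevelSlice

variable {H : Type u} [NormedAddCommGroup H] [InnerProductSpace ℂ H] [CompleteSpace H]
  {M N : ℕ} {m : Fin M → ℝ} {n : Fin N → ℝ} {ψ : TensorSpace H M N}
  {𝔪 : Submodule ℝ (SkewCompact H)} {W : Type u} [NormedAddCommGroup W] [NormedSpace ℝ W]

/-- A slice chart of the level set at `ψ` in which the left momentum map is a projection. -/
structure LevelSlice (s : OrbitSlice m n ψ 𝔪 W) (𝔨 : Submodule ℝ (TensorSpace H M N)) where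
  slice : SliceChart {φ : TensorSpace H M N | momentumRight φ = weight m n} (𝔪 × 𝔨)
    (hermitianKernels (Fin M ⊕ Fin N))
  mem_source : ψ ∈ slice.toOpenPartialHomeomorph.source
  fst_eq : ∀ φ, (slice.toOpenPartialHomeomorph φ).1.1 =
    (s.slice.toOpenPartialHomeomorph (momentumLeft φ)).1

namespace LevelSlice

variable {s : OrbitSlice m n ψ 𝔪 W} {𝔨 : Submodule ℝ (TensorSpace H M N)} (t : LevelSlice s 𝔨)

/-- The translates of the slice chart. -/
def translate (U : UnitaryCompact H) :
    SliceChart {φ : TensorSpace H M N | momentumRight φ = weight m n} (𝔪 × 𝔨)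
      (hermitianKernels (Fin M ⊕ Fin N)) :=
  t.slice.translate (leftMulEquiv U) fun φ => by
    refine ⟨fun h => ?_, fun h => ?_⟩
    · have h1 := momentumRight_leftMul U (m := m) (n := n) h
      exact ((congrArg momentumRight ((leftMulEquiv U).apply_symm_apply φ)).symm.trans h1 :)
    · exact momentumRight_leftMul U⁻¹ h

lemma momentumLeft_symm (U : UnitaryCompact H) (φ : TensorSpace H M N) :
    momentumLeft ((leftMulEquiv U).symm φ) = (coadjointEquiv U).symm (momentumLeft φ) := by
  rw [ContinuousLinearEquiv.eq_symm_apply, coadjointEquiv_apply, ← momentumLeft_leftMul]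
  exact congrArg momentumLeft ((leftMulEquiv U).apply_symm_apply φ)

/-- By equivariance, translating both charts by the same unitary keeps the left momentum map a
projection. -/
lemma fst_translate (U : UnitaryCompact H) (φ : TensorSpace H M N) :
    ((t.translate U).toOpenPartialHomeomorph φ).1.1 =
      ((s.translate U).toOpenPartialHomeomorph (momentumLeft φ)).1 := by
  rw [translate, SliceChart.translate_apply, t.fst_eq, momentumLeft_symm]
  rfl

lemma mem_translate_source {U : UnitaryCompact H} {φ : TensorSpace H M N}
    (h : φ = leftMul (U : H →L[ℂ] H) ψ) :
    φ ∈ (t.translate U).toOpenPartialHomeomorph.source := by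
  rw [translate, SliceChart.translate_source, mem_preimage, h, ← leftMulEquiv_apply,
    ContinuousLinearEquiv.symm_apply_apply]
  exact t.mem_source

/-- If X and Y generate v and w, both sides equal `momentumLeft φ` at [X, Y], by
`indefForm_bracket`. -/
lemma twoForm_eq_symplecticForm {E F : Type*} [NormedAddCommGroup E] [NormedSpace ℝ E]
    [NormedAddCommGroup F] [NormedSpace ℝ F] [ChartedSpace E (LevelSet H (weight m n))]
    [ChartedSpace F (ReducedSpace H (weight m n))] (Ω : TwoForm F (ReducedSpace H (weight m n)))
    (φ : LevelSet H (weight m n))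
    (hΩ : ∀ (X Y : SkewCompact H) (v w : F),
      mfderiv 𝓘(ℝ, F) 𝓘(ℝ, SkewCompactDual H) (reducedMomentum (weight m n))
        (toReduced (weight m n) φ) v =
        coadjointField X (reducedMomentum (weight m n) (toReduced (weight m n) φ)) →
      mfderiv 𝓘(ℝ, F) 𝓘(ℝ, SkewCompactDual H) (reducedMomentum (weight m n))
        (toReduced (weight m n) φ) w =
        coadjointField Y (reducedMomentum (weight m n) (toReduced (weight m n) φ)) →
      Ω (toReduced (weight m n) φ) ![v, w] =
        reducedMomentum (weight m n) (toReduced (weight m n) φ) (bracket X Y))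
    (hex : ∀ v : E, ∃ X : SkewCompact H, leftMul (X : H →L[ℂ] H) φ.1 =
        mfderiv 𝓘(ℝ, E) 𝓘(ℝ, TensorSpace H M N)
          (Subtype.val : LevelSet H (weight m n) → TensorSpace H M N) φ v ∧
      mfderiv 𝓘(ℝ, F) 𝓘(ℝ, SkewCompactDual H) (reducedMomentum (weight m n))
        (toReduced (weight m n) φ) (mfderiv 𝓘(ℝ, E) 𝓘(ℝ, F) (toReduced (weight m n)) φ v) =
        coadjointField X (momentumLeft φ.1)) (v w : E) :
    Ω (toReduced (weight m n) φ)
        ![mfderiv 𝓘(ℝ, E) 𝓘(ℝ, F) (toReduced (weight m n)) φ v,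
          mfderiv 𝓘(ℝ, E) 𝓘(ℝ, F) (toReduced (weight m n)) φ w] =
      symplecticForm
        (mfderiv 𝓘(ℝ, E) 𝓘(ℝ, TensorSpace H M N)
          (Subtype.val : LevelSet H (weight m n) → TensorSpace H M N) φ v)
        (mfderiv 𝓘(ℝ, E) 𝓘(ℝ, TensorSpace H M N)
          (Subtype.val : LevelSet H (weight m n) → TensorSpace H M N) φ w) := by
  obtain ⟨X, hX, hX'⟩ := hex v
  obtain ⟨Y, hY, hY'⟩ := hex w
  refine (hΩ X Y _ _ hX' hY').trans ?_
  rw [reducedMomentum_toReduced, indefForm_bracket, hX, hY]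

variable [Nonempty (LevelSet H (weight m n))] {i : LevelSet H (weight m n) → UnitaryCompact H}
  (hi : ∀ φ, φ.1 = leftMul (i φ : H →L[ℂ] H) ψ)

/-- The charted space structure of the level set. -/
@[reducible] def chartedSpace : ChartedSpace (𝔪 × 𝔨) (LevelSet H (weight m n)) :=
  SliceChart.chartedSpace IsEmbedding.subtypeVal LevelSet.range_val t.translate i
    fun φ => t.mem_translate_source (hi φ)

lemma isManifold : letI := t.chartedSpace hi;
    IsManifold 𝓘(ℝ, 𝔪 × 𝔨) ∞ (LevelSet H (weight m n)) :=
  SliceChart.isManifold IsEmbedding.subtypeVal LevelSet.range_val t.translate i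
    fun φ => t.mem_translate_source (hi φ)

lemma isSmoothEmbedding : letI := t.chartedSpace hi;
    Manifold.IsSmoothEmbedding 𝓘(ℝ, 𝔪 × 𝔨) 𝓘(ℝ, TensorSpace H M N) ∞
      (Subtype.val : LevelSet H (weight m n) → TensorSpace H M N) :=
  SliceChart.isSmoothEmbedding IsEmbedding.subtypeVal LevelSet.range_val t.translate i
    fun φ => t.mem_translate_source (hi φ)

/-- The tangent vectors of the level set are generated by the Lie algebra. -/
lemma exists_leftMul_eq_mfderiv (φ : LevelSet H (weight m n)) (v : 𝔪 × 𝔨) :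
    letI := t.chartedSpace hi
    ∃ X : SkewCompact H, leftMul (X : H →L[ℂ] H) φ.1 =
      mfderiv 𝓘(ℝ, 𝔪 × 𝔨) 𝓘(ℝ, TensorSpace H M N)
        (Subtype.val : LevelSet H (weight m n) → TensorSpace H M N) φ v := by
  let := t.chartedSpace hi
  have h1 := SliceChart.mfderiv_eq IsEmbedding.subtypeVal LevelSet.range_val t.translate i
    (fun φ => t.mem_translate_source (hi φ)) φ
  set c := t.translate (i φ)
  have hφ := t.mem_translate_source (hi φ)
  have hy := c.fst_mem_dom hφ φ.2
  have h2 := c.param_fst hφ φ.2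
  obtain ⟨X, hX⟩ := exists_leftMul_eq_fderiv (m := m) (n := n) s.pos_left s.pos_right
    ((c.contDiffOn_param.contDiffAt (c.isOpen_dom.mem_nhds hy)).differentiableAt (by simp))
    (Filter.eventually_of_mem (c.isOpen_dom.mem_nhds hy) fun z hz => c.param_mem hz) v
  rw [h2] at hX
  exact ⟨X, hX.trans (DFunLike.congr_fun h1 v).symm⟩

variable [Nonempty (ReducedSpace H (weight m n))]
  {i' : ReducedSpace H (weight m n) → UnitaryCompact H}
  (hi' : ∀ q, reducedMomentum (weight m n) q = coadjointAction (i' q) (momentumLeft ψ))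

theorem isSubmersion_toReduced :
    letI := t.chartedSpace hi
    letI := s.chartedSpace s.isEmbedding_reducedMomentum
      (range_reducedMomentum s.pos_left s.pos_right) hi'
    Manifold.IsSubmersion 𝓘(ℝ, 𝔪 × 𝔨) 𝓘(ℝ, 𝔪) ∞ (toReduced (H := H) (weight m n)) := by
  let hj := s.isEmbedding_reducedMomentum
  let hA := range_reducedMomentum (H := H) s.pos_left s.pos_right
  let := t.chartedSpace hi
  let := s.chartedSpace hj hA hi'
  have key : Manifold.IsSubmersionOfComplement 𝔨 𝓘(ℝ, 𝔪 × 𝔨) 𝓘(ℝ, 𝔪) ∞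
      (toReduced (H := H) (weight m n)) := by
    intro φ
    -- The chart of the quotient is translated by the unitary of the level set point φ, not by the
    -- one chosen for its class: the projection is linear only for matching translates, and any
    -- chart of the maximal atlas is allowed.
    refine Manifold.IsSubmersionAtOfComplement.mk_of_continuousAt
      (continuous_toReduced _).continuousAt (ContinuousLinearEquiv.refl ℝ (𝔪 × 𝔨))
      ((t.translate (i φ)).chart IsEmbedding.subtypeVal LevelSet.range_val)
      ((s.translate (i φ)).chart hj hA) (t.mem_translate_source (hi φ)) ?_
      (SliceChart.chart_mem_maximalAtlas IsEmbedding.subtypeVal LevelSet.range_val t.translate i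
        (fun φ => t.mem_translate_source (hi φ)) (i φ))
      (SliceChart.chart_mem_maximalAtlas hj hA s.translate i'
        (fun q => s.mem_translate_source (hi' q)) (i φ)) fun y hy => ?_
    · refine s.mem_translate_source ?_
      rw [reducedMomentum_toReduced, hi φ, momentumLeft_leftMul]
    · have hy' : y ∈ (t.translate (i φ)).dom := by simpa [SliceChart.chart_target] using hy
      have h1 := (t.translate (i φ)).apply_chart_symm IsEmbedding.subtypeVal LevelSet.range_val hy'
      have h2 := t.fst_translate (i φ) ((t.translate (i φ)).param y)
      rw [(t.translate (i φ)).apply_param hy', ← h1, ← reducedMomentum_toReduced] at h2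
      exact h2.symm
  exact key.isSubmersion

/-- Chain rule for the two factorizations of `momentumLeft` on the level set, through the quotient
and through S. -/
lemma exists_mfderiv_toReduced (φ : LevelSet H (weight m n)) (v : 𝔪 × 𝔨) :
    letI := t.chartedSpace hi
    letI := s.chartedSpace s.isEmbedding_reducedMomentum
      (range_reducedMomentum s.pos_left s.pos_right) hi'
    ∃ X : SkewCompact H, leftMul (X : H →L[ℂ] H) φ.1 =
        mfderiv 𝓘(ℝ, 𝔪 × 𝔨) 𝓘(ℝ, TensorSpace H M N)
          (Subtype.val : LevelSet H (weight m n) → TensorSpace H M N) φ v ∧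
      mfderiv 𝓘(ℝ, 𝔪) 𝓘(ℝ, SkewCompactDual H) (reducedMomentum (weight m n))
        (toReduced (weight m n) φ) (mfderiv 𝓘(ℝ, 𝔪 × 𝔨) 𝓘(ℝ, 𝔪) (toReduced (weight m n)) φ v) =
        coadjointField X (momentumLeft φ.1) := by
  let hj := s.isEmbedding_reducedMomentum
  let hA := range_reducedMomentum (H := H) s.pos_left s.pos_right
  obtain ⟨X, hX⟩ := t.exists_leftMul_eq_mfderiv hi φ v
  have hs := t.isSubmersion_toReduced hi hi'
  let := t.chartedSpace hi
  let := s.chartedSpace hj hA hi'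
  have := t.isManifold hi
  have := s.isManifold hj hA hi'
  refine ⟨X, hX, ?_⟩
  have hπ : MDifferentiableAt 𝓘(ℝ, 𝔪 × 𝔨) 𝓘(ℝ, 𝔪) (toReduced (H := H) (weight m n)) φ :=
    hs.contMDiff.mdifferentiable (by simp) φ
  have hjd : MDifferentiableAt 𝓘(ℝ, 𝔪) 𝓘(ℝ, SkewCompactDual H)
      (reducedMomentum (H := H) (weight m n)) (toReduced (weight m n) φ) :=
    (s.isSmoothEmbedding hj hA hi').contMDiff.mdifferentiable (by simp) _
  have hval : MDifferentiableAt 𝓘(ℝ, 𝔪 × 𝔨) 𝓘(ℝ, TensorSpace H M N)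
      (Subtype.val : LevelSet H (weight m n) → TensorSpace H M N) φ :=
    (t.isSmoothEmbedding hi).contMDiff.mdifferentiable (by simp) φ
  have hJ : MDifferentiableAt 𝓘(ℝ, TensorSpace H M N) 𝓘(ℝ, SkewCompactDual H)
      (momentumLeft (H := H) (M := M) (N := N)) φ.1 :=
    (contDiff_momentumLeft.differentiable (by simp) φ.1).mdifferentiableAt
  have h1 := DFunLike.congr_fun (mfderiv_comp φ hjd hπ) v
  have h2 := DFunLike.congr_fun (mfderiv_comp φ hJ hval) v
  refine h1.symm.trans (h2.trans ?_)
  rw [mfderiv_eq_fderiv]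
  refine Eq.trans ?_ (fderiv_momentumLeft_leftMul X φ.1)
  exact congrArg (fderiv ℝ momentumLeft φ.1) hX.symm

theorem twoForm_toReduced (φ : LevelSet H (weight m n)) (v w : 𝔪 × 𝔨) :
    letI := t.chartedSpace hi
    letI := s.chartedSpace s.isEmbedding_reducedMomentum
      (range_reducedMomentum s.pos_left s.pos_right) hi'
    s.twoForm s.isEmbedding_reducedMomentum (range_reducedMomentum s.pos_left s.pos_right) hi'
        (toReduced (weight m n) φ)
        ![mfderiv 𝓘(ℝ, 𝔪 × 𝔨) 𝓘(ℝ, 𝔪) (toReduced (weight m n)) φ v,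
          mfderiv 𝓘(ℝ, 𝔪 × 𝔨) 𝓘(ℝ, 𝔪) (toReduced (weight m n)) φ w] =
      symplecticForm
        (mfderiv 𝓘(ℝ, 𝔪 × 𝔨) 𝓘(ℝ, TensorSpace H M N)
          (Subtype.val : LevelSet H (weight m n) → TensorSpace H M N) φ v)
        (mfderiv 𝓘(ℝ, 𝔪 × 𝔨) 𝓘(ℝ, TensorSpace H M N)
          (Subtype.val : LevelSet H (weight m n) → TensorSpace H M N) φ w) := by
  let := t.chartedSpace hi
  let := s.chartedSpace s.isEmbedding_reducedMomentum
    (range_reducedMomentum s.pos_left s.pos_right) hi'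
  exact twoForm_eq_symplecticForm
    (s.twoForm s.isEmbedding_reducedMomentum (range_reducedMomentum s.pos_left s.pos_right) hi') φ
    (s.twoForm_apply s.isEmbedding_reducedMomentum (range_reducedMomentum s.pos_left s.pos_right)
      hi' (toReduced (weight m n) φ)) (t.exists_mfderiv_toReduced hi hi' φ) v w

end LevelSlice

end LevelSlice

/-! ### The symplectic manifolds -/

section Symplectomorphism

variable {H : Type u} [NormedAddCommGroup H] [InnerProductSpace ℂ H] [CompleteSpace H]
  {M N : ℕ} {m : Fin M → ℝ} {n : Fin N → ℝ} {ψ : TensorSpace H M N}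
  {𝔪 : Submodule ℝ (SkewCompact H)} {W : Type u} [NormedAddCommGroup W] [NormedSpace ℝ W]
  (s : OrbitSlice m n ψ 𝔪 W)

theorem OrbitSlice.isOrbitSymplecticManifold [Nonempty (orbitSet H m n)]
    {i : orbitSet H m n → UnitaryCompact H}
    (hi : ∀ f, f.1 = coadjointAction (i f) (momentumLeft ψ)) :
    letI := s.chartedSpace IsEmbedding.subtypeVal Subtype.range_coe hi
    IsOrbitSymplecticManifold (orbitSet H m n) 𝔪
      (s.twoForm IsEmbedding.subtypeVal Subtype.range_coe hi) := by
  let := s.chartedSpace IsEmbedding.subtypeVal Subtype.range_coe hi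
  exact {
    isManifold := s.isManifold IsEmbedding.subtypeVal Subtype.range_coe hi
    isSmoothEmbedding := s.isSmoothEmbedding IsEmbedding.subtypeVal Subtype.range_coe hi
    tangent := s.range_mfderiv IsEmbedding.subtypeVal Subtype.range_coe hi
    isSymplectic := s.isSymplectic IsEmbedding.subtypeVal Subtype.range_coe hi
    kks := s.twoForm_apply IsEmbedding.subtypeVal Subtype.range_coe hi }

variable {s} in
theorem LevelSlice.isMarsdenWeinsteinQuotient {𝔨 : Submodule ℝ (TensorSpace H M N)}
    (t : LevelSlice s 𝔨) [Nonempty (LevelSet H (weight m n))]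
    {i : LevelSet H (weight m n) → UnitaryCompact H}
    (hi : ∀ φ, φ.1 = leftMul (i φ : H →L[ℂ] H) ψ) [Nonempty (ReducedSpace H (weight m n))]
    {i' : ReducedSpace H (weight m n) → UnitaryCompact H}
    (hi' : ∀ q, reducedMomentum (weight m n) q = coadjointAction (i' q) (momentumLeft ψ)) :
    letI := t.chartedSpace hi
    letI := s.chartedSpace s.isEmbedding_reducedMomentum
      (range_reducedMomentum s.pos_left s.pos_right) hi'
    IsMarsdenWeinsteinQuotient (weight m n) (𝔪 × 𝔨) 𝔪
      (s.twoForm s.isEmbedding_reducedMomentum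
        (range_reducedMomentum s.pos_left s.pos_right) hi') := by
  let := t.chartedSpace hi
  let := s.chartedSpace s.isEmbedding_reducedMomentum
    (range_reducedMomentum s.pos_left s.pos_right) hi'
  exact {
    isManifold_levelSet := t.isManifold hi
    isSmoothEmbedding := t.isSmoothEmbedding hi
    isManifold := s.isManifold _ _ hi'
    isSubmersion := t.isSubmersion_toReduced hi hi'
    isSymplectic := s.isSymplectic _ _ hi'
    pullback := t.twoForm_toReduced hi hi' }

/-- The quotient, through `reducedMomentum`, and the orbit, through its inclusion, are embedded onto
the same set. The bijection commuting with the embeddings is smooth in both directions and preserves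
the forms. -/
theorem OrbitSlice.exists_symplectomorphism [Nonempty (orbitSet H m n)]
    {i : orbitSet H m n → UnitaryCompact H}
    (hi : ∀ f, f.1 = coadjointAction (i f) (momentumLeft ψ))
    [Nonempty (ReducedSpace H (weight m n))]
    {i' : ReducedSpace H (weight m n) → UnitaryCompact H}
    (hi' : ∀ q, reducedMomentum (weight m n) q = coadjointAction (i' q) (momentumLeft ψ)) :
    letI := s.chartedSpace IsEmbedding.subtypeVal Subtype.range_coe hi
    letI := s.chartedSpace s.isEmbedding_reducedMomentum
      (range_reducedMomentum s.pos_left s.pos_right) hi'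
    ∃ Φ : Diffeomorph 𝓘(ℝ, 𝔪) 𝓘(ℝ, 𝔪) (ReducedSpace H (weight m n)) (orbitSet H m n) ∞,
      (∀ φ : LevelSet H (weight m n),
        (Φ (toReduced (weight m n) φ) : SkewCompactDual H) = momentumLeft φ.1) ∧
      ∀ (q : ReducedSpace H (weight m n)) (v w : TangentSpace 𝓘(ℝ, 𝔪) q),
        s.twoForm IsEmbedding.subtypeVal Subtype.range_coe hi (Φ q)
            ![mfderiv 𝓘(ℝ, 𝔪) 𝓘(ℝ, 𝔪) Φ q v, mfderiv 𝓘(ℝ, 𝔪) 𝓘(ℝ, 𝔪) Φ q w] =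
          s.twoForm s.isEmbedding_reducedMomentum
            (range_reducedMomentum s.pos_left s.pos_right) hi' q ![v, w] := by
  have hA := range_reducedMomentum (H := H) s.pos_left s.pos_right
  let e : ReducedSpace H (weight m n) ≃ orbitSet H m n :=
    (Equiv.ofInjective _ (reducedMomentum_injective s.pos_left s.pos_right)).trans
      (Equiv.setCongr hA)
  have he (q) : (e q).1 = reducedMomentum (weight m n) q := rfl
  have he' (f) : reducedMomentum (weight m n) (e.symm f) = f.1 := by
    rw [← he, e.apply_symm_apply]
  let := s.chartedSpace IsEmbedding.subtypeVal Subtype.range_coe hi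
  let := s.chartedSpace s.isEmbedding_reducedMomentum hA hi'
  let Φ : Diffeomorph 𝓘(ℝ, 𝔪) 𝓘(ℝ, 𝔪) (ReducedSpace H (weight m n)) (orbitSet H m n) ∞ :=
    { toEquiv := e
      contMDiff_toFun := s.contMDiff_of_comp s.isEmbedding_reducedMomentum hA hi'
        IsEmbedding.subtypeVal Subtype.range_coe hi he
      contMDiff_invFun := s.contMDiff_of_comp IsEmbedding.subtypeVal Subtype.range_coe hi
        s.isEmbedding_reducedMomentum hA hi' he' }
  exact ⟨Φ, fun φ => rfl, fun q v w => s.twoForm_comp s.isEmbedding_reducedMomentum hA hi'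
    IsEmbedding.subtypeVal Subtype.range_coe hi he q v w⟩

end Symplectomorphism

/-- The symplectic manifold structures of the level set, of the reduced space and of the orbit, and
the symplectomorphism between the last two. -/
theorem exists_symplectic_structures {H : Type u} [NormedAddCommGroup H] [InnerProductSpace ℂ H]
    [CompleteSpace H] {M N : ℕ} {m : Fin M → ℝ} {n : Fin N → ℝ} (hm : ∀ i, 0 < m i)
    (hn : ∀ j, 0 < n j) {ψ : TensorSpace H M N} (hψ : momentumRight ψ = weight m n) :
    ∃ (E : Type u) (_ : NormedAddCommGroup E) (_ : NormedSpace ℝ E) (_ : CompleteSpace E)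
      (_ : ChartedSpace E (LevelSet H (weight m n)))
      (F : Type u) (_ : NormedAddCommGroup F) (_ : NormedSpace ℝ F) (_ : CompleteSpace F)
      (_ : ChartedSpace F (ReducedSpace H (weight m n)))
      (G : Type u) (_ : NormedAddCommGroup G) (_ : NormedSpace ℝ G) (_ : CompleteSpace G)
      (_ : ChartedSpace G (orbitSet H m n))
      (ωred : TwoForm F (ReducedSpace H (weight m n))) (ωorb : TwoForm G (orbitSet H m n)),
      IsMarsdenWeinsteinQuotient (weight m n) E F ωred ∧
      IsOrbitSymplecticManifold (orbitSet H m n) G ωorb ∧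
      ∃ Φ : Diffeomorph 𝓘(ℝ, F) 𝓘(ℝ, G) (ReducedSpace H (weight m n)) (orbitSet H m n) ∞,
        (∀ ψ : LevelSet H (weight m n),
          (Φ (toReduced (weight m n) ψ) : SkewCompactDual H) = momentumLeft ψ.1) ∧
        ∀ (q : ReducedSpace H (weight m n)) (v w : TangentSpace 𝓘(ℝ, F) q),
          ωorb (Φ q) ![mfderiv 𝓘(ℝ, F) 𝓘(ℝ, G) Φ q v, mfderiv 𝓘(ℝ, F) 𝓘(ℝ, G) Φ q w] =
            ωred q ![v, w] := by
  obtain ⟨𝔪, 𝔫, h𝔪, htr, c, hc1, hc2, hc3⟩ := exists_sliceChart_orbitSet hm hn hψ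
  obtain ⟨𝔨, h𝔨, c', hc'1, hc'2⟩ :=
    exists_sliceChart_levelSet hm hn hψ hc1 hc2 hc3
  let s : OrbitSlice m n ψ 𝔪 𝔫 := ⟨hm, hn, hψ, htr, c, hc1, hc2, hc3⟩
  let t : LevelSlice s 𝔨 := ⟨c', hc'1, hc'2⟩
  have hA := range_reducedMomentum (H := H) (m := m) (n := n) hm hn
  have : Nonempty (LevelSet H (weight m n)) := ⟨⟨ψ, hψ⟩⟩
  have : Nonempty (ReducedSpace H (weight m n)) := ⟨toReduced _ ⟨ψ, hψ⟩⟩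
  have : Nonempty (orbitSet H m n) :=
    ⟨⟨momentumLeft ψ, (mem_orbitSet_iff hm hn _).2 ⟨ψ, hψ, rfl⟩⟩⟩
  choose i hi using fun φ : LevelSet H (weight m n) =>
    exists_leftMul_unitary_eq hm hn hψ φ.2
  choose i' hi' using fun q : ReducedSpace H (weight m n) =>
    s.exists_coadjointAction_eq (hA ▸ mem_range_self q)
  choose k hk using fun f : orbitSet H m n => s.exists_coadjointAction_eq f.2
  exact ⟨𝔪 × 𝔨, inferInstance, inferInstance, inferInstance, t.chartedSpace fun φ => (hi φ).symm,
    𝔪, inferInstance, inferInstance, inferInstance,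
    s.chartedSpace s.isEmbedding_reducedMomentum
      (range_reducedMomentum s.pos_left s.pos_right) hi',
    𝔪, inferInstance, inferInstance, inferInstance,
    s.chartedSpace IsEmbedding.subtypeVal Subtype.range_coe hk,
    s.twoForm s.isEmbedding_reducedMomentum
      (range_reducedMomentum s.pos_left s.pos_right) hi',
    s.twoForm IsEmbedding.subtypeVal Subtype.range_coe hk,
    t.isMarsdenWeinsteinQuotient (fun φ => (hi φ).symm) hi', s.isOrbitSymplecticManifold hk,
    s.exists_symplectomorphism hk hi'⟩

end

theorem theorem1 {H : Type u} [NormedAddCommGroup H] [InnerProductSpace ℂ H] [CompleteSpace H]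
    [TopologicalSpace.SeparableSpace H] {M N : ℕ} (m : Fin M → ℝ) (n : Fin N → ℝ)
    (hm : Antitone m) (hm_pos : ∀ i, 0 < m i) (hn : Antitone n) (hn_pos : ∀ j, 0 < n j)
    (hdim : ((M + N : ℕ) : Cardinal.{u}) ≤ Module.rank ℂ H) :
    -- the set with the prescribed eigenvalues is one coadjoint orbit
    (∃ f₀ : SkewCompactDual H, orbitSet H m n = coadjointOrbit f₀) ∧
    -- the two maps are momentum maps
    IsMomentumMap (H := H) (fun (X : PseudoSkew M N) ψ => rightMul ψ (X : Matrix _ _ ℂ))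
      (fun ψ X => momentumRight ψ X) ∧
    IsMomentumMap (M := M) (N := N) (fun (Y : SkewCompact H) ψ => leftMul (Y : H →L[ℂ] H) ψ)
      (fun ψ Y => momentumLeft ψ Y) ∧
    -- the symplectic manifolds
    ∃ (E : Type u) (_ : NormedAddCommGroup E) (_ : NormedSpace ℝ E) (_ : CompleteSpace E)
      (_ : ChartedSpace E (LevelSet H (weight m n)))
      (F : Type u) (_ : NormedAddCommGroup F) (_ : NormedSpace ℝ F) (_ : CompleteSpace F)
      (_ : ChartedSpace F (ReducedSpace H (weight m n)))
      (G : Type u) (_ : NormedAddCommGroup G) (_ : NormedSpace ℝ G) (_ : CompleteSpace G)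
      (_ : ChartedSpace G (orbitSet H m n))
      (ωred : TwoForm F (ReducedSpace H (weight m n))) (ωorb : TwoForm G (orbitSet H m n)),
      IsMarsdenWeinsteinQuotient (weight m n) E F ωred ∧
      IsOrbitSymplecticManifold (orbitSet H m n) G ωorb ∧
      -- the quotient of the left momentum map is a symplectomorphism
      ∃ Φ : Diffeomorph 𝓘(ℝ, F) 𝓘(ℝ, G) (ReducedSpace H (weight m n)) (orbitSet H m n) ∞,
        (∀ ψ : LevelSet H (weight m n),
          (Φ (toReduced (weight m n) ψ) : SkewCompactDual H) = momentumLeft ψ.1) ∧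
        ∀ (q : ReducedSpace H (weight m n)) (v w : TangentSpace 𝓘(ℝ, F) q),
          ωorb (Φ q) ![mfderiv 𝓘(ℝ, F) 𝓘(ℝ, G) Φ q v, mfderiv 𝓘(ℝ, F) 𝓘(ℝ, G) Φ q w] =
            ωred q ![v, w] := by
  obtain ⟨ψ, hψ⟩ := nonempty_levelSet (H := H) hm_pos hn_pos hdim
  exact ⟨⟨momentumLeft ψ, orbitSet_eq_coadjointOrbit hm_pos hn_pos hψ⟩,
    isMomentumMap_momentumRight, isMomentumMap_momentumLeft,
    exists_symplectic_structures hm_pos hn_pos hψ⟩
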